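/- **Setting.** Let $(\mathcal X,d)$ be a compact metric space with a binary tree of partitions: for every $h\ge 0$ there are points $x_{h,i}$ and cells $\mathcal X_{h,i}$, $0\le i<2^h$, such that the cells of depth $h$ are pairwise disjoint with union $\mathcal X$, $\mathcal X_{h,i}=\mathcal X_{h+1,2i}\cup\mathcal X_{h+1,2i+1}$ (so $x_{h,i}$ is the parent of $x_{h+1,2i},x_{h+1,2i+1}$), and $B(x_{h,i},v_2\rho^h)\subset\mathcal X_{h,i}\subset B(x_{h,i},v_1\rho^h)$, with constants $0<v_2\le1\le v_1$, $0<\rho<1$. Let $D_m$ be the metric dimension, i.e. the infimum of the $a>0$ such that the $r$-covering number of $\mathcal X$ is $\le Cr^{-a}$ for some $C$ and all $r\in(0,1]$ (it is finite). Let $k$ be a covariance function on $\mathcal X$ with $d_k(x,y)=(k(x,x)+k(y,y)-2k(x,y))^{1/2}$ such that * (C1) $d_k(x,y)\le g(d(x,y))$ for a continuous non-decreasing $g:[0,\infty)\to[0,\infty)$ with $g(0)=0$; * (C2) $g(r)\le C_kr^\alpha$ for $0\le r\le\delta_k$, where $C_k,\delta_k>0$, $0<\alpha\le1$. Let $f$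 be a zero-mean Gaussian process $GP(0,k)$ with almost surely continuous paths. Evaluating $f$ at $x$ returns $f(x)+\eta$, the errors $\eta$ of successive evaluations being i.i.d. $N(0,\sigma^2)$, $\sigma>0$ known, and independent of $f$. Let $\tau>0$, $S_\tau=\{x:f(x)\ge\tau\}$, and $\mathcal L(S',S_\tau)=\sup_{x\in S'\triangle S_\tau}|f(x)-\tau|$ (with $\sup\emptyset=0$). **Parameters.** For a budget $n$ and $\delta\in(0,1)$ let $\bar\rho=\max\{\rho,1/2\}$, $h_{\max}=\frac{\log n}{2\alpha\log(1/\bar\rho)}$, $\beta_n=\sqrt{2\log\big(2n^{1+2/(2\alpha\log(1/\bar\rho))}\big)+2\log(1/\delta)}$, $\delta_h=\delta/(2^hh_{\max})$ and $$V_h=g(v_1\rho^h)\Big(\sqrt{C_2+2\log(1/\delta_h)+4\tfrac{D_m}{\alpha}\log\big(1/g(v_1\rho^h)\big)}+C_3\Big)$$ (with $V_h=0$ if $g(v_1\rho^h)=0$), where $C_2,C_3$ are constants. **Algorithm.** Start with the active set $\{x_{0,0}\}$ and $\hat S=\hat R=\emptyset$. While fewer than $n$ evaluations have been made and the active set is nonempty,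 perform an iteration. Let $\mu,\sigma(\cdot)$ be the current posterior mean and standard deviation of $f$ given the observations made so far. For each node put $$u(x_{h,i})=\min\{\mu(x_{h,i})+\beta_n\sigma(x_{h,i}),\ \mu(p)+\beta_n\sigma(p)+V_{h-1}\}+V_h,$$ $$l(x_{h,i})=\max\{\mu(x_{h,i})-\beta_n\sigma(x_{h,i}),\ \mu(p)-\beta_n\sigma(p)-V_{h-1}\}-V_h,$$ where $p$ is the parent of $x_{h,i}$ (for $h=0$ only the first entry is used), and let $\bar u$, $\bar l$ be the minimum of $u$ and the maximum of $l$ over all iterations so far. Each active $x_{h,i}$ with $\bar l\ge\tau$ is made inactive and its cell is added to $\hat S$; each other active $x_{h,i}$ with $\bar u<\tau$ is made inactive and its cell is added to $\hat R$. If nothing is active any more, stop. Otherwise select an active $x_{h,i}$ maximizing $\max(\bar u-\tau,\tau-\bar l)$, with ties broken by any measurable rule that depends only on the past. If $\beta_n\sigma(x_{h,i})<V_h$ and $h\le h_{\max}$, replace $x_{h,i}$ by its two children in the active set; otherwise evaluate $f$ at $x_{h,i}$. The output is $\hat S_\tau=\hat S$ at the end. Let $\mathcal D_n$ be the sequence of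 evaluated points, $J_n$ the sum over the evaluations of the posterior variance, just before the evaluation, at the evaluated point, and $I(y_{\mathcal D};f_{\mathcal D})$ the mutual information between the noisy observations and the values of $f$ at a design $\mathcal D$. **Local dimension.** Let $M(S,r)$ be the largest number of points of $S$ with mutual distances $\ge r$. For $r>0$ let $h_r=\max\{h\ge0:v_2\rho^h\ge r\}$ ($h_r=0$ if there is no such $h$), $\zeta(r)=\{x:|f(x)-\tau|\le10V_{h_r}\}$, and let $\tilde D$ be the infimum of the $a>0$ such that $M(\zeta(r),r)\le Cr^{-a}$ for some $C$ and all $r\in(0,1]$ (a random variable). **Theorem.** There are thresholds depending only on $\mathcal X$, its tree of partitions, $k$, $g$, $\alpha$, $\delta_k$ and $C_k$ such that the following holds for all constants $C_2,C_3$ above them. For all $\sigma,\tau>0$ and $\delta\in(0,1)$ there are constants $K,p,C_1,N$ (depending on the data above, but not on $n$ or the realization) such that for every $n\ge N$, with probability at least $1-2\delta$, the algorithm terminates and 1. $\mathcal L(\hat S_\tau,S_\tau)\le K(1+C)(\log n)^p\,n^{-\alpha/(\tilde D+\varepsilon+2\alpha)}$ for all $\varepsilon\ge0$, $C\ge0$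 with $\tilde D+\varepsilon>0$ and $M(\zeta(r),r)\le C\,r^{-(\tilde D+\varepsilon)}$ for all $r\in(0,1]$ (such a $C$ exists for every $\varepsilon>0$, and for $\varepsilon=0$ if the infimum defining $\tilde D$ is attained); 2. $\mathcal L(\hat S_\tau,S_\tau)\le K(\log n)^p\,\beta_n\sqrt{J_n/n}$; 3. $J_n\le C_1\,I(y_{\mathcal D_n};f_{\mathcal D_n})$, where the right-hand side is the mutual information $I(y_{\mathcal D};f_{\mathcal D})$ of a fixed design, at the realized sequence of evaluated points $\mathcal D=\mathcal D_n$. -/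

import Mathlib

open MeasureTheory ProbabilityTheory Set
open scoped NNReal ENNReal Matrix

universe u v
noncomputable section

namespace GPLevelSet

/-! ### Index space -/

/-- A node of the binary tree: `(h, i)` is the `i`-th node of depth `h`, `0 ≤ i < 2 ^ h`. -/
abbrev Node : Type := ℕ × ℕ

/-- The parent of `(h, i)` is `(h - 1, i / 2)`; the children of `(h, i)` are `(h + 1, 2 i)` and
`(h + 1, 2 i + 1)`. -/
def Node.parent (v : Node) : Node := (v.1 - 1, v.2 / 2)

/-- The two children of a node. -/
def Node.children (v : Node) : Finset Node := {(v.1 + 1, 2 * v.2), (v.1 + 1, 2 * v.2 + 1)}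

/-- A binary tree of partitions of a metric space: at depth `h` the cells `cell (h, i)`, `i < 2 ^ h`,
partition the space, every cell is the union of its two children, and cells of depth `h` contain a
ball of radius `v₂ ρ ^ h` and lie in a ball of radius `v₁ ρ ^ h` around their centers.
(The `2 ^ h` centers of depth `h` are then distinct, since every center lies in its own cell.) -/
structure PartitionTree (X : Type*) [MetricSpace X] where
  center : Node → X
  cell : Node → Set X
  v₁ : ℝ
  v₂ : ℝ
  ρ : ℝ
  v₂_pos : 0 < v₂
  v₂_le_one : v₂ ≤ 1
  one_le_v₁ : 1 ≤ v₁
  ρ_pos : 0 < ρ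
  ρ_lt_one : ρ < 1
  cover : ∀ h : ℕ, ⋃ i ∈ Finset.range (2 ^ h), cell (h, i) = Set.univ
  disjoint : ∀ h i j : ℕ, i < 2 ^ h → j < 2 ^ h → i ≠ j → Disjoint (cell (h, i)) (cell (h, j))
  split : ∀ h i : ℕ, i < 2 ^ h → cell (h + 1, 2 * i) ∪ cell (h + 1, 2 * i + 1) = cell (h, i)
  inner : ∀ h i : ℕ, i < 2 ^ h → Metric.ball (center (h, i)) (v₂ * ρ ^ h) ⊆ cell (h, i)
  outer : ∀ h i : ℕ, i < 2 ^ h → cell (h, i) ⊆ Metric.ball (center (h, i)) (v₁ * ρ ^ h)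

/-- The metric dimension: infimum of the `a > 0` for which the `r`-covering number is at most
`C r ^ (-a)` for some `C` and all small radii (`0 < r ≤ 1`). -/
def metricDim (X : Type*) [MetricSpace X] : ℝ :=
  sInf {a : ℝ | 0 < a ∧ ∃ C : ℝ, ∀ r : ℝ, 0 < r → r ≤ 1 →
    ((Metric.coveringNumber r.toNNReal (Set.univ : Set X) : ℕ∞) : ℝ≥0∞)
      ≤ ENNReal.ofReal (C * r ^ (-a))}

/-- The `r`-packing number of `S`: largest cardinality of a subset of `S` whose distinct points are
at distance at least `r` (non-strict, unlike `Metric.packingNumber`). -/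
def packingNumber {X : Type*} [MetricSpace X] (S : Set X) (r : ℝ) : ℕ∞ :=
  ⨆ (Z : Set X) (_ : Z ⊆ S) (_ : Z.Pairwise fun x y => r ≤ dist x y), Z.encard

/-- `M(ζ(r), r) ≤ C r ^ (-a)` for all `0 < r ≤ 1`. -/
def HasPackingBound {X : Type*} [MetricSpace X] (ζ : ℝ → Set X) (a C : ℝ) : Prop :=
  ∀ r : ℝ, 0 < r → r ≤ 1 →
    ((packingNumber (ζ r) r : ℕ∞) : ℝ≥0∞) ≤ ENNReal.ofReal (C * r ^ (-a))

/-- The dimension associated with the mapping `ζ`. -/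
def localDim {X : Type*} [MetricSpace X] (ζ : ℝ → Set X) : ℝ :=
  sInf {a : ℝ | 0 < a ∧ ∃ C : ℝ, HasPackingBound ζ a C}

/-! ### Gaussian processes and posteriors -/

/-- `k` is a covariance function: symmetric and positive semidefinite. -/
def IsCovarianceFunction {X : Type*} (k : X → X → ℝ) : Prop :=
  ∀ (m : ℕ) (x : Fin m → X), (Matrix.of fun i j => k (x i) (x j)).PosSemidef

/-- The canonical (pseudo-)metric of a covariance function. -/
def canonicalDist {X : Type*} (k : X → X → ℝ) (x y : X) : ℝ :=
  √(k x x + k y y - 2 * k x y)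

/-- `f` is a zero mean Gaussian process with covariance function `k`. -/
structure IsCenteredGP {X Ω : Type*} [MeasurableSpace Ω] (k : X → X → ℝ) (f : X → Ω → ℝ)
    (P : Measure Ω) : Prop where
  measurable : ∀ x, Measurable (f x)
  gaussian : IsGaussianProcess f P
  mean : ∀ x, ∫ ω, f x ω ∂P = 0
  cov : ∀ x y, covariance (f x) (f y) P = k x y

/-- `η` is a sequence of independent `N(0, σ²)` variables, independent of the process `f`. -/
structure IsNoise {X Ω : Type*} [MeasurableSpace Ω] (σ : ℝ) (f : X → Ω → ℝ) (η : ℕ → Ω → ℝ)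
    (P : Measure Ω) : Prop where
  measurable : ∀ j, Measurable (η j)
  law : ∀ j, P.map (η j) = gaussianReal 0 (σ ^ 2).toNNReal
  indep : iIndepFun η P
  indep_process : IndepFun (fun ω (x : X) => f x ω) (fun ω (j : ℕ) => η j ω) P

/-- The matrix `k(x_D, x_D) + σ² I` of the first `m` evaluation points. -/
def gramNoise {X : Type*} (k : X → X → ℝ) (σ : ℝ) (m : ℕ) (p : ℕ → X) :
    Matrix (Fin m) (Fin m) ℝ :=
  (Matrix.of fun i j : Fin m => k (p i) (p j)) + σ ^ 2 • (1 : Matrix (Fin m) (Fin m) ℝ)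

/-- Posterior mean at `x` given the observations `y 0, …, y (m - 1)` at `p 0, …, p (m - 1)`. -/
def postMean {X : Type*} (k : X → X → ℝ) (σ : ℝ) (m : ℕ) (p : ℕ → X) (y : ℕ → ℝ) (x : X) : ℝ :=
  (fun i : Fin m => k x (p i)) ⬝ᵥ ((gramNoise k σ m p)⁻¹ *ᵥ fun i : Fin m => y i)

/-- Posterior variance at `x` given observations at `p 0, …, p (m - 1)`. -/
def postVar {X : Type*} (k : X → X → ℝ) (σ : ℝ) (m : ℕ) (p : ℕ → X) (x : X) : ℝ :=
  k x x - (fun i : Fin m => k x (p i)) ⬝ᵥ ((gramNoise k σ m p)⁻¹ *ᵥ fun i : Fin m => k (p i) x)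

/-- Posterior standard deviation. -/
def postStd {X : Type*} (k : X → X → ℝ) (σ : ℝ) (m : ℕ) (p : ℕ → X) (x : X) : ℝ :=
  √(postVar k σ m p x)

/-- Mutual information (in nats) of two random variables. -/
def mutualInfo {Ω A B : Type*} [MeasurableSpace Ω] [MeasurableSpace A] [MeasurableSpace B]
    (P : Measure Ω) (U : Ω → A) (V : Ω → B) : ℝ≥0∞ :=
  InformationTheory.klDiv (P.map fun ω => (U ω, V ω)) ((P.map U).prod (P.map V))

/-- The information gain `I(y_D; f_D)` of a design `D = (p 0, …, p (m - 1))`: the mutual information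
of the noisy observations at these points and the values of the process at these points. -/
def infoGain {X Ω : Type*} [MeasurableSpace Ω] (P : Measure Ω) (f : X → Ω → ℝ) (η : ℕ → Ω → ℝ)
    (m : ℕ) (p : ℕ → X) : ℝ≥0∞ :=
  mutualInfo P (fun ω (i : Fin m) => f (p i) ω + η i ω) (fun ω (i : Fin m) => f (p i) ω)

/-! ### The algorithm -/

/-- The inputs of the algorithm. -/
structure Inputs (X : Type*) [MetricSpace X] where
  tree : PartitionTree X
  /-- covariance function -/
  k : X → X → ℝ
  /-- noise standard deviation -/
  σ : ℝ
  /-- threshold -/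
  τ : ℝ
  /-- budget of function evaluations -/
  n : ℕ
  /-- scaling of the confidence intervals -/
  β : ℝ
  /-- bounds on the variation of the function in the cells of depth `h` -/
  V : ℕ → ℝ
  /-- maximal depth of a cell that may be refined -/
  hmax : ℝ

/-- The state of the algorithm. -/
structure State (X : Type*) where
  active : Finset Node
  /-- the estimate of the superlevel set -/
  inSet : Set X
  /-- the rejected part of the space -/
  outSet : Set X
  numEvals : ℕ
  /-- node evaluated in the `j`-th evaluation, `j < numEvals` -/
  node : ℕ → Node
  /-- result of the `j`-th evaluation, `j < numEvals`; zero for larger `j` -/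
  obs : ℕ → ℝ
  /-- running upper bounds -/
  upper : Node → ℝ
  /-- running lower bounds -/
  lower : Node → ℝ

section Algorithm

variable {X : Type*} [MetricSpace X]

/-- The evaluation points of a state. -/
def State.point (A : Inputs X) (s : State X) (j : ℕ) : X := A.tree.center (s.node j)

/-- Current posterior mean at (the center of) a node. -/
def State.mean (A : Inputs X) (s : State X) (v : Node) : ℝ :=
  postMean A.k A.σ s.numEvals (s.point A) s.obs (A.tree.center v)

/-- Current posterior standard deviation at (the center of) a node. -/
def State.std (A : Inputs X) (s : State X) (v : Node) : ℝ :=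
  postStd A.k A.σ s.numEvals (s.point A) (A.tree.center v)

/-- The upper bound `u_t` for the function on the cell of `v`, from the current posterior. The root
has no parent. -/
def State.currUpper (A : Inputs X) (s : State X) (v : Node) : ℝ :=
  (if v.1 = 0 then s.mean A v + A.β * s.std A v
    else min (s.mean A v + A.β * s.std A v)
      (s.mean A v.parent + A.β * s.std A v.parent + A.V (v.1 - 1))) + A.V v.1

/-- The lower bound `l_t` for the function on the cell of `v`, from the current posterior. -/
def State.currLower (A : Inputs X) (s : State X) (v : Node) : ℝ :=
  (if v.1 = 0 then s.mean A v - A.β * s.std A v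
    else max (s.mean A v - A.β * s.std A v)
      (s.mean A v.parent - A.β * s.std A v.parent - A.V (v.1 - 1))) - A.V v.1

/-- The state before the bounds are initialized: only the root is active. -/
def State.blank (X : Type*) : State X where
  active := {(0, 0)}
  inSet := ∅
  outSet := ∅
  numEvals := 0
  node := fun _ => (0, 0)
  obs := fun _ => 0
  upper := fun _ => 0
  lower := fun _ => 0

/-- Initial state; the running bounds start from the bounds given by the prior (the first iteration
then sets `ū₁ = u₁`, `l̄₁ = l₁`). -/
def State.init (A : Inputs X) : State X :=
  { State.blank X with
    upper := (State.blank X).currUpper A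
    lower := (State.blank X).currLower A }

/-- First part of an iteration: `ū_t = min (ū_{t-1}, u_t)` and `l̄_t = max (l̄_{t-1}, l_t)`. -/
def State.updateBounds (A : Inputs X) (s : State X) : State X :=
  { s with
    upper := fun v => min (s.upper v) (s.currUpper A v)
    lower := fun v => max (s.lower v) (s.currLower A v) }

/-- Second part of an iteration: active cells with `l̄ ≥ τ` are added to the estimate; the other
active cells with `ū < τ` are rejected; both are removed from the active set. -/
def State.classify (A : Inputs X) (s : State X) : State X :=
  { s with
    inSet := s.inSet ∪ ⋃ v ∈ s.active.filter (fun v => A.τ ≤ s.lower v), A.tree.cell v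
    outSet := s.outSet ∪
      ⋃ v ∈ s.active.filter (fun v => ¬ A.τ ≤ s.lower v ∧ s.upper v < A.τ), A.tree.cell v
    active := s.active.filter (fun v => ¬ A.τ ≤ s.lower v ∧ ¬ s.upper v < A.τ) }

/-- The selection index `max (ū - τ, τ - l̄)`. -/
def State.index (A : Inputs X) (s : State X) (v : Node) : ℝ :=
  max (s.upper v - A.τ) (A.τ - s.lower v)

/-- The active nodes of maximal index. -/
def State.argmax (A : Inputs X) (s : State X) : Finset Node :=
  s.active.filter (fun v => ∀ w ∈ s.active, s.index A w ≤ s.index A v)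

/-- Third part of an iteration: the selected node `v` is refined or evaluated. The `j`-th evaluation
returns `F x + ε j`. -/
def State.act (A : Inputs X) (F : X → ℝ) (ε : ℕ → ℝ) (s : State X) (v : Node) : State X :=
  if A.β * s.std A v < A.V v.1 ∧ (v.1 : ℝ) ≤ A.hmax then
    { s with active := s.active.erase v ∪ v.children }
  else
    { s with
      node := Function.update s.node s.numEvals v
      obs := Function.update s.obs s.numEvals (F (A.tree.center v) + ε s.numEvals)
      numEvals := s.numEvals + 1 }

/-- The algorithm stops when the budget is used, or when nothing is left to select. -/
def State.Halted (A : Inputs X) (s : State X) : Prop := s.numEvals = A.n ∨ s.active = ∅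

open Classical in
/-- One iteration; `sel` picks one of the active nodes of maximal index, given the observations made
so far. -/
def State.step (A : Inputs X) (sel : (ℕ → ℝ) → Finset Node → Node) (F : X → ℝ) (ε : ℕ → ℝ)
    (s : State X) : State X :=
  if s.Halted A then s
  else
    let s' := (s.updateBounds A).classify A
    if s'.active = ∅ then s' else s'.act A F ε (sel s'.obs (s'.argmax A))

/-- The state after `t` iterations, for the function `F` and the noise sequence `ε`. -/
def run (A : Inputs X) (sel : ℕ → (ℕ → ℝ) → Finset Node → Node) (F : X → ℝ) (ε : ℕ → ℝ) :
    ℕ → State X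
  | 0 => State.init A
  | t + 1 => (run A sel F ε t).step A (sel t) F ε

/-- `J_n`: the sum over the evaluations of the posterior variance, at the time of the evaluation
and given the previous observations, at the evaluated point. -/
def sumPostVar (A : Inputs X) (s : State X) : ℝ :=
  ∑ j ∈ Finset.range s.numEvals, postVar A.k A.σ j (s.point A) (s.point A j)

end Algorithm

/-- A (measurable) rule for breaking ties in the argmax: at iteration `t`, given the observations
`y` made so far, it picks an element of the set of maximizers. -/
structure IsTieBreaking (sel : ℕ → (ℕ → ℝ) → Finset Node → Node) : Prop where
  mem : ∀ t y S, S.Nonempty → sel t y S ∈ S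
  measurable : ∀ t S, Measurable fun y => sel t y S

/-! ### Choice of the parameters, loss -/

section Parameters

variable {X : Type*} [MetricSpace X]

/-- `ρ̄ = max (ρ, 1/2)`. -/
def rhoBar (T : PartitionTree X) : ℝ := max T.ρ (1 / 2)

/-- `h_max = log n / (2 α log (1 / ρ̄))`. -/
def maxDepth (T : PartitionTree X) (α : ℝ) (n : ℕ) : ℝ :=
  Real.log n / (2 * α * Real.log (1 / rhoBar T))

/-- `β_n = √(2 log (2 n ^ (1 + 2 / (2 α log (1 / ρ̄)))) + 2 log (1 / δ))`. -/
def betaParam (T : PartitionTree X) (α δ : ℝ) (n : ℕ) : ℝ :=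
  √(2 * Real.log (2 * (n : ℝ) ^ (1 + 2 / (2 * α * Real.log (1 / rhoBar T))))
    + 2 * Real.log (1 / δ))

/-- `δ_h = δ / (2 ^ h h_max)`. -/
def deltaParam (T : PartitionTree X) (α δ : ℝ) (n h : ℕ) : ℝ := δ / (2 ^ h * maxDepth T α n)

/-- `V_h = g(v₁ρ^h) (√(C₂ + 2 log (1 / δ_h) + 4 D' log (1 / g(v₁ρ^h))) + C₃)`, where `D' = D / α` and
`D` is the metric dimension. -/
def varParam (T : PartitionTree X) (g : ℝ → ℝ) (α C₂ C₃ δ : ℝ) (n h : ℕ) : ℝ :=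
  g (T.v₁ * T.ρ ^ h) *
    (√(C₂ + 2 * Real.log (1 / deltaParam T α δ n h)
        + 4 * (metricDim X / α) * Real.log (1 / g (T.v₁ * T.ρ ^ h))) + C₃)

/-- The inputs of the algorithm with the prescribed parameters. -/
def inputs (T : PartitionTree X) (k : X → X → ℝ) (g : ℝ → ℝ) (α C₂ C₃ σ τ δ : ℝ) (n : ℕ) :
    Inputs X where
  tree := T
  k := k
  σ := σ
  τ := τ
  n := n
  β := betaParam T α δ n
  V := varParam T g α C₂ C₃ δ n
  hmax := maxDepth T α n

/-- `h_r = max {h ≥ 0 : v₂ ρ ^ h ≥ r}` (and `0` if there is no such `h`). -/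
def scaleDepth (T : PartitionTree X) (r : ℝ) : ℕ := sSup {h : ℕ | r ≤ T.v₂ * T.ρ ^ h}

/-- The near-threshold region `ζ(r) = {x : |f x - τ| ≤ 10 V_{h_r}}`. -/
def nearThreshold (A : Inputs X) (F : X → ℝ) (r : ℝ) : Set X :=
  {x | |F x - A.τ| ≤ 10 * A.V (scaleDepth A.tree r)}

end Parameters

/-- The superlevel set `{x : f x ≥ τ}`. -/
def superlevel {X : Type*} (F : X → ℝ) (τ : ℝ) : Set X := {x | τ ≤ F x}

/-- The loss `sup {|f x - τ| : x ∈ S' ∆ S_τ}` of an estimate `S'` of the superlevel set (with values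
in `[0, ∞]`; the supremum over the empty set is `0`). -/
def levelSetLoss {X : Type*} (F : X → ℝ) (τ : ℝ) (S' : Set X) : ℝ≥0∞ :=
  ⨆ x ∈ symmDiff S' (superlevel F τ), ENNReal.ofReal |F x - τ|

end GPLevelSet

end

/-!
The loss is controlled by following a single random event, on which everything else is deterministic.

*The event.* Two things have to hold: all credible intervals `|f - μ| ≤ β σ` at the nodes of depth at
most `H + 1`, `H = ⌊h_max⌋`, as long as the budget is not used; and `|f x - f x_{h,i}| ≤ V_h` on the
cells of these depths. For a fixed design the posterior error is a Gaussian variable independent of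
the observations. The run is a measurable function of the observations (`measurableState_run`), so
the event that a given design occurs depends only on observations at that design, and summing over
the countably many designs extends the Gaussian tail bound to the adaptive design
(`measure_posterior_error`, `measure_posteriorFailure_le`). The variation in the cells is bounded by
chaining along the tree (`exists_thresholds`): from the center of a cell one first jumps to the
descendants at a scale smaller by a factor `θ` of order `(log (1 / δ_h))^(-1/2)`, then descends one
level at a time, so that only the first jump contributes the square root in `V_h`. The count of the
descendants is expressed through the metric dimension, which the tree determines (`metricDim_eq`).
The two failure probabilities are at most `δ` each.

*The run.* On this event the set estimates are correct, and the loss is at most the largest index of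
an active node (`Invariant.loss_le`). The invariants (`Invariant`, `invariant_run`) keep for each
evaluation its index `I`, which satisfies `I ≤ 2 β σ + 2 V_h` with `V_h ≤ β σ` unless `h = H + 1`, and
which dominates up to the factor `6 Γ`, `Γ` of order `√(log n)`, the index of every node active later.
So the final loss `Λ` is at most a multiple of `β σ_j + V_{H+1}` for each evaluation `j`. Averaging
over `j` with the Cauchy–Schwarz inequality gives the second bound; the term `V_{H+1}`, of order
`n^(-1/2)` up to logarithms, is absorbed since the first evaluation alone gives `J ≥ τ² / (4 β²)`
(`Invariant.index_le_sqrt`, `Invariant.tau_le`).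

*Dimension.* A node that is evaluated `q` times has posterior variance `O(1 / q)`, so each node
receives `O(β² / Λ²)` evaluations up to logarithms. The parent of an evaluated node of depth `h` lies
near the threshold, so there are at most `2 C (v₂ ρ^(h-1))^(-a)` evaluated nodes of depth `h`, and the
deepest one has `Λ ≲ V_{h-1} ≲ ρ^(α (h-1))`. These relations (`Invariant.exists_scale`) give
`n Λ² ≲ (1 + C) Λ^(-a/α)`, that is the first bound (`le_rate_of_scale`). An evaluation at depth
`H + 1` even forces `Λ ≲ n^(-1/2)`.

*Information.* For a fixed design, the Donsker–Varadhan inequality with the logarithm of the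
likelihood ratio of the observations as test function gives
`I(y; f) ≥ ½ ∑ log (1 + σ_j² / σ²)`, from which the third bound follows (`sum_log_le_infoGain`,
`sum_postVar_le_infoGain`).
-/

namespace GPLevelSet

/-! ### Posterior variance of a Gaussian process -/

section Posterior

variable {X : Type*} {k : X → X → ℝ}

lemma IsCovarianceFunction.symm (hk : IsCovarianceFunction k) (x y : X) : k x y = k y x := by
  simpa using (hk 2 ![x, y]).isHermitian.apply 1 0

lemma IsCovarianceFunction.quadratic_nonneg (hk : IsCovarianceFunction k) (x y : X) (a b : ℝ) :
    0 ≤ a ^ 2 * k x x + 2 * a * b * k x y + b ^ 2 * k y y := by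
  have h := (hk 2 ![x, y]).dotProduct_mulVec_nonneg ![a, b]
  have hs := hk.symm x y
  simp [dotProduct, Matrix.mulVec, Fin.sum_univ_two] at h
  rw [← hs] at h
  linarith

lemma IsCovarianceFunction.self_nonneg (hk : IsCovarianceFunction k) (x : X) : 0 ≤ k x x := by
  have := hk.quadratic_nonneg x x 1 0
  simpa using this

/-- The variance at a point is controlled by the variance at another point and the canonical
distance between them. -/
lemma IsCovarianceFunction.self_le (hk : IsCovarianceFunction k) {x y : X} {r : ℝ}
    (hr : canonicalDist k x y ≤ r) : k x x ≤ 2 * k y y + 2 * r ^ 2 := by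
  have h1 := hk.quadratic_nonneg x y 1 (-2)
  have h2 : k x x + k y y - 2 * k x y ≤ r ^ 2 := (Real.sqrt_le_left
    ((Real.sqrt_nonneg _).trans hr)).1 hr
  linarith

lemma gramNoise_posDef (hk : IsCovarianceFunction k) {σ : ℝ} (hσ : 0 < σ) (m : ℕ) (p : ℕ → X) :
    (gramNoise k σ m p).PosDef :=
  Matrix.PosDef.posSemidef_add (hk m fun i => p i) (Matrix.PosDef.one.smul (by positivity))

/-- The coefficients of the posterior mean as a linear function of the observations. -/
noncomputable def postWeights (k : X → X → ℝ) (σ : ℝ) (m : ℕ) (p : ℕ → X) (x : X) : Fin m → ℝ :=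
  (fun i : Fin m => k x (p i)) ᵥ* (gramNoise k σ m p)⁻¹

lemma postMean_eq (σ : ℝ) (m : ℕ) (p : ℕ → X) (y : ℕ → ℝ) (x : X) :
    postMean k σ m p y x = ∑ i : Fin m, postWeights k σ m p x i * y i := by
  rw [postMean, Matrix.dotProduct_mulVec]
  rfl

lemma postVar_eq (σ : ℝ) (m : ℕ) (p : ℕ → X) (x : X) :
    postVar k σ m p x = k x x - ∑ i : Fin m, postWeights k σ m p x i * k (p i) x := by
  rw [postVar, Matrix.dotProduct_mulVec]
  rfl

lemma postWeights_vecMul (hk : IsCovarianceFunction k) {σ : ℝ} (hσ : 0 < σ) (m : ℕ) (p : ℕ → X)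
    (x : X) : postWeights k σ m p x ᵥ* gramNoise k σ m p = fun i : Fin m => k x (p i) := by
  have hG := (gramNoise_posDef hk hσ m p).isUnit
  rw [postWeights, Matrix.vecMul_vecMul, Matrix.nonsing_inv_mul _
    ((Matrix.isUnit_iff_isUnit_det _).1 hG), Matrix.vecMul_one]

/-- The posterior variance is the smallest mean square error of a linear predictor. -/
lemma postVar_le_of_weights (hk : IsCovarianceFunction k) {σ : ℝ} (hσ : 0 < σ) (m : ℕ) (p : ℕ → X)
    (x : X) (c : Fin m → ℝ) :
    postVar k σ m p x ≤
      k x x - 2 * (c ⬝ᵥ fun i => k x (p i)) + c ⬝ᵥ (gramNoise k σ m p *ᵥ c) := by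
  set G := gramNoise k σ m p with hG
  set w := postWeights k σ m p x with hw
  have hpos := gramNoise_posDef hk hσ m p
  have hwG : w ᵥ* G = fun i : Fin m => k x (p i) := postWeights_vecMul hk hσ m p x
  have hT : Gᵀ = G := by
    have := hpos.isHermitian
    simpa [Matrix.IsHermitian] using this
  have hGw : G *ᵥ w = fun i : Fin m => k x (p i) := by
    rw [← Matrix.vecMul_transpose, hT, hwG]
  have h := hpos.posSemidef.dotProduct_mulVec_nonneg (c - w)
  rw [← hG] at h
  have hv : postVar k σ m p x = k x x - w ⬝ᵥ (fun i : Fin m => k x (p i)) := by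
    rw [postVar_eq]
    simp only [dotProduct, hw, hk.symm x]
  simp only [star_trivial, Matrix.mulVec_sub, sub_dotProduct, dotProduct_sub] at h
  rw [Matrix.dotProduct_mulVec w G c, hwG, hGw, dotProduct_comm (fun i : Fin m => k x (p i)) c] at h
  rw [hv]
  linarith

lemma postVar_le_self (hk : IsCovarianceFunction k) {σ : ℝ} (hσ : 0 < σ) (m : ℕ) (p : ℕ → X)
    (x : X) : postVar k σ m p x ≤ k x x := by
  simpa using postVar_le_of_weights hk hσ m p x 0

/-- The posterior variance at a point that has been evaluated `q` times decays like `1 / q`: compare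
with the linear predictor that puts the weight `1 / (q + 1)` on each of these evaluations. -/
lemma postVar_le_div (hk : IsCovarianceFunction k) {σ : ℝ} (hσ : 0 < σ) (m : ℕ) (p : ℕ → X)
    (x : X) (S : Finset (Fin m)) (hS : ∀ i ∈ S, p i = x) :
    postVar k σ m p x ≤ (k x x + σ ^ 2) / (S.card + 1) := by
  classical
  set q : ℝ := (S.card : ℝ)
  have hq : 0 ≤ q := Nat.cast_nonneg _
  have hq1 : q + 1 ≠ 0 := by positivity
  let c : Fin m → ℝ := fun i => if i ∈ S then 1 / (q + 1) else 0
  have h := postVar_le_of_weights hk hσ m p x c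
  have h1 : (c ⬝ᵥ fun i => k x (p i)) = q * (1 / (q + 1)) * k x x := by
    simp only [dotProduct, c, ite_mul, zero_mul, Finset.sum_ite_mem, Finset.univ_inter]
    rw [Finset.sum_congr rfl fun i hi => by rw [hS i hi], Finset.sum_const, nsmul_eq_mul]
    ring
  have h2 : c ⬝ᵥ (gramNoise k σ m p *ᵥ c) =
      (q * (1 / (q + 1))) ^ 2 * k x x + σ ^ 2 * (q * (1 / (q + 1)) ^ 2) := by
    rw [gramNoise, Matrix.add_mulVec, dotProduct_add, Matrix.smul_mulVec, Matrix.one_mulVec,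
      dotProduct_smul]
    have hc : c ⬝ᵥ c = q * (1 / (q + 1)) ^ 2 := by
      simp only [dotProduct, c, ite_mul, zero_mul, Finset.sum_ite_mem, Finset.univ_inter]
      rw [Finset.sum_congr rfl fun i hi => by rw [if_pos hi], Finset.sum_const, nsmul_eq_mul]
      ring
    have hm : c ⬝ᵥ ((Matrix.of fun i j : Fin m => k (p i) (p j)) *ᵥ c) =
        (q * (1 / (q + 1))) ^ 2 * k x x := by
      simp only [dotProduct, Matrix.mulVec, Matrix.of_apply, c, ite_mul, zero_mul, mul_ite,
        mul_zero, Finset.sum_ite_mem, Finset.univ_inter]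
      rw [Finset.sum_congr rfl fun i hi => by
        rw [hS i hi, Finset.sum_congr rfl fun j hj => by rw [hS j hj], Finset.sum_const,
          nsmul_eq_mul], Finset.sum_const, nsmul_eq_mul]
      ring
    rw [hm, hc, smul_eq_mul]
  rw [h1, h2] at h
  refine h.trans ?_
  have hkx := hk.self_nonneg x
  rw [le_div_iff₀ (by positivity)]
  have : (k x x - 2 * (q * (1 / (q + 1)) * k x x) + ((q * (1 / (q + 1))) ^ 2 * k x x +
      σ ^ 2 * (q * (1 / (q + 1)) ^ 2))) * (q + 1) = (k x x + q * σ ^ 2) / (q + 1) := by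
    field_simp
    ring
  rw [this, div_le_iff₀ (by positivity)]
  nlinarith [mul_nonneg hq hkx, sq_nonneg σ]

end Posterior

/-! ### Gaussian residuals -/

section Residual

variable {X Ω : Type*} [MeasurableSpace Ω] {k : X → X → ℝ} {f : X → Ω → ℝ} {η : ℕ → Ω → ℝ}
  {P : Measure Ω} {σ : ℝ}

lemma IsCenteredGP.hasGaussianLaw_pi (hf : IsCenteredGP k f P) {ι : Type*} [Fintype ι]
    (q : ι → X) : HasGaussianLaw (fun ω i => f (q i) ω) P := by
  have h := (hf.gaussian.comp_right q).hasGaussianLaw (Finset.univ : Finset ι)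
  let L : (↥(Finset.univ : Finset ι) → ℝ) →L[ℝ] (ι → ℝ) :=
    { toFun := fun x i => x ⟨i, Finset.mem_univ i⟩
      map_add' := fun x y => rfl
      map_smul' := fun c x => rfl }
  exact h.map L

lemma IsCenteredGP.memLp (hf : IsCenteredGP k f P) (x : X) : MemLp (f x) 2 P :=
  (hf.gaussian.hasGaussianLaw_eval x).memLp_two

lemma IsNoise.hasGaussianLaw (hη : IsNoise σ f η P) (j : ℕ) : HasGaussianLaw (η j) P :=
  HasLaw.hasGaussianLaw ⟨(hη.measurable j).aemeasurable, hη.law j⟩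

lemma IsNoise.memLp (hη : IsNoise σ f η P) (j : ℕ) : MemLp (η j) 2 P :=
  (hη.hasGaussianLaw j).memLp_two

lemma IsNoise.integral_eq_zero (hη : IsNoise σ f η P) (j : ℕ) : ∫ ω, η j ω ∂P = 0 := by
  have : HasLaw (η j) (gaussianReal 0 (σ ^ 2).toNNReal) P :=
    ⟨(hη.measurable j).aemeasurable, hη.law j⟩
  rw [this.integral_eq]
  exact integral_id_gaussianReal

lemma IsNoise.variance_eq (hη : IsNoise σ f η P) (j : ℕ) : Var[η j; P] = σ ^ 2 := by
  have : HasLaw (η j) (gaussianReal 0 (σ ^ 2).toNNReal) P :=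
    ⟨(hη.measurable j).aemeasurable, hη.law j⟩
  rw [this.variance_eq, variance_id_gaussianReal, Real.coe_toNNReal _ (sq_nonneg σ)]

lemma IsNoise.cov_self (hη : IsNoise σ f η P) (i j : ℕ) :
    cov[η i, η j; P] = if i = j then σ ^ 2 else 0 := by
  split_ifs with h
  · subst h
    rw [covariance_self (hη.measurable i).aemeasurable, hη.variance_eq]
  · exact (hη.indep.indepFun h).covariance_eq_zero (hη.memLp i) (hη.memLp j)

lemma IsNoise.cov_process (hf : IsCenteredGP k f P) (hη : IsNoise σ f η P) (x : X) (j : ℕ) :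
    cov[f x, η j; P] = 0 := by
  have h : IndepFun (f x) (η j) P :=
    hη.indep_process.comp (measurable_pi_apply x) (measurable_pi_apply j)
  exact h.covariance_eq_zero (hf.memLp x) (hη.memLp j)

lemma IsNoise.hasGaussianLaw_prod (hf : IsCenteredGP k f P) (hη : IsNoise σ f η P) {ι : Type*}
    [Fintype ι] (q : ι → X) (m : ℕ) :
    HasGaussianLaw (fun ω => ((fun i => f (q i) ω), fun j : Fin m => η j ω)) P := by
  have h1 := hf.hasGaussianLaw_pi q
  have h2 : HasGaussianLaw (fun ω (j : Fin m) => η j ω) P :=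
    iIndepFun.hasGaussianLaw (fun j => hη.hasGaussianLaw j)
      (hη.indep.precomp (g := fun j : Fin m => (j : ℕ)) Fin.val_injective)
  refine IndepFun.hasGaussianLaw h1 h2 ?_
  exact hη.indep_process.comp
    (φ := fun (a : X → ℝ) i => a (q i)) (ψ := fun (b : ℕ → ℝ) (j : Fin m) => b j)
    (by fun_prop) (by fun_prop)

lemma memLp_obs (hf : IsCenteredGP k f P) (hη : IsNoise σ f η P) (p : ℕ → X) (i : ℕ) :
    MemLp (fun ω => f (p i) ω + η i ω) 2 P := (hf.memLp _).add (hη.memLp _)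

/-- The error of the posterior mean as a predictor of `f x`, or (for `c = 1`) of the next
observation. -/
noncomputable def residual (k : X → X → ℝ) (σ : ℝ) (f : X → Ω → ℝ) (η : ℕ → Ω → ℝ) (m : ℕ)
    (p : ℕ → X) (x : X) (c : ℝ) (ω : Ω) : ℝ :=
  f x ω + c * η m ω - ∑ i : Fin m, postWeights k σ m p x i * (f (p i) ω + η i ω)

lemma measurable_residual (hf : IsCenteredGP k f P) (hη : IsNoise σ f η P) (m : ℕ) (p : ℕ → X)
    (x : X) (c : ℝ) : Measurable (residual k σ f η m p x c) := by
  have h1 := hf.measurable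
  have h2 := hη.measurable
  unfold residual
  fun_prop

lemma memLp_residual (hf : IsCenteredGP k f P)
    (hη : IsNoise σ f η P) (m : ℕ) (p : ℕ → X) (x : X) (c : ℝ) :
    MemLp (residual k σ f η m p x c) 2 P := by
  have h1 : MemLp (fun ω => f x ω + c * η m ω) 2 P := (hf.memLp _).add ((hη.memLp _).const_mul c)
  have h2 : MemLp (fun ω => ∑ i : Fin m, postWeights k σ m p x i * (f (p i) ω + η i ω)) 2 P :=
    memLp_finsetSum _ fun i _ => (memLp_obs hf hη p i).const_mul _
  exact h1.sub h2

lemma hasGaussianLaw_residual_prod (hf : IsCenteredGP k f P) (hη : IsNoise σ f η P) (m : ℕ)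
    (p : ℕ → X) (x : X) (c : ℝ) :
    HasGaussianLaw (fun ω => ((fun _ : Unit => residual k σ f η m p x c ω),
      fun i : Fin m => f (p i) ω + η i ω)) P := by
  have h := IsNoise.hasGaussianLaw_prod hf hη
    (fun o : Option (Fin m) => o.elim x fun i => p i) (m + 1)
  let L : ((Option (Fin m) → ℝ) × (Fin (m + 1) → ℝ)) →ₗ[ℝ] ((Unit → ℝ) × (Fin m → ℝ)) :=
    { toFun := fun z => ((fun _ => z.1 none + c * z.2 (Fin.last m) -
          ∑ i : Fin m, postWeights k σ m p x i * (z.1 (some i) + z.2 i.castSucc)),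
        fun i => z.1 (some i) + z.2 i.castSucc)
      map_add' := fun z z' => by
        ext i
        · simp [mul_add, Finset.sum_add_distrib]
          ring
        · simp
          ring
      map_smul' := fun r z => by
        ext i
        · simp [mul_add, mul_sub, Finset.sum_add_distrib, Finset.mul_sum, mul_left_comm]
        · simp [mul_add] }
  have := h.map (LinearMap.toContinuousLinearMap L)
  exact this

variable [IsProbabilityMeasure P]

lemma cov_obs (hf : IsCenteredGP k f P) (hη : IsNoise σ f η P) (m : ℕ) (p : ℕ → X)
    (i j : Fin m) :
    cov[fun ω => f (p i) ω + η i ω, fun ω => f (p j) ω + η j ω; P] = gramNoise k σ m p i j := by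
  have e : ∀ l : Fin m, (fun ω => f (p l) ω + η l ω) = f (p l) + η l := fun l => rfl
  rw [e, e, covariance_add_left (hf.memLp _) (hη.memLp _) ((hf.memLp _).add (hη.memLp _)),
    covariance_add_right (hf.memLp _) (hf.memLp _) (hη.memLp _),
    covariance_add_right (hη.memLp _) (hf.memLp _) (hη.memLp _),
    hf.cov, IsNoise.cov_process hf hη, covariance_comm, IsNoise.cov_process hf hη, hη.cov_self]
  simp [gramNoise, Matrix.one_apply, Fin.val_inj]

lemma cov_signal_obs (hf : IsCenteredGP k f P) (hη : IsNoise σ f η P) (m : ℕ) (p : ℕ → X) (x : X)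
    (c : ℝ) (j : Fin m) :
    cov[fun ω => f x ω + c * η m ω, fun ω => f (p j) ω + η j ω; P] = k x (p j) := by
  have e : (fun ω => f (p j) ω + η j ω) = f (p j) + η j := rfl
  have e' : (fun ω => f x ω + c * η m ω) = f x + c • η m := rfl
  rw [e, e', covariance_add_left (hf.memLp _) ((hη.memLp _).const_smul c)
      ((hf.memLp _).add (hη.memLp _)),
    covariance_add_right (hf.memLp _) (hf.memLp _) (hη.memLp _),
    covariance_smul_left, covariance_add_right (hη.memLp _) (hf.memLp _) (hη.memLp _),
    hf.cov, IsNoise.cov_process hf hη, covariance_comm, IsNoise.cov_process hf hη, hη.cov_self,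
    if_neg (by omega)]
  simp

lemma cov_signal_sum (hf : IsCenteredGP k f P) (hη : IsNoise σ f η P) {m : ℕ} (p : ℕ → X)
    (w : Fin m → ℝ) {Z : Ω → ℝ} (hZ : MemLp Z 2 P) :
    cov[fun ω => ∑ i : Fin m, w i * (f (p i) ω + η i ω), Z; P] =
      ∑ i : Fin m, w i * cov[fun ω => f (p i) ω + η i ω, Z; P] := by
  rw [covariance_fun_sum_left (fun i : Fin m => (memLp_obs hf hη p i).const_mul (w i)) hZ]
  simp only [covariance_const_mul_left]

lemma cov_residual_obs (hk : IsCovarianceFunction k) (hσ : 0 < σ) (hf : IsCenteredGP k f P)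
    (hη : IsNoise σ f η P) (m : ℕ) (p : ℕ → X) (x : X) (c : ℝ) (j : Fin m) :
    cov[residual k σ f η m p x c, fun ω => f (p j) ω + η j ω; P] = 0 := by
  have h1 : MemLp (fun ω => f x ω + c * η m ω) 2 P := (hf.memLp _).add ((hη.memLp _).const_mul c)
  have h2 : MemLp (fun ω => ∑ i : Fin m, postWeights k σ m p x i * (f (p i) ω + η i ω)) 2 P :=
    memLp_finsetSum _ fun i _ => (memLp_obs hf hη p i).const_mul _
  have e : residual k σ f η m p x c = (fun ω => f x ω + c * η m ω) -
    fun ω => ∑ i : Fin m, postWeights k σ m p x i * (f (p i) ω + η i ω) := rfl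
  rw [e, covariance_sub_left h1 h2 (memLp_obs hf hη p j), cov_signal_obs hf hη,
    cov_signal_sum hf hη p _ (memLp_obs hf hη p j)]
  simp only [cov_obs hf hη]
  have := congrFun (postWeights_vecMul hk hσ m p x) j
  rw [Matrix.vecMul, dotProduct] at this
  rw [this, sub_self]

lemma variance_residual (hk : IsCovarianceFunction k) (hσ : 0 < σ) (hf : IsCenteredGP k f P)
    (hη : IsNoise σ f η P) (m : ℕ) (p : ℕ → X) (x : X) (c : ℝ) :
    Var[residual k σ f η m p x c; P] = postVar k σ m p x + c ^ 2 * σ ^ 2 := by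
  have h1 : MemLp (fun ω => f x ω + c * η m ω) 2 P := (hf.memLp _).add ((hη.memLp _).const_mul c)
  have h2 : MemLp (fun ω => ∑ i : Fin m, postWeights k σ m p x i * (f (p i) ω + η i ω)) 2 P :=
    memLp_finsetSum _ fun i _ => (memLp_obs hf hη p i).const_mul _
  have hR := memLp_residual hf hη m p x c
  have e : residual k σ f η m p x c = (fun ω => f x ω + c * η m ω) -
    fun ω => ∑ i : Fin m, postWeights k σ m p x i * (f (p i) ω + η i ω) := rfl
  rw [← covariance_self hR.aemeasurable]
  nth_rewrite 1 [e]
  rw [covariance_sub_left h1 h2 hR, cov_signal_sum hf hη p _ hR]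
  have h0 : ∀ i : Fin m, cov[fun ω => f (p i) ω + η i ω, residual k σ f η m p x c; P] = 0 :=
    fun i => by rw [covariance_comm, cov_residual_obs hk hσ hf hη]
  simp only [h0, mul_zero, Finset.sum_const_zero, sub_zero]
  rw [e, covariance_sub_right h1 h1 h2, covariance_comm _ (fun ω => ∑ i : Fin m, _),
    cov_signal_sum hf hη p _ h1]
  have h3 : ∀ i : Fin m, cov[fun ω => f (p i) ω + η i ω, fun ω => f x ω + c * η m ω; P] =
      k (p i) x := fun i => by
    rw [covariance_comm, cov_signal_obs hf hη, hk.symm]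
  simp only [h3]
  have e' : (fun ω => f x ω + c * η m ω) = f x + c • η m := rfl
  have h4 : cov[fun ω => f x ω + c * η m ω, fun ω => f x ω + c * η m ω; P] =
      k x x + c ^ 2 * σ ^ 2 := by
    have hc := (hη.memLp m).const_smul c
    rw [e', covariance_add_left (hf.memLp _) hc ((hf.memLp _).add hc),
      covariance_add_right (hf.memLp _) (hf.memLp _) hc,
      covariance_add_right hc (hf.memLp _) hc, covariance_smul_left, covariance_smul_left,
      covariance_smul_right, covariance_smul_right, covariance_comm (η m) (f x),
      IsNoise.cov_process hf hη, hη.cov_self, hf.cov, if_pos rfl]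
    ring
  rw [h4, postVar_eq]
  ring

lemma postVar_nonneg (hk : IsCovarianceFunction k) (hσ : 0 < σ) (hf : IsCenteredGP k f P)
    (hη : IsNoise σ f η P) (m : ℕ) (p : ℕ → X) (x : X) : 0 ≤ postVar k σ m p x := by
  have h := variance_residual hk hσ hf hη m p x 0
  have h' := variance_nonneg (residual k σ f η m p x 0) P
  rw [h] at h'
  simpa using h'

lemma integral_residual (hf : IsCenteredGP k f P) (hη : IsNoise σ f η P) (m : ℕ) (p : ℕ → X)
    (x : X) (c : ℝ) : ∫ ω, residual k σ f η m p x c ω ∂P = 0 := by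
  have i1 : ∀ x, Integrable (f x) P := fun x => (hf.memLp x).integrable (by norm_num)
  have i2 : ∀ j, Integrable (η j) P := fun j => (hη.memLp j).integrable (by norm_num)
  have i3 : ∀ i : Fin m,
      Integrable (fun ω => postWeights k σ m p x i * (f (p i) ω + η i ω)) P :=
    fun i => ((i1 _).add (i2 _)).const_mul _
  have h0 : ∀ i : Fin m, ∫ ω, postWeights k σ m p x i * (f (p i) ω + η i ω) ∂P = 0 := fun i => by
    rw [integral_const_mul, integral_add (i1 _) (i2 _), hf.mean, hη.integral_eq_zero, add_zero,
      mul_zero]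
  have h1 : ∫ ω, f x ω + c * η m ω ∂P = 0 := by
    rw [integral_add (i1 x) ((i2 m).const_mul c), integral_const_mul, hf.mean,
      hη.integral_eq_zero, mul_zero, add_zero]
  unfold residual
  rw [integral_sub (f := fun ω => f x ω + c * η m ω) ((i1 x).add ((i2 m).const_mul c))
    (integrable_finsetSum _ fun i _ => i3 i), h1, integral_finsetSum _ fun i _ => i3 i]
  simp [h0]

lemma map_residual (hk : IsCovarianceFunction k) (hσ : 0 < σ) (hf : IsCenteredGP k f P)
    (hη : IsNoise σ f η P) (m : ℕ) (p : ℕ → X) (x : X) (c : ℝ) :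
    P.map (residual k σ f η m p x c) =
      gaussianReal 0 (postVar k σ m p x + c ^ 2 * σ ^ 2).toNNReal := by
  have h := (hasGaussianLaw_residual_prod hf hη m p x c).fst.eval ()
  have := h.map_eq_gaussianReal
  rw [integral_residual hf hη, variance_residual hk hσ hf hη] at this
  exact this

/-- The residual is uncorrelated with the observations, hence independent of them. -/
lemma indepFun_residual (hk : IsCovarianceFunction k) (hσ : 0 < σ) (hf : IsCenteredGP k f P)
    (hη : IsNoise σ f η P) (m : ℕ) (p : ℕ → X) (x : X) (c : ℝ) :
    IndepFun (residual k σ f η m p x c) (fun ω (i : Fin m) => f (p i) ω + η i ω) P := by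
  have h := (hasGaussianLaw_residual_prod hf hη m p x c).indepFun_of_covariance_eval
    fun _ j => cov_residual_obs hk hσ hf hη m p x c j
  exact h.comp (φ := fun a : Unit → ℝ => a ()) (by fun_prop) measurable_id

/-- The two-sided tail of a centered Gaussian variable. -/
lemma gaussian_tail {Z : Ω → ℝ} {v : ℝ} (hZm : Measurable Z)
    (hZ : P.map Z = gaussianReal 0 v.toNNReal) {s t : ℝ} (hs : 0 ≤ s) (ht : 0 ≤ t)
    (hv : v ≤ s ^ 2) : P {ω | s * t < |Z ω|} ≤ ENNReal.ofReal (2 * Real.exp (-t ^ 2 / 2)) := by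
  have hsub : HasSubgaussianMGF Z (s ^ 2).toNNReal P := by
    refine ⟨fun r => ?_, fun r => ?_⟩
    · have := integrable_exp_mul_gaussianReal (μ := 0) (v := v.toNNReal) r
      rw [← hZ] at this
      exact this.comp_measurable hZm
    · rw [mgf_gaussianReal hZ, Real.exp_le_exp]
      have : (v.toNNReal : ℝ) ≤ (s ^ 2).toNNReal := by
        exact_mod_cast Real.toNNReal_le_toNNReal hv
      nlinarith [mul_le_mul_of_nonneg_right this (sq_nonneg r)]
  rcases hs.eq_or_lt with rfl | hs
  · have h0 : Z =ᵐ[P] 0 := by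
      apply HasSubgaussianMGF.ae_eq_zero_of_hasSubgaussianMGF_zero
      simpa using hsub
    have : P {ω | 0 * t < |Z ω|} = 0 := by
      rw [← nonpos_iff_eq_zero]
      refine (measure_mono_null (t := {ω | ¬ Z ω = (0 : Ω → ℝ) ω}) ?_ h0).le
      intro ω hω
      simp only [zero_mul, mem_ofPred_eq, abs_pos] at hω ⊢
      simpa using hω
    rw [this]
    exact zero_le
  have key : ∀ W : Ω → ℝ, HasSubgaussianMGF W (s ^ 2).toNNReal P →
      P {ω | s * t ≤ W ω} ≤ ENNReal.ofReal (Real.exp (-t ^ 2 / 2)) := fun W hW => by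
    have h := hW.measure_ge_le (ε := s * t) (by positivity)
    rw [Measure.real, Real.coe_toNNReal _ (sq_nonneg s)] at h
    rw [← ENNReal.ofReal_toReal (measure_ne_top P {ω | s * t ≤ W ω})]
    refine ENNReal.ofReal_le_ofReal (h.trans (le_of_eq ?_))
    congr 1
    field_simp
  calc P {ω | s * t < |Z ω|} ≤ P ({ω | s * t ≤ Z ω} ∪ {ω | s * t ≤ (-Z) ω}) := by
        refine measure_mono fun ω hω => ?_
        rcases lt_abs.1 (show s * t < |Z ω| from hω) with h | h
        · exact Or.inl h.le
        · exact Or.inr h.le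
    _ ≤ _ := (measure_union_le _ _).trans (add_le_add (key Z hsub) (key (-Z) hsub.neg))
    _ = _ := by rw [← ENNReal.ofReal_add (by positivity) (by positivity), two_mul]

end Residual

/-! ### Information gain of a fixed design -/

section DonskerVaradhan

/-- The easy half of the Donsker–Varadhan variational formula. -/
lemma ofReal_integral_le_klDiv {A : Type*} [MeasurableSpace A] {μ ν : Measure A}
    [IsProbabilityMeasure μ] [IsProbabilityMeasure ν] {φ : A → ℝ} (hφ : Measurable φ)
    (hint : Integrable φ μ) (hexp : ∫⁻ a, ENNReal.ofReal (Real.exp (φ a)) ∂ν ≤ 1) :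
    ENNReal.ofReal (∫ a, φ a ∂μ) ≤ InformationTheory.klDiv μ ν := by
  by_cases htop : InformationTheory.klDiv μ ν = ∞
  · rw [htop]
    exact le_top
  obtain ⟨hac, hllr⟩ := InformationTheory.klDiv_ne_top_iff.1 htop
  rw [← ENNReal.ofReal_toReal htop,
    InformationTheory.toReal_klDiv_of_measure_eq hac (by simp)]
  refine ENNReal.ofReal_le_ofReal ?_
  have hl : ∫⁻ a, ENNReal.ofReal (Real.exp (φ a - llr μ ν a)) ∂μ ≤ 1 := by
    have h1 : (fun a => ENNReal.ofReal (Real.exp (φ a - llr μ ν a))) =ᵐ[μ]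
        fun a => ν.rnDeriv μ a * ENNReal.ofReal (Real.exp (φ a)) := by
      filter_upwards [exp_neg_llr hac, Measure.rnDeriv_lt_top ν μ] with a ha hlt
      rw [sub_eq_add_neg, Real.exp_add, ha, mul_comm, ENNReal.ofReal_mul ENNReal.toReal_nonneg,
        ENNReal.ofReal_toReal hlt.ne]
    rw [lintegral_congr_ae h1]
    have h2 := lintegral_withDensity_eq_lintegral_mul μ (Measure.measurable_rnDeriv ν μ)
      (g := fun a => ENNReal.ofReal (Real.exp (φ a))) (by fun_prop)
    simp only [Pi.mul_apply] at h2
    rw [← h2]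
    exact (lintegral_mono' (Measure.withDensity_rnDeriv_le ν μ) le_rfl).trans hexp
  have hmeas : Measurable fun a => Real.exp (φ a - llr μ ν a) :=
    (hφ.sub (measurable_llr μ ν)).exp
  have hi : Integrable (fun a => Real.exp (φ a - llr μ ν a)) μ := by
    refine ⟨hmeas.aestronglyMeasurable, ?_⟩
    rw [hasFiniteIntegral_iff_ofReal (Filter.Eventually.of_forall fun a => (Real.exp_pos _).le)]
    exact hl.trans_lt ENNReal.one_lt_top
  have h3 : ∫ a, Real.exp (φ a - llr μ ν a) ∂μ ≤ 1 := by
    rw [integral_eq_lintegral_of_nonneg_ae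
      (Filter.Eventually.of_forall fun a => (Real.exp_pos _).le) hmeas.aestronglyMeasurable]
    exact ENNReal.toReal_le_of_le_ofReal zero_le_one (by simpa using hl)
  have h4 : ∫ a, (φ a - llr μ ν a) ∂μ ≤ ∫ a, (Real.exp (φ a - llr μ ν a) - 1) ∂μ := by
    refine integral_mono (hint.sub hllr) (hi.sub (integrable_const 1)) fun a => ?_
    have := Real.add_one_le_exp (φ a - llr μ ν a)
    simp only
    linarith
  rw [integral_sub hint hllr, integral_sub hi (integrable_const 1)] at h4
  simp only [integral_const, probReal_univ, smul_eq_mul, mul_one] at h4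
  linarith

end DonskerVaradhan

section InfoGain

variable {X Ω : Type*} [MeasurableSpace Ω] {k : X → X → ℝ} {f : X → Ω → ℝ} {η : ℕ → Ω → ℝ}
  {P : Measure Ω} {σ : ℝ}

/-- The logarithm of the density of `N(F j, σ ^ 2)` with respect to the predictive law
`N(μ_j, σ_j ^ 2 + σ ^ 2)`, evaluated at the observation `y j`. -/
noncomputable def logRatio (k : X → X → ℝ) (σ : ℝ) (p : ℕ → X) (j : ℕ) (y F : ℕ → ℝ) : ℝ :=
  -(y j - F j) ^ 2 / (2 * σ ^ 2) +
    (y j - postMean k σ j p y (p j)) ^ 2 / (2 * (postVar k σ j p (p j) + σ ^ 2)) +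
    Real.log ((postVar k σ j p (p j) + σ ^ 2) / σ ^ 2) / 2

/-- Extension of a vector to a sequence by zeros. -/
def extendZero {m : ℕ} (y : Fin m → ℝ) (j : ℕ) : ℝ := if h : j < m then y ⟨j, h⟩ else 0

lemma extendZero_of_lt {m : ℕ} (y : ℕ → ℝ) {j : ℕ} (h : j < m) :
    extendZero (fun i : Fin m => y i) j = y j := by simp [extendZero, h]

lemma measurable_extendZero {m : ℕ} (j : ℕ) :
    Measurable fun y : Fin m → ℝ => extendZero y j := by
  unfold extendZero
  split_ifs <;> fun_prop

lemma postMean_congr {m : ℕ} {p : ℕ → X} {y y' : ℕ → ℝ} (x : X) (h : ∀ i < m, y i = y' i) :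
    postMean k σ m p y x = postMean k σ m p y' x := by
  rw [postMean_eq, postMean_eq]
  exact Finset.sum_congr rfl fun i _ => by rw [h i i.2]

lemma logRatio_congr {p : ℕ → X} {j : ℕ} {y y' F F' : ℕ → ℝ} (h : ∀ i ≤ j, y i = y' i)
    (hF : F j = F' j) : logRatio k σ p j y F = logRatio k σ p j y' F' := by
  rw [logRatio, logRatio, h j le_rfl, hF, postMean_congr (p j) fun i hi => h i hi.le]

lemma measurable_logRatio {A : Type*} [MeasurableSpace A] (p : ℕ → X) (j : ℕ) {y F : A → ℕ → ℝ}
    (hy : ∀ i, Measurable fun a => y a i) (hF : ∀ i, Measurable fun a => F a i) :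
    Measurable fun a => logRatio k σ p j (y a) (F a) := by
  unfold logRatio
  simp only [postMean_eq]
  fun_prop

/-- Integrating the density ratio against the predictive law gives total mass one. -/
lemma lintegral_density_ratio {s v c : ℝ} (hs : 0 < s) (hv : 0 < v) :
    ∫⁻ z, ENNReal.ofReal (Real.exp (-(z - c) ^ 2 / (2 * s) + z ^ 2 / (2 * v) +
      Real.log (v / s) / 2)) ∂(gaussianReal 0 v.toNNReal) = 1 := by
  have hv' : v.toNNReal ≠ 0 := by simpa using hv
  have hs' : s.toNNReal ≠ 0 := by simpa using hs
  rw [gaussianReal_of_var_ne_zero _ hv', lintegral_withDensity_eq_lintegral_mul _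
    (measurable_gaussianPDF _ _) (by fun_prop), ← lintegral_gaussianPDF_eq_one c hs']
  refine lintegral_congr fun z => ?_
  rw [Pi.mul_apply, gaussianPDF, gaussianPDF, ← ENNReal.ofReal_mul (gaussianPDFReal_nonneg _ _ _)]
  congr 1
  rw [gaussianPDFReal, gaussianPDFReal, Real.coe_toNNReal _ hv.le, Real.coe_toNNReal _ hs.le,
    Real.exp_add, Real.exp_add, ← Real.log_sqrt (by positivity), Real.exp_log (by positivity),
    Real.sqrt_div hv.le, Real.sqrt_mul (by positivity) v, Real.sqrt_mul (by positivity) s,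
    sub_zero, neg_div, Real.exp_neg (z ^ 2 / (2 * v))]
  have h1 := Real.sqrt_pos.2 hv
  have h2 := Real.sqrt_pos.2 hs
  have h3 := Real.exp_pos (z ^ 2 / (2 * v))
  field_simp

variable [IsProbabilityMeasure P]

/-- For every fixed vector of function values, the likelihood ratio of the observations has mean
one under their marginal law. The innovations of the observations are independent, so the
factors can be integrated out one at a time. -/
lemma lintegral_exp_sum_logRatio (hk : IsCovarianceFunction k) (hσ : 0 < σ)
    (hf : IsCenteredGP k f P) (hη : IsNoise σ f η P) (p : ℕ → X) (F : ℕ → ℝ) (m : ℕ) :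
    ∫⁻ ω, ENNReal.ofReal (Real.exp (∑ j ∈ Finset.range m,
      logRatio k σ p j (fun i => f (p i) ω + η i ω) F)) ∂P = 1 := by
  induction m with
  | zero => simp
  | succ m ih =>
    set Z := residual k σ f η m p (p m) 1 with hZ
    set Y : Ω → Fin m → ℝ := fun ω i => f (p i) ω + η i ω with hY
    have hfm := hf.measurable
    have hηm := hη.measurable
    have hYm : Measurable Y := by fun_prop
    have hZm : Measurable Z := measurable_residual hf hη m p (p m) 1
    set a : (Fin m → ℝ) → ℝ≥0∞ := fun y => ENNReal.ofReal (Real.exp (∑ j ∈ Finset.range m,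
      logRatio k σ p j (extendZero y) F)) with ha
    have ham : Measurable a := by
      refine ENNReal.measurable_ofReal.comp (Real.measurable_exp.comp
        (Finset.measurable_sum _ fun j _ => ?_))
      exact measurable_logRatio p j measurable_extendZero fun i => measurable_const
    set v := postVar k σ m p (p m) + σ ^ 2 with hv
    have hv0 : 0 < v := by
      have := postVar_nonneg hk hσ hf hη m p (p m)
      positivity
    set b : ℝ → ℝ → ℝ≥0∞ := fun z c => ENNReal.ofReal (Real.exp (-(z - c) ^ 2 / (2 * σ ^ 2) +
      z ^ 2 / (2 * v) + Real.log (v / σ ^ 2) / 2)) with hb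
    set c : (Fin m → ℝ) → ℝ := fun y => F m - postMean k σ m p (extendZero y) (p m) with hc
    have hcm : Measurable c := by
      simp only [hc, postMean_eq]
      exact measurable_const.sub (Finset.measurable_sum _ fun i _ =>
        measurable_const.mul (measurable_extendZero _))
    have hZY : ∀ ω, f (p m) ω + η m ω =
        Z ω + postMean k σ m p (fun i => f (p i) ω + η i ω) (p m) := fun ω => by
      rw [hZ, residual, postMean_eq]
      ring
    have hfact : ∀ ω, ENNReal.ofReal (Real.exp (∑ j ∈ Finset.range (m + 1),
        logRatio k σ p j (fun i => f (p i) ω + η i ω) F)) = a (Y ω) * b (Z ω) (c (Y ω)) := by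
      intro ω
      rw [Finset.sum_range_succ, Real.exp_add, ENNReal.ofReal_mul (Real.exp_pos _).le]
      congr 1
      · simp only [ha, hY]
        congr 2
        refine Finset.sum_congr rfl fun j hj => logRatio_congr (fun i hi => ?_) rfl
        rw [extendZero_of_lt (fun i => f (p i) ω + η i ω)
          (lt_of_le_of_lt hi (Finset.mem_range.1 hj))]
      · simp only [hb, hc, hY]
        have hp : postMean k σ m p (extendZero fun i : Fin m => f (p i) ω + η i ω) (p m) =
            postMean k σ m p (fun i => f (p i) ω + η i ω) (p m) :=
          postMean_congr _ fun i hi => extendZero_of_lt (fun i => f (p i) ω + η i ω) hi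
        rw [hp, logRatio]
        congr 3
        rw [hZY ω]
        ring
    simp only [hfact]
    -- the innovation `Z` is independent of the earlier observations `Y`
    have hind := indepFun_residual hk hσ hf hη m p (p m) 1
    have hmap := (indepFun_iff_map_prod_eq_prod_map_map hZm.aemeasurable hYm.aemeasurable).1 hind
    have hbm : Measurable fun w : ℝ × (Fin m → ℝ) => b w.1 (c w.2) := by
      simp only [hb]
      fun_prop
    have habm : Measurable fun w : ℝ × (Fin m → ℝ) => a w.2 * b w.1 (c w.2) :=
      (ham.comp measurable_snd).mul hbm
    have h1 : ∫⁻ ω, a (Y ω) * b (Z ω) (c (Y ω)) ∂P =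
        ∫⁻ w, a w.2 * b w.1 (c w.2) ∂(P.map fun ω => (Z ω, Y ω)) := by
      rw [lintegral_map habm (hZm.prodMk hYm)]
    rw [h1, hmap, lintegral_prod_symm' _ habm]
    have h2 : ∀ y, ∫⁻ z, a y * b z (c y) ∂(P.map Z) = a y := fun y => by
      rw [lintegral_const_mul _ (by simp only [hb]; fun_prop), hZ,
        map_residual hk hσ hf hη m p (p m) 1, one_pow, one_mul, ← hv,
        lintegral_density_ratio (by positivity) hv0, mul_one]
    simp only [h2]
    rw [lintegral_map ham hYm, ← ih]
    refine lintegral_congr fun ω => ?_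
    simp only [ha, hY]
    congr 2
    refine Finset.sum_congr rfl fun j hj => logRatio_congr (fun i hi => ?_) rfl
    rw [extendZero_of_lt (fun i => f (p i) ω + η i ω) (lt_of_le_of_lt hi (Finset.mem_range.1 hj))]

lemma integral_logRatio (hk : IsCovarianceFunction k) (hσ : 0 < σ)
    (hf : IsCenteredGP k f P) (hη : IsNoise σ f η P) (p : ℕ → X) (j : ℕ) :
    Integrable (fun ω => logRatio k σ p j (fun i => f (p i) ω + η i ω) fun i => f (p i) ω) P ∧
    ∫ ω, logRatio k σ p j (fun i => f (p i) ω + η i ω) (fun i => f (p i) ω) ∂P =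
      Real.log ((postVar k σ j p (p j) + σ ^ 2) / σ ^ 2) / 2 := by
  set v := postVar k σ j p (p j) + σ ^ 2 with hv
  have hv0 : 0 < v := by
    have := postVar_nonneg hk hσ hf hη j p (p j)
    positivity
  set Z := residual k σ f η j p (p j) 1 with hZ
  have e : (fun ω => logRatio k σ p j (fun i => f (p i) ω + η i ω) fun i => f (p i) ω) =
      fun ω => (-1 / (2 * σ ^ 2)) * (η j ω) ^ 2 + (1 / (2 * v)) * (Z ω) ^ 2 +
        Real.log (v / σ ^ 2) / 2 := by
    funext ω
    have : f (p j) ω + η j ω - postMean k σ j p (fun i => f (p i) ω + η i ω) (p j) = Z ω := by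
      rw [hZ, residual, postMean_eq]
      ring
    rw [logRatio, this, ← hv]
    ring
  have hZL : MemLp Z 2 P := memLp_residual hf hη j p (p j) 1
  have i1 : Integrable (fun ω => (-1 / (2 * σ ^ 2)) * (η j ω) ^ 2) P :=
    (hη.memLp j).integrable_sq.const_mul _
  have i2 : Integrable (fun ω => (1 / (2 * v)) * (Z ω) ^ 2) P := hZL.integrable_sq.const_mul _
  have hηv : ∫ ω, (η j ω) ^ 2 ∂P = σ ^ 2 := by
    rw [← hη.variance_eq j, variance_of_integral_eq_zero (hη.measurable j).aemeasurable
      (hη.integral_eq_zero j)]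
  have hZv : ∫ ω, (Z ω) ^ 2 ∂P = v := by
    have h := variance_residual hk hσ hf hη j p (p j) 1
    rw [one_pow, one_mul, variance_of_integral_eq_zero hZL.aemeasurable
      (integral_residual hf hη j p (p j) 1)] at h
    exact h
  refine ⟨?_, ?_⟩
  · rw [e]
    exact (i1.add i2).add (integrable_const _)
  · rw [e, integral_add (f := fun ω => (-1 / (2 * σ ^ 2)) * (η j ω) ^ 2 + (1 / (2 * v)) * (Z ω) ^ 2)
      (i1.add i2) (integrable_const _), integral_add i1 i2, integral_const_mul, integral_const_mul,
      hηv, hZv]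
    simp only [integral_const, probReal_univ, smul_eq_mul, one_mul]
    field_simp
    ring

/-- The information gain of a design is at least the sum of the log-ratios of the predictive
variances and the noise variance (it is in fact equal to it). -/
lemma sum_log_le_infoGain (hk : IsCovarianceFunction k) (hσ : 0 < σ)
    (hf : IsCenteredGP k f P) (hη : IsNoise σ f η P) (p : ℕ → X) (m : ℕ) :
    ENNReal.ofReal (∑ j ∈ Finset.range m,
      Real.log ((postVar k σ j p (p j) + σ ^ 2) / σ ^ 2) / 2) ≤ infoGain P f η m p := by
  have hfm := hf.measurable
  have hηm := hη.measurable
  set Y : Ω → Fin m → ℝ := fun ω i => f (p i) ω + η i ω with hY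
  set G : Ω → Fin m → ℝ := fun ω i => f (p i) ω with hG
  have hYm : Measurable Y := by fun_prop
  have hGm : Measurable G := by fun_prop
  set φ : (Fin m → ℝ) × (Fin m → ℝ) → ℝ := fun z => ∑ j ∈ Finset.range m,
    logRatio k σ p j (extendZero z.1) (extendZero z.2) with hφ
  have hφm : Measurable φ := by
    refine Finset.measurable_sum _ fun j _ => ?_
    exact measurable_logRatio p j (fun i => (measurable_extendZero i).comp measurable_fst)
      fun i => (measurable_extendZero i).comp measurable_snd
  have hφY : ∀ ω, ∀ F : Fin m → ℝ, φ (Y ω, F) =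
      ∑ j ∈ Finset.range m, logRatio k σ p j (fun i => f (p i) ω + η i ω) (extendZero F) := by
    intro ω F
    refine Finset.sum_congr rfl fun j hj => logRatio_congr (fun i hi => ?_) rfl
    exact extendZero_of_lt (fun i => f (p i) ω + η i ω) (lt_of_le_of_lt hi (Finset.mem_range.1 hj))
  have hφYG : ∀ ω, φ (Y ω, G ω) = ∑ j ∈ Finset.range m,
      logRatio k σ p j (fun i => f (p i) ω + η i ω) (fun i => f (p i) ω) := by
    intro ω
    rw [hφY]
    refine Finset.sum_congr rfl fun j hj => logRatio_congr (fun i hi => rfl) ?_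
    exact extendZero_of_lt (fun i => f (p i) ω) (Finset.mem_range.1 hj)
  have : IsProbabilityMeasure (P.map fun ω => (Y ω, G ω)) :=
    Measure.isProbabilityMeasure_map (hYm.prodMk hGm).aemeasurable
  have : IsProbabilityMeasure (P.map Y) := Measure.isProbabilityMeasure_map hYm.aemeasurable
  have : IsProbabilityMeasure (P.map G) := Measure.isProbabilityMeasure_map hGm.aemeasurable
  have hint : ∫ z, φ z ∂(P.map fun ω => (Y ω, G ω)) = ∑ j ∈ Finset.range m,
      Real.log ((postVar k σ j p (p j) + σ ^ 2) / σ ^ 2) / 2 := by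
    rw [integral_map (hYm.prodMk hGm).aemeasurable hφm.aestronglyMeasurable]
    simp only [hφYG]
    rw [integral_finsetSum _ fun j _ => (integral_logRatio hk hσ hf hη p j).1]
    exact Finset.sum_congr rfl fun j _ => (integral_logRatio hk hσ hf hη p j).2
  rw [← hint]
  refine ofReal_integral_le_klDiv hφm ?_ ?_
  · rw [integrable_map_measure hφm.aestronglyMeasurable (hYm.prodMk hGm).aemeasurable]
    have : (φ ∘ fun ω => (Y ω, G ω)) = fun ω => ∑ j ∈ Finset.range m,
      logRatio k σ p j (fun i => f (p i) ω + η i ω) (fun i => f (p i) ω) := funext hφYG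
    rw [this]
    exact integrable_finsetSum _ fun j _ => (integral_logRatio hk hσ hf hη p j).1
  · have hm' : Measurable fun z => ENNReal.ofReal (Real.exp (φ z)) :=
      ENNReal.measurable_ofReal.comp (Real.measurable_exp.comp hφm)
    rw [lintegral_prod_symm' _ hm']
    have : ∀ F : Fin m → ℝ, ∫⁻ y, ENNReal.ofReal (Real.exp (φ (y, F))) ∂(P.map Y) = 1 := by
      intro F
      have hmF : Measurable fun y => ENNReal.ofReal (Real.exp (φ (y, F))) :=
        hm'.comp measurable_prodMk_right
      rw [lintegral_map hmF hYm]
      simp only [hφY]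
      exact lintegral_exp_sum_logRatio hk hσ hf hη p (extendZero F) m
    exact ((lintegral_congr this).trans (by
      rw [lintegral_const, one_mul]; exact measure_univ (μ := P.map G))).le

lemma sum_postVar_le_infoGain (hk : IsCovarianceFunction k) (hσ : 0 < σ)
    (hf : IsCenteredGP k f P) (hη : IsNoise σ f η P) {M : ℝ} (hM : ∀ x, k x x ≤ M) (p : ℕ → X)
    (m : ℕ) :
    ENNReal.ofReal (∑ j ∈ Finset.range m, postVar k σ j p (p j)) ≤
      ENNReal.ofReal (2 * (M + σ ^ 2)) * infoGain P f η m p := by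
  have hM0 : 0 ≤ M := (hk.self_nonneg (p 0)).trans (hM _)
  refine le_trans ?_ (mul_le_mul_right (sum_log_le_infoGain hk hσ hf hη p m) _)
  rw [← ENNReal.ofReal_mul (by positivity)]
  refine ENNReal.ofReal_le_ofReal ?_
  rw [Finset.mul_sum]
  refine Finset.sum_le_sum fun j _ => ?_
  set s := postVar k σ j p (p j)
  have hs : 0 ≤ s := postVar_nonneg hk hσ hf hη j p (p j)
  have hsM : s ≤ M := (postVar_le_self hk hσ j p (p j)).trans (hM _)
  have hσ2 : 0 < σ ^ 2 := by positivity
  have h := Real.one_sub_inv_le_log_of_pos (show 0 < (s + σ ^ 2) / σ ^ 2 by positivity)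
  have h1 : 1 - ((s + σ ^ 2) / σ ^ 2)⁻¹ = s / (s + σ ^ 2) := by
    field_simp
    ring
  rw [h1] at h
  have h2 : s / (M + σ ^ 2) ≤ s / (s + σ ^ 2) := by gcongr
  have h3 : s = (M + σ ^ 2) * (s / (M + σ ^ 2)) := by field_simp
  calc s = (M + σ ^ 2) * (s / (M + σ ^ 2)) := h3
    _ ≤ (M + σ ^ 2) * Real.log ((s + σ ^ 2) / σ ^ 2) := by gcongr; exact h2.trans h
    _ = _ := by ring

end InfoGain

/-! ### The run of the algorithm as a function of the observations -/

section Design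

variable {X : Type*}

lemma postWeights_congr {k : X → X → ℝ} {σ : ℝ} {m : ℕ} {p q : ℕ → X} (h : ∀ i < m, p i = q i)
    (x : X) : postWeights k σ m p x = postWeights k σ m q x := by
  have h1 : gramNoise k σ m p = gramNoise k σ m q := by
    ext i j
    simp [gramNoise, h i i.2, h j j.2]
  have h2 : (fun i : Fin m => k x (p i)) = fun i : Fin m => k x (q i) := by
    ext i
    rw [h i i.2]
  rw [postWeights, postWeights, h1, h2]

lemma postMean_congr_design {k : X → X → ℝ} {σ : ℝ} {m : ℕ} {p q : ℕ → X}
    (h : ∀ i < m, p i = q i) (y : ℕ → ℝ) (x : X) :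
    postMean k σ m p y x = postMean k σ m q y x := by
  rw [postMean_eq, postMean_eq, postWeights_congr h]

lemma postVar_congr_design {k : X → X → ℝ} {σ : ℝ} {m : ℕ} {p q : ℕ → X}
    (h : ∀ i < m, p i = q i) (x : X) : postVar k σ m p x = postVar k σ m q x := by
  rw [postVar_eq, postVar_eq, postWeights_congr h]
  congr 1
  exact Finset.sum_congr rfl fun i _ => by rw [h i i.2]

end Design

section Run

variable {X : Type*} [MetricSpace X] {A : Inputs X} {sel : ℕ → (ℕ → ℝ) → Finset Node → Node}

lemma State.step_of_halted {F : X → ℝ} {ε : ℕ → ℝ} {s : State X}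
    {r : (ℕ → ℝ) → Finset Node → Node} (h : s.Halted A) : s.step A r F ε = s := by
  rw [State.step, if_pos h]

lemma State.step_of_not_halted {F : X → ℝ} {ε : ℕ → ℝ} {s : State X}
    {r : (ℕ → ℝ) → Finset Node → Node} (h : ¬ s.Halted A) :
    s.step A r F ε = if ((s.updateBounds A).classify A).active = ∅
      then (s.updateBounds A).classify A
      else ((s.updateBounds A).classify A).act A F ε
        (r ((s.updateBounds A).classify A).obs (((s.updateBounds A).classify A).argmax A)) := by
  rw [State.step, if_neg h]

lemma State.step_numEvals_node {F : X → ℝ} {ε : ℕ → ℝ} (s : State X)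
    (r : (ℕ → ℝ) → Finset Node → Node) :
    s.numEvals ≤ (s.step A r F ε).numEvals ∧
      ∀ j < s.numEvals, (s.step A r F ε).node j = s.node j := by
  by_cases hh : s.Halted A
  · rw [State.step_of_halted hh]
    exact ⟨le_rfl, fun _ _ => rfl⟩
  rw [State.step_of_not_halted hh]
  split_ifs with h
  · exact ⟨le_rfl, fun _ _ => rfl⟩
  · rw [State.act]
    split_ifs with h2
    · exact ⟨le_rfl, fun _ _ => rfl⟩
    · exact ⟨Nat.le_succ _, fun j hj => Function.update_of_ne (Nat.ne_of_lt hj) _ _⟩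

lemma run_numEvals_node (F : X → ℝ) (ε : ℕ → ℝ) {t t' : ℕ} (h : t ≤ t') :
    (run A sel F ε t).numEvals ≤ (run A sel F ε t').numEvals ∧
      ∀ j < (run A sel F ε t).numEvals,
        (run A sel F ε t').node j = (run A sel F ε t).node j := by
  induction t', h using Nat.le_induction with
  | base => exact ⟨le_rfl, fun _ _ => rfl⟩
  | succ t' _ ih =>
    have hs := State.step_numEvals_node (A := A) (F := F) (ε := ε) (run A sel F ε t') (sel t')
    refine ⟨ih.1.trans hs.1, fun j hj => ?_⟩
    rw [← ih.2 j hj]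
    exact hs.2 j (hj.trans_le ih.1)

/-- The run depends on the function and the noise only through the observations made. -/
lemma run_congr {F F' : X → ℝ} {ε ε' : ℕ → ℝ} {t : ℕ}
    (h : ∀ j < (run A sel F ε t).numEvals,
      F (A.tree.center ((run A sel F ε t).node j)) + ε j =
        F' (A.tree.center ((run A sel F ε t).node j)) + ε' j) :
    run A sel F' ε' t = run A sel F ε t := by
  induction t with
  | zero => rfl
  | succ t ih =>
    have hs := State.step_numEvals_node (A := A) (F := F) (ε := ε) (run A sel F ε t) (sel t)
    have ih' := ih fun j hj => by
      have := h j (hj.trans_le hs.1)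
      rwa [show (run A sel F ε (t + 1)).node j = _ from hs.2 j hj] at this
    rw [run, run, ih']
    rw [run] at h
    set s := run A sel F ε t
    by_cases hh : s.Halted A
    · rw [State.step_of_halted hh, State.step_of_halted hh]
    rw [State.step_of_not_halted hh] at h
    rw [State.step_of_not_halted hh, State.step_of_not_halted hh]
    split_ifs with h1
    · rfl
    · rw [if_neg h1] at h
      set s' := (s.updateBounds A).classify A
      set w := sel t s'.obs (s'.argmax A)
      simp only [State.act] at h ⊢
      split_ifs with h2
      · rfl
      · rw [if_neg h2] at h
        have := h s'.numEvals (Nat.lt_succ_self _)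
        simp only [Function.update_self] at this
        rw [this]

end Run

section Measurability

/-- Finite sets of nodes form a countable set, with the discrete `σ`-algebra. -/
instance : MeasurableSpace (Finset Node) := ⊤

instance : DiscreteMeasurableSpace (Finset Node) := ⟨fun _ => trivial⟩

variable {α : Type*} [MeasurableSpace α]

lemma measurable_of_countable_cases {β ι : Type*} [MeasurableSpace β] [Countable ι] {Q : α → ι}
    (hQ : ∀ i, MeasurableSet {a | Q a = i}) {h : α → β}
    (hh : ∀ i, ∃ h' : α → β, Measurable h' ∧ ∀ a, Q a = i → h a = h' a) : Measurable h := by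
  choose h' hm he using hh
  intro s hs
  have : h ⁻¹' s = ⋃ i, {a | Q a = i} ∩ h' i ⁻¹' s := by
    ext a
    simp only [mem_preimage, mem_iUnion, mem_inter_iff]
    constructor
    · intro ha
      exact ⟨Q a, rfl, by rwa [← he _ a rfl]⟩
    · rintro ⟨i, hi, ha⟩
      rwa [he i a hi]
  rw [this]
  exact MeasurableSet.iUnion fun i => (hQ i).inter (hm i hs)

lemma measurable_filter {B : α → Finset Node} (hB : Measurable B) {p : α → Node → Prop}
    [∀ a, DecidablePred (p a)] (hp : ∀ v, MeasurableSet {a | p a v}) :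
    Measurable fun a => (B a).filter (p a) := by
  refine measurable_to_countable' fun C => ?_
  have : (fun a => (B a).filter (p a)) ⁻¹' {C} = ⋂ v, {a | (v ∈ B a ∧ p a v) ↔ v ∈ C} := by
    ext a
    simp only [mem_preimage, mem_singleton_iff, mem_iInter]
    rw [Finset.ext_iff]
    simp only [Finset.mem_filter]
    rfl
  rw [this]
  refine MeasurableSet.iInter fun v => ?_
  have hv : MeasurableSet {a | v ∈ B a} :=
    hB (MeasurableSet.of_discrete (s := {C : Finset Node | v ∈ C}))
  exact MeasurableSet.iff (hv.inter (hp v)) (MeasurableSet.const _)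

variable {X : Type*} {S : α → State X}

/-- Measurable dependence of a state of the algorithm on a parameter. -/
structure MeasurableState (S : α → State X) : Prop where
  active : Measurable fun a => (S a).active
  numEvals : Measurable fun a => (S a).numEvals
  node : ∀ j, Measurable fun a => (S a).node j
  obs : ∀ j, Measurable fun a => (S a).obs j
  upper : ∀ v, Measurable fun a => (S a).upper v
  lower : ∀ v, Measurable fun a => (S a).lower v

lemma MeasurableState.of_cases {ι : Type*} [Countable ι] {Q : α → ι}
    (hQ : ∀ i, MeasurableSet {a | Q a = i})
    (hh : ∀ i, ∃ S' : α → State X, MeasurableState S' ∧ ∀ a, Q a = i → S a = S' a) :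
    MeasurableState S where
  active := measurable_of_countable_cases hQ fun i =>
    let ⟨_, h, e⟩ := hh i; ⟨_, h.active, fun a ha => by rw [e a ha]⟩
  numEvals := measurable_of_countable_cases hQ fun i =>
    let ⟨_, h, e⟩ := hh i; ⟨_, h.numEvals, fun a ha => by rw [e a ha]⟩
  node j := measurable_of_countable_cases hQ fun i =>
    let ⟨_, h, e⟩ := hh i; ⟨_, h.node j, fun a ha => by rw [e a ha]⟩
  obs j := measurable_of_countable_cases hQ fun i =>
    let ⟨_, h, e⟩ := hh i; ⟨_, h.obs j, fun a ha => by rw [e a ha]⟩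
  upper v := measurable_of_countable_cases hQ fun i =>
    let ⟨_, h, e⟩ := hh i; ⟨_, h.upper v, fun a ha => by rw [e a ha]⟩
  lower v := measurable_of_countable_cases hQ fun i =>
    let ⟨_, h, e⟩ := hh i; ⟨_, h.lower v, fun a ha => by rw [e a ha]⟩

lemma MeasurableState.const (s : State X) : MeasurableState fun _ : α => s :=
  ⟨measurable_const, measurable_const, fun _ => measurable_const, fun _ => measurable_const,
    fun _ => measurable_const, fun _ => measurable_const⟩

/-- A quantity that depends only on the evaluated nodes and measurably on another parameter is
measurable. -/
lemma MeasurableState.measurable_of_design (hS : MeasurableState S) {β : Type*} [MeasurableSpace β]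
    {h : α → β} (hh : ∀ (m : ℕ) (q : Fin m → Node), ∃ h' : α → β, Measurable h' ∧
      ∀ a, (S a).numEvals = m → (∀ j : Fin m, (S a).node j = q j) → h a = h' a) :
    Measurable h := by
  choose h' hm he using hh
  refine measurable_of_countable_cases (Q := fun a => (S a).numEvals)
    (fun m => hS.numEvals (measurableSet_singleton m)) fun m => ?_
  refine ⟨fun a => h' m (fun j => (S a).node j) a, ?_, fun a ha => he _ _ a ha fun j => rfl⟩
  refine measurable_of_countable_cases (Q := fun a => fun j : Fin m => (S a).node j)
    (fun q => ?_) fun q => ⟨h' m q, hm m q, fun a ha => by rw [ha]⟩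
  exact (measurable_pi_lambda _ fun j : Fin m => hS.node j) (measurableSet_singleton q)

variable [MetricSpace X] {A : Inputs X}

lemma MeasurableState.mean (hS : MeasurableState S) (v : Node) :
    Measurable fun a => (S a).mean A v := by
  refine hS.measurable_of_design fun m q => ?_
  refine ⟨fun a => postMean A.k A.σ m
    (fun j => if h : j < m then A.tree.center (q ⟨j, h⟩) else A.tree.center (0, 0)) (S a).obs
    (A.tree.center v), ?_, fun a ha hq => ?_⟩
  · simp only [postMean_eq]
    exact Finset.measurable_sum _ fun i _ => measurable_const.mul (hS.obs i)
  · rw [State.mean, ha]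
    refine postMean_congr_design (fun i hi => ?_) _ _
    rw [dif_pos hi, State.point, ← hq ⟨i, hi⟩]

lemma MeasurableState.std (hS : MeasurableState S) (v : Node) :
    Measurable fun a => (S a).std A v := by
  refine hS.measurable_of_design fun m q => ?_
  refine ⟨fun a => postStd A.k A.σ m
    (fun j => if h : j < m then A.tree.center (q ⟨j, h⟩) else A.tree.center (0, 0))
    (A.tree.center v), measurable_const, fun a ha hq => ?_⟩
  rw [State.std, ha, postStd, postStd]
  congr 1
  refine postVar_congr_design (fun i hi => ?_) _
  rw [dif_pos hi, State.point, ← hq ⟨i, hi⟩]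

lemma MeasurableState.currUpper (hS : MeasurableState S) (v : Node) :
    Measurable fun a => (S a).currUpper A v := by
  have h1 := fun v => hS.mean (A := A) v
  have h2 := fun v => hS.std (A := A) v
  unfold State.currUpper
  split_ifs
  · exact ((h1 v).add ((h2 v).const_mul _)).add_const _
  · exact (((h1 v).add ((h2 v).const_mul _)).min
      (((h1 _).add ((h2 _).const_mul _)).add_const _)).add_const _

lemma MeasurableState.currLower (hS : MeasurableState S) (v : Node) :
    Measurable fun a => (S a).currLower A v := by
  have h1 := fun v => hS.mean (A := A) v
  have h2 := fun v => hS.std (A := A) v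
  unfold State.currLower
  split_ifs
  · exact ((h1 v).sub ((h2 v).const_mul _)).sub_const _
  · exact (((h1 v).sub ((h2 v).const_mul _)).max
      (((h1 _).sub ((h2 _).const_mul _)).sub_const _)).sub_const _

lemma MeasurableState.updateBounds (hS : MeasurableState S) :
    MeasurableState fun a => (S a).updateBounds A where
  active := hS.active
  numEvals := hS.numEvals
  node := hS.node
  obs := hS.obs
  upper v := (hS.upper v).min (hS.currUpper v)
  lower v := (hS.lower v).max (hS.currLower v)

lemma MeasurableState.classify (hS : MeasurableState S) :
    MeasurableState fun a => (S a).classify A where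
  active := measurable_filter hS.active fun v =>
    (measurableSet_le measurable_const (hS.lower v)).compl.inter
      (measurableSet_lt (hS.upper v) measurable_const).compl
  numEvals := hS.numEvals
  node := hS.node
  obs := hS.obs
  upper := hS.upper
  lower := hS.lower

lemma MeasurableState.argmax (hS : MeasurableState S) :
    Measurable fun a => (S a).argmax A := by
  refine measurable_filter hS.active fun v => ?_
  have hi : ∀ v, Measurable fun a => (S a).index A v := fun v =>
    ((hS.upper v).sub_const _).max (measurable_const.sub (hS.lower v))
  have : {a | ∀ w ∈ (S a).active, (S a).index A w ≤ (S a).index A v} =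
      ⋂ w, ({a | w ∈ (S a).active}ᶜ ∪ {a | (S a).index A w ≤ (S a).index A v}) := by
    ext a
    simp only [mem_iInter, mem_union, mem_compl_iff]
    exact forall_congr' fun w => imp_iff_not_or
  rw [this]
  exact MeasurableSet.iInter fun w =>
    (hS.active (MeasurableSet.of_discrete (s := {C : Finset Node | w ∈ C}))).compl.union
      (measurableSet_le (hi w) (hi v))

lemma MeasurableState.act (hS : MeasurableState S) {y : α → ℕ → ℝ}
    (hy : ∀ j, Measurable fun a => y a j) (v : Node) :
    MeasurableState fun a => (S a).act A (fun _ => 0) (y a) v := by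
  have hc : MeasurableSet {a | A.β * (S a).std A v < A.V v.1 ∧ (v.1 : ℝ) ≤ A.hmax} :=
    (measurableSet_lt ((hS.std v).const_mul _) measurable_const).inter (MeasurableSet.const _)
  have hc' : ∀ b : Prop, MeasurableSet {a |
      (A.β * (S a).std A v < A.V v.1 ∧ (v.1 : ℝ) ≤ A.hmax) = b} := fun b => by
    simpa only [eq_iff_iff] using MeasurableSet.iff hc (MeasurableSet.const b)
  refine MeasurableState.of_cases hc' fun b => ?_
  by_cases hb : b
  · refine ⟨fun a => { S a with active := (S a).active.erase v ∪ v.children },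
      ⟨?_, hS.numEvals, hS.node, hS.obs, hS.upper, hS.lower⟩, fun a ha => ?_⟩
    · exact (Measurable.of_discrete (f := fun C : Finset Node => C.erase v ∪ v.children)).comp
        hS.active
    · rw [State.act, if_pos (ha ▸ hb)]
  · refine ⟨fun a => { S a with
      node := Function.update (S a).node (S a).numEvals v
      obs := Function.update (S a).obs (S a).numEvals (0 + y a (S a).numEvals)
      numEvals := (S a).numEvals + 1 },
      ⟨hS.active, hS.numEvals.add_const 1, fun j => ?_, fun j => ?_, hS.upper, hS.lower⟩,
      fun a ha => ?_⟩
    · simp only [Function.update_apply]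
      exact Measurable.ite (measurableSet_eq_fun measurable_const hS.numEvals) measurable_const
        (hS.node j)
    · have : ∀ a, Function.update (S a).obs (S a).numEvals (0 + y a (S a).numEvals) j =
          if j = (S a).numEvals then y a j else (S a).obs j := fun a => by
        rw [Function.update_apply]
        split_ifs with h
        · rw [h, zero_add]
        · rfl
      simp only [this]
      exact Measurable.ite (measurableSet_eq_fun measurable_const hS.numEvals) (hy j) (hS.obs j)
    · rw [State.act, if_neg (ha ▸ hb)]

/-- Every state of the run is a measurable function of the observations. -/
lemma measurableState_run {sel : ℕ → (ℕ → ℝ) → Finset Node → Node} (hsel : IsTieBreaking sel)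
    {y : α → ℕ → ℝ} (hy : ∀ j, Measurable fun a => y a j) (t : ℕ) :
    MeasurableState fun a => run A sel (fun _ => 0) (y a) t := by
  induction t with
  | zero => exact MeasurableState.const _
  | succ t ih =>
    have h1 := (ih.updateBounds (A := A)).classify (A := A)
    set S : α → State X := fun a => run A sel (fun _ => 0) (y a) t with hS
    set S' : α → State X := fun a => ((S a).updateBounds A).classify A with hS'
    have hH : MeasurableSet {a | (S a).Halted A} :=
      (measurableSet_eq_fun ih.numEvals measurable_const).union
        (ih.active (measurableSet_singleton ∅))
    have hE : MeasurableSet {a | (S' a).active = ∅} := h1.active (measurableSet_singleton ∅)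
    have hw : Measurable fun a => sel t (S' a).obs ((S' a).argmax A) := by
      refine measurable_of_countable_cases (Q := fun a => (S' a).argmax A)
        (fun C => h1.argmax (measurableSet_singleton C)) fun C => ?_
      exact ⟨fun a => sel t (S' a).obs C,
        (hsel.measurable t C).comp (measurable_pi_lambda _ h1.obs), fun a ha => by rw [ha]⟩
    have e : ∀ a, run A sel (fun _ => 0) (y a) (t + 1) =
        (S a).step A (sel t) (fun _ => 0) (y a) := fun a => rfl
    simp only [e]
    refine MeasurableState.of_cases (Q := fun a => ((S a).Halted A, (S' a).active = ∅,
      sel t (S' a).obs ((S' a).argmax A))) (fun i => ?_) fun i => ?_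
    · have : {a | ((S a).Halted A, (S' a).active = ∅, sel t (S' a).obs ((S' a).argmax A)) = i} =
          {a | (S a).Halted A ↔ i.1} ∩ ({a | (S' a).active = ∅ ↔ i.2.1} ∩
            {a | sel t (S' a).obs ((S' a).argmax A) = i.2.2}) := by
        ext a
        simp [Prod.ext_iff]
      rw [this]
      exact (hH.iff (MeasurableSet.const _)).inter ((hE.iff (MeasurableSet.const _)).inter
        (hw (measurableSet_singleton i.2.2)))
    · obtain ⟨b1, b2, w⟩ := i
      by_cases hb1 : b1
      · refine ⟨S, ih, fun a ha => ?_⟩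
        simp only [Prod.mk.injEq] at ha
        rw [State.step_of_halted (ha.1 ▸ hb1)]
      by_cases hb2 : b2
      · refine ⟨S', h1, fun a ha => ?_⟩
        simp only [Prod.mk.injEq] at ha
        rw [State.step_of_not_halted (ha.1 ▸ hb1), if_pos (ha.2.1 ▸ hb2)]
      · refine ⟨_, h1.act (A := A) hy w, fun a ha => ?_⟩
        simp only [Prod.mk.injEq] at ha
        rw [State.step_of_not_halted (ha.1 ▸ hb1), if_neg (ha.2.1 ▸ hb2), ← ha.2.2]

end Measurability

/-! ### Uniform credible intervals along the adaptive design -/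

section Credible

variable {X : Type*} [MetricSpace X] {A : Inputs X} {sel : ℕ → (ℕ → ℝ) → Finset Node → Node}

lemma run_obs (F : X → ℝ) (ε : ℕ → ℝ) (t j : ℕ) (hj : j < (run A sel F ε t).numEvals) :
    (run A sel F ε t).obs j = F ((run A sel F ε t).point A j) + ε j := by
  induction t with
  | zero => exact absurd hj (Nat.not_lt_zero _)
  | succ t ih =>
    rw [run] at hj ⊢
    set s := run A sel F ε t
    by_cases hh : s.Halted A
    · rw [State.step_of_halted hh] at hj ⊢
      exact ih hj
    rw [State.step_of_not_halted hh] at hj ⊢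
    split_ifs at hj ⊢ with h1
    · exact ih hj
    · simp only [State.act] at hj ⊢
      split_ifs at hj ⊢ with h2
      · exact ih hj
      · simp only [State.point]
        rcases Nat.lt_succ_iff_lt_or_eq.1 hj with h | h
        · rw [Function.update_of_ne h.ne, Function.update_of_ne h.ne]
          exact ih h
        · subst h
          rw [Function.update_self, Function.update_self]

variable {Ω : Type*} {f : X → Ω → ℝ} {η : ℕ → Ω → ℝ}

/-- The sequence of evaluation points of a finite sequence of nodes, continued arbitrarily. -/
def designPoint (A : Inputs X) {m : ℕ} (q : Fin m → Node) (j : ℕ) : X :=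
  if h : j < m then A.tree.center (q ⟨j, h⟩) else A.tree.center (0, 0)

lemma designPoint_of_lt {m : ℕ} (q : Fin m → Node) {j : ℕ} (h : j < m) :
    designPoint A q j = A.tree.center (q ⟨j, h⟩) := dif_pos h

/-- The event that the first `m` evaluations are made at the nodes `q`. -/
def designEvent (A : Inputs X) (sel : ℕ → (ℕ → ℝ) → Finset Node → Node) (f : X → Ω → ℝ)
    (η : ℕ → Ω → ℝ) {m : ℕ} (q : Fin m → Node) : Set Ω :=
  {ω | ∃ t, (run A sel (fun x => f x ω) (fun j => η j ω) t).numEvals = m ∧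
    ∀ j : Fin m, (run A sel (fun x => f x ω) (fun j => η j ω) t).node j = q j}

/-- The set of observation vectors for which the first `m` evaluations are made at the nodes `q`. -/
def designObs (A : Inputs X) (sel : ℕ → (ℕ → ℝ) → Finset Node → Node) {m : ℕ}
    (q : Fin m → Node) : Set (Fin m → ℝ) :=
  {y | ∃ t, (run A sel (fun _ => 0) (extendZero y) t).numEvals = m ∧
    ∀ j : Fin m, (run A sel (fun _ => 0) (extendZero y) t).node j = q j}

lemma measurableSet_designObs (hsel : IsTieBreaking sel) {m : ℕ} (q : Fin m → Node) :
    MeasurableSet (designObs A sel q) := by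
  have h : designObs A sel q = ⋃ t : ℕ, ({y : Fin m → ℝ |
      (run A sel (fun _ => 0) (extendZero y) t).numEvals = m} ∩ ⋂ j : Fin m, {y : Fin m → ℝ |
      (run A sel (fun _ => 0) (extendZero y) t).node j = q j}) := by
    ext y
    simp [designObs]
  rw [h]
  refine MeasurableSet.iUnion fun t => ?_
  have ht := measurableState_run (A := A) hsel (y := fun y : Fin m → ℝ => extendZero y)
    measurable_extendZero t
  exact (ht.numEvals (measurableSet_singleton m)).inter
    (MeasurableSet.iInter fun j => ht.node j (measurableSet_singleton (q j)))

lemma designEvent_eq {m : ℕ} (q : Fin m → Node) :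
    designEvent A sel f η q =
      (fun ω (i : Fin m) => f (designPoint A q i) ω + η i ω) ⁻¹' designObs A sel q := by
  ext ω
  have hval : ∀ (j : ℕ) (hj : j < m),
      extendZero (fun i : Fin m => f (designPoint A q i) ω + η i ω) j =
        f (A.tree.center (q ⟨j, hj⟩)) ω + η j ω := fun j hj => by
    rw [extendZero_of_lt (fun i => f (designPoint A q i) ω + η i ω) hj, designPoint_of_lt q hj]
  constructor
  · rintro ⟨t, ht, hq⟩
    refine ⟨t, ?_⟩
    have := run_congr (A := A) (sel := sel) (F := fun x => f x ω) (F' := fun _ => 0)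
      (ε := fun j => η j ω)
      (ε' := extendZero fun i : Fin m => f (designPoint A q i) ω + η i ω) (t := t)
      fun j hj => by
        rw [ht] at hj
        rw [hval j hj, hq ⟨j, hj⟩, zero_add]
    rw [this]
    exact ⟨ht, hq⟩
  · rintro ⟨t, ht, hq⟩
    refine ⟨t, ?_⟩
    have := run_congr (A := A) (sel := sel) (F' := fun x => f x ω) (F := fun _ => 0)
      (ε' := fun j => η j ω)
      (ε := extendZero fun i : Fin m => f (designPoint A q i) ω + η i ω) (t := t)
      fun j hj => by
        rw [ht] at hj
        rw [hval j hj, hq ⟨j, hj⟩, zero_add]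
    rw [this]
    exact ⟨ht, hq⟩

lemma designEvent_disjoint {m : ℕ} :
    Pairwise (Function.onFun Disjoint fun q : Fin m → Node => designEvent A sel f η q) := by
  intro q q' hne
  refine Set.disjoint_left.2 fun ω ⟨t, ht, hq⟩ ⟨t', ht', hq'⟩ => hne (funext fun j => ?_)
  rw [← hq j, ← hq' j]
  rcases le_total t t' with h | h
  · exact ((run_numEvals_node (A := A) (sel := sel) _ _ h).2 j (by rw [ht]; exact j.2)).symm
  · exact (run_numEvals_node (A := A) (sel := sel) _ _ h).2 j (by rw [ht']; exact j.2)

variable [MeasurableSpace Ω] {P : Measure Ω} [IsProbabilityMeasure P]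

/-- The posterior error at a point after `m` evaluations has Gaussian tails although the design is
adaptive: on the event that the design is `q`, which is determined by the observations at `q`, the
error is a Gaussian variable that is independent of these observations. -/
lemma measure_posterior_error (hk : IsCovarianceFunction A.k) (hσ : 0 < A.σ)
    (hf : IsCenteredGP A.k f P) (hη : IsNoise A.σ f η P) (hsel : IsTieBreaking sel)
    (hβ : 0 ≤ A.β) (m : ℕ) (v : Node) :
    P {ω | ∃ t, (run A sel (fun x => f x ω) (fun j => η j ω) t).numEvals = m ∧
      A.β * (run A sel (fun x => f x ω) (fun j => η j ω) t).std A v <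
        |f (A.tree.center v) ω - (run A sel (fun x => f x ω) (fun j => η j ω) t).mean A v|} ≤
      ENNReal.ofReal (2 * Real.exp (-A.β ^ 2 / 2)) := by
  set c := A.tree.center v
  let R : (Fin m → Node) → Ω → ℝ := fun q => residual A.k A.σ f η m (designPoint A q) c 0
  let B : (Fin m → Node) → Set Ω := fun q =>
    {ω | postStd A.k A.σ m (designPoint A q) c * A.β < |R q ω|}
  have hfm := hf.measurable
  have hηm := hη.measurable
  have hD : ∀ q : Fin m → Node, MeasurableSet (designEvent A sel f η q) := fun q => by
    rw [designEvent_eq]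
    have : Measurable fun ω (i : Fin m) => f (designPoint A q i) ω + η i ω := by fun_prop
    exact this (measurableSet_designObs hsel q)
  have hsub : {ω | ∃ t, (run A sel (fun x => f x ω) (fun j => η j ω) t).numEvals = m ∧
      A.β * (run A sel (fun x => f x ω) (fun j => η j ω) t).std A v <
        |f (A.tree.center v) ω - (run A sel (fun x => f x ω) (fun j => η j ω) t).mean A v|} ⊆
      ⋃ q : Fin m → Node, designEvent A sel f η q ∩ B q := by
    rintro ω ⟨t, ht, hlt⟩
    set s := run A sel (fun x => f x ω) (fun j => η j ω) t with hs
    refine mem_iUnion.2 ⟨fun j => s.node j, ⟨t, ht, fun j => rfl⟩, ?_⟩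
    have hp : ∀ i < m, s.point A i = designPoint A (fun j : Fin m => s.node j) i := fun i hi => by
      rw [designPoint_of_lt _ hi, State.point]
    have hstd : s.std A v = postStd A.k A.σ m (designPoint A fun j : Fin m => s.node j) c := by
      rw [State.std, ht, postStd, postStd, postVar_congr_design hp]
    have hmean : f c ω - s.mean A v = R (fun j => s.node j) ω := by
      simp only [R, residual, zero_mul, add_zero]
      rw [State.mean, ht, postMean_congr_design hp, postMean_eq]
      congr 1
      refine Finset.sum_congr rfl fun i _ => ?_
      rw [run_obs _ _ _ _ (by rw [ht]; exact i.2), ← hs, hp i i.2]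
    change postStd A.k A.σ m _ c * A.β < |R _ ω|
    rw [← hmean, ← hstd, mul_comm]
    exact hlt
  have htail : ∀ q, P (B q) ≤ ENNReal.ofReal (2 * Real.exp (-A.β ^ 2 / 2)) := fun q => by
    have hmap := map_residual hk hσ hf hη m (designPoint A q) c 0
    refine gaussian_tail (measurable_residual hf hη _ _ _ _) hmap (Real.sqrt_nonneg _) hβ ?_
    rw [postStd, Real.sq_sqrt (postVar_nonneg hk hσ hf hη _ _ _)]
    simp
  have hprod : ∀ q, P (designEvent A sel f η q ∩ B q) = P (designEvent A sel f η q) * P (B q) := by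
    intro q
    have hind := (indepFun_residual hk hσ hf hη m (designPoint A q) c 0).symm
    have := hind.measure_inter_preimage_eq_mul (designObs A sel q)
      {r | postStd A.k A.σ m (designPoint A q) c * A.β < |r|} (measurableSet_designObs hsel q)
      (measurableSet_lt measurable_const measurable_norm)
    rw [designEvent_eq]
    exact this
  calc _ ≤ P (⋃ q : Fin m → Node, designEvent A sel f η q ∩ B q) := measure_mono hsub
    _ ≤ ∑' q : Fin m → Node, P (designEvent A sel f η q ∩ B q) := measure_iUnion_le _
    _ ≤ ∑' q : Fin m → Node, P (designEvent A sel f η q) *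
          ENNReal.ofReal (2 * Real.exp (-A.β ^ 2 / 2)) :=
        ENNReal.tsum_le_tsum fun q => by rw [hprod]; gcongr; exact htail q
    _ = P (⋃ q : Fin m → Node, designEvent A sel f η q) *
          ENNReal.ofReal (2 * Real.exp (-A.β ^ 2 / 2)) := by
        rw [ENNReal.tsum_mul_right, measure_iUnion designEvent_disjoint hD]
    _ ≤ 1 * ENNReal.ofReal (2 * Real.exp (-A.β ^ 2 / 2)) := by gcongr; exact prob_le_one
    _ = _ := one_mul _

/-- The nodes of the tree of depth at most `H + 1`. -/
def treeNodes (H : ℕ) : Finset Node :=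
  (Finset.range (H + 2)).biUnion fun h => (Finset.range (2 ^ h)).image fun i => (h, i)

lemma mem_treeNodes {H : ℕ} {v : Node} : v ∈ treeNodes H ↔ v.1 ≤ H + 1 ∧ v.2 < 2 ^ v.1 := by
  simp only [treeNodes, Finset.mem_biUnion, Finset.mem_range, Finset.mem_image]
  constructor
  · rintro ⟨h, hh, i, hi, rfl⟩
    exact ⟨by simpa using Nat.lt_succ_iff.1 hh, hi⟩
  · rintro ⟨h1, h2⟩
    exact ⟨v.1, by omega, v.2, h2, rfl⟩

lemma card_treeNodes_le (H : ℕ) : (treeNodes H).card ≤ 2 ^ (H + 2) := by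
  refine Finset.card_biUnion_le.trans ?_
  calc _ ≤ ∑ h ∈ Finset.range (H + 2), 2 ^ h :=
        Finset.sum_le_sum fun h _ => Finset.card_image_le.trans (Finset.card_range _).le
    _ ≤ 2 ^ (H + 2) := by
        have := Nat.geomSum_lt (m := 2) (n := H + 2) (s := Finset.range (H + 2)) le_rfl
          fun k hk => Finset.mem_range.1 hk
        exact this.le

/-- The event that some credible interval at a node of depth at most `H + 1` fails before the budget
is used. -/
def posteriorFailure (A : Inputs X) (sel : ℕ → (ℕ → ℝ) → Finset Node → Node) (f : X → Ω → ℝ)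
    (η : ℕ → Ω → ℝ) (H : ℕ) : Set Ω :=
  {ω | ∃ t, (run A sel (fun x => f x ω) (fun j => η j ω) t).numEvals < A.n ∧ ∃ v ∈ treeNodes H,
      A.β * (run A sel (fun x => f x ω) (fun j => η j ω) t).std A v <
        |f (A.tree.center v) ω - (run A sel (fun x => f x ω) (fun j => η j ω) t).mean A v|}

lemma measure_posteriorFailure_le (hk : IsCovarianceFunction A.k) (hσ : 0 < A.σ)
    (hf : IsCenteredGP A.k f P) (hη : IsNoise A.σ f η P) (hsel : IsTieBreaking sel)
    (hβ : 0 ≤ A.β) (H : ℕ) :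
    P (posteriorFailure A sel f η H) ≤
      ENNReal.ofReal (A.n * 2 ^ (H + 2) * (2 * Real.exp (-A.β ^ 2 / 2))) := by
  have hsub : posteriorFailure A sel f η H ⊆ ⋃ m ∈ Finset.range A.n, ⋃ v ∈ treeNodes H,
      {ω | ∃ t, (run A sel (fun x => f x ω) (fun j => η j ω) t).numEvals = m ∧
        A.β * (run A sel (fun x => f x ω) (fun j => η j ω) t).std A v <
        |f (A.tree.center v) ω - (run A sel (fun x => f x ω) (fun j => η j ω) t).mean A v|} := by
    rintro ω ⟨t, ht, v, hv, hlt⟩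
    simp only [mem_iUnion]
    exact ⟨_, Finset.mem_range.2 ht, v, hv, t, rfl, hlt⟩
  set e := ENNReal.ofReal (2 * Real.exp (-A.β ^ 2 / 2)) with he
  calc _ ≤ _ := measure_mono hsub
    _ ≤ ∑ m ∈ Finset.range A.n, ∑ v ∈ treeNodes H, e := by
        refine (measure_biUnion_finset_le _ _).trans (Finset.sum_le_sum fun m _ => ?_)
        refine (measure_biUnion_finset_le _ _).trans (Finset.sum_le_sum fun v _ => ?_)
        exact measure_posterior_error hk hσ hf hη hsel hβ m v
    _ = (A.n * (treeNodes H).card : ℕ) * e := by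
        simp only [Finset.sum_const, Finset.card_range, nsmul_eq_mul]
        push_cast
        ring
    _ ≤ (A.n * 2 ^ (H + 2) : ℕ) * e := by
        gcongr
        exact card_treeNodes_le H
    _ = _ := by
        rw [he, ENNReal.ofReal_mul (p := (A.n : ℝ) * 2 ^ (H + 2)) (by positivity),
          ← ENNReal.ofReal_natCast]
        push_cast
        rfl

end Credible

/-! ### Deterministic analysis of a successful run -/

section Analysis

variable {X : Type*} [MetricSpace X] {A : Inputs X} {sel : ℕ → (ℕ → ℝ) → Finset Node → Node}
  {F : X → ℝ} {ε : ℕ → ℝ} {H : ℕ} {Γ : ℝ} {s : State X}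

/-- The hypotheses of the deterministic analysis: all credible intervals hold until the budget is
used, the function varies by at most `V h` on the cells of depth `h`, and the bounds `V` increase at
most by a factor `Γ` from a depth to a larger one. Only nodes of depth at most `H + 1` occur. -/
structure GoodRun (A : Inputs X) (sel : ℕ → (ℕ → ℝ) → Finset Node → Node) (F : X → ℝ)
    (ε : ℕ → ℝ) (H : ℕ) (Γ : ℝ) : Prop where
  n_pos : 0 < A.n
  tie : IsTieBreaking sel
  hmax : ∀ h : ℕ, (h : ℝ) ≤ A.hmax ↔ h ≤ H
  one_le : 1 ≤ Γ
  V_nonneg : ∀ h, 0 ≤ A.V h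
  V_le : ∀ h h', h ≤ h' → h' ≤ H + 1 → A.V h' ≤ Γ * A.V h
  cells : ∀ v ∈ treeNodes H, ∀ x ∈ A.tree.cell v, |F x - F (A.tree.center v)| ≤ A.V v.1
  post : ∀ t, (run A sel F ε t).numEvals < A.n → ∀ v ∈ treeNodes H,
    |F (A.tree.center v) - (run A sel F ε t).mean A v| ≤ A.β * (run A sel F ε t).std A v

/-- What is remembered about an evaluation at the node `v`, with posterior standard deviation `r`
and selection index `I`. The last two clauses say that the index of the nodes active at any later
time is at most `6 Γ I`. -/
structure EvalRecord (A : Inputs X) (F : X → ℝ) (H : ℕ) (Γ : ℝ) (s : State X) (v : Node) (r : ℝ)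
    (I : ℝ) : Prop where
  node : v ∈ treeNodes H
  parent : v.1 ≠ 0 → |F (A.tree.center v.parent) - A.τ| ≤ 4 * A.V (v.1 - 1)
  pos : 0 < I
  le_std : I ≤ 2 * (A.β * r) + 2 * A.V v.1
  V_le : v.1 ≤ H → A.V v.1 ≤ A.β * r
  le_V : v.1 ≠ 0 → I ≤ 4 * A.V (v.1 - 1) + 2 * A.V v.1
  index_le : ∀ w ∈ s.active, s.index A w ≤ 6 * Γ * I
  exists_V_le : ∀ w ∈ s.active, ∃ h ≤ w.1, A.V h ≤ I

/-- The posterior standard deviation at the time and place of the `j`-th evaluation. -/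
noncomputable def State.evalStd (A : Inputs X) (s : State X) (j : ℕ) : ℝ :=
  postStd A.k A.σ j (s.point A) (s.point A j)

/-- The invariants of a successful run. The upper bounds keep the margin `V h` above the value at the
center (and the lower bounds below it), so that classifying a whole cell is correct. -/
structure Invariant (A : Inputs X) (F : X → ℝ) (H : ℕ) (Γ : ℝ) (s : State X) : Prop where
  nodes : ∀ v ∈ s.active, v ∈ treeNodes H
  numEvals_le : s.numEvals ≤ A.n
  upper : ∀ v ∈ treeNodes H, F (A.tree.center v) + A.V v.1 ≤ s.upper v
  lower : ∀ v ∈ treeNodes H, s.lower v ≤ F (A.tree.center v) - A.V v.1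
  width : ∀ v ∈ s.active, v.1 ≠ 0 → s.upper v - s.lower v ≤ 4 * A.V (v.1 - 1) + 2 * A.V v.1
  parent : ∀ v ∈ s.active, v.1 ≠ 0 → |F (A.tree.center v.parent) - A.τ| ≤ 4 * A.V (v.1 - 1)
  inSet : ∀ x ∈ s.inSet, A.τ ≤ F x
  outSet : ∀ x ∈ s.outSet, F x < A.τ
  cover : ∀ x, x ∈ s.inSet ∨ x ∈ s.outSet ∨ ∃ v ∈ s.active, x ∈ A.tree.cell v
  record : ∀ j < s.numEvals, ∃ I, EvalRecord A F H Γ s (s.node j) (s.evalStd A j) I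
  first : 0 < s.numEvals → A.τ ≤ A.β * s.evalStd A 0 + A.V (s.node 0).1

lemma parent_mem_treeNodes {v : Node} (hv : v ∈ treeNodes H) : v.parent ∈ treeNodes H := by
  rw [mem_treeNodes] at hv ⊢
  obtain ⟨h, i⟩ := v
  simp only [Node.parent] at hv ⊢
  refine ⟨by omega, ?_⟩
  cases h with
  | zero => simp at hv ⊢; omega
  | succ h =>
    have : 2 ^ (h + 1) = 2 * 2 ^ h := by ring
    simp only [Nat.add_sub_cancel]
    omega

lemma mem_children {v w : Node} (hw : w ∈ v.children) : w.1 = v.1 + 1 ∧ w.parent = v := by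
  simp only [Node.children, Finset.mem_insert, Finset.mem_singleton] at hw
  obtain ⟨h, i⟩ := v
  rcases hw with rfl | rfl
  · exact ⟨rfl, by simp [Node.parent]⟩
  · refine ⟨rfl, ?_⟩
    simp only [Node.parent, Nat.add_sub_cancel, Prod.mk.injEq, true_and]
    omega

lemma children_mem_treeNodes {v w : Node} (hv : v ∈ treeNodes H) (hH : v.1 ≤ H)
    (hw : w ∈ v.children) : w ∈ treeNodes H := by
  rw [mem_treeNodes] at hv ⊢
  have : 2 ^ (v.1 + 1) = 2 * 2 ^ v.1 := by ring
  simp only [Node.children, Finset.mem_insert, Finset.mem_singleton] at hw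
  rcases hw with rfl | rfl
  · exact ⟨by simpa using hH, by simp only; omega⟩
  · exact ⟨by simpa using hH, by simp only; omega⟩

lemma currUpper_le (v : Node) :
    s.currUpper A v ≤ s.mean A v + A.β * s.std A v + A.V v.1 := by
  rw [State.currUpper]
  split_ifs
  · exact le_rfl
  · gcongr
    exact min_le_left _ _

lemma le_currLower (v : Node) :
    s.mean A v - A.β * s.std A v - A.V v.1 ≤ s.currLower A v := by
  rw [State.currLower]
  split_ifs
  · exact le_rfl
  · gcongr
    exact le_max_left _ _

lemma currUpper_le_parent {v : Node} (hv : v.1 ≠ 0) : s.currUpper A v ≤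
    s.mean A v.parent + A.β * s.std A v.parent + A.V (v.1 - 1) + A.V v.1 := by
  rw [State.currUpper, if_neg hv]
  gcongr
  exact min_le_right _ _

lemma le_currLower_parent {v : Node} (hv : v.1 ≠ 0) :
    s.mean A v.parent - A.β * s.std A v.parent - A.V (v.1 - 1) - A.V v.1 ≤ s.currLower A v := by
  rw [State.currLower, if_neg hv]
  gcongr
  exact le_max_right _ _

lemma center_mem_cell (T : PartitionTree X) {h i : ℕ} (hi : i < 2 ^ h) :
    T.center (h, i) ∈ T.cell (h, i) :=
  T.inner h i hi (Metric.mem_ball_self (mul_pos T.v₂_pos (pow_pos T.ρ_pos _)))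

lemma cell_subset_parent (T : PartitionTree X) {v : Node} (hv : v.1 ≠ 0) (hi : v.2 < 2 ^ v.1) :
    T.cell v ⊆ T.cell v.parent := by
  obtain ⟨h, i⟩ := v
  obtain ⟨h, rfl⟩ := Nat.exists_eq_succ_of_ne_zero hv
  simp only [Nat.succ_eq_add_one] at hi ⊢
  have h2 : 2 ^ (h + 1) = 2 * 2 ^ h := by ring
  have hs := T.split h (i / 2) (by omega)
  simp only [Node.parent, Nat.add_sub_cancel]
  rw [← hs]
  rcases Nat.even_or_odd' i with ⟨j, rfl | rfl⟩
  · rw [show 2 * j / 2 = j by omega]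
    exact subset_union_left
  · rw [show (2 * j + 1) / 2 = j by omega]
    exact subset_union_right

/-- The current bounds enclose the value at the center with a margin that covers the cell. -/
lemma currBounds_enclose
    (hcell : ∀ v ∈ treeNodes H, ∀ x ∈ A.tree.cell v, |F x - F (A.tree.center v)| ≤ A.V v.1)
    (hpost : ∀ v ∈ treeNodes H, |F (A.tree.center v) - s.mean A v| ≤ A.β * s.std A v)
    {v : Node} (hv : v ∈ treeNodes H) :
    F (A.tree.center v) + A.V v.1 ≤ s.currUpper A v ∧
      s.currLower A v ≤ F (A.tree.center v) - A.V v.1 := by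
  have h1 := abs_le.1 (hpost v hv)
  by_cases h0 : v.1 = 0
  · rw [State.currUpper, State.currLower, if_pos h0, if_pos h0]
    constructor <;> linarith
  · have h2 := abs_le.1 (hpost _ (parent_mem_treeNodes hv))
    have hc : A.tree.center v ∈ A.tree.cell v.parent :=
      cell_subset_parent A.tree h0 (mem_treeNodes.1 hv).2
        (center_mem_cell A.tree (mem_treeNodes.1 hv).2)
    have h3 := abs_le.1 (hcell _ (parent_mem_treeNodes hv) _ hc)
    have h4 : v.parent.1 = v.1 - 1 := rfl
    rw [h4] at h3
    rw [State.currUpper, State.currLower, if_neg h0, if_neg h0]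
    constructor
    · gcongr
      exact le_min (by linarith) (by linarith)
    · gcongr
      exact max_le (by linarith) (by linarith)

lemma EvalRecord.mono {s' : State X} {v : Node} {r I : ℝ} (h : EvalRecord A F H Γ s v r I)
    (hi : ∀ w ∈ s'.active, s'.index A w ≤ 6 * Γ * I)
    (hV : ∀ w ∈ s'.active, ∃ h ≤ w.1, A.V h ≤ I) : EvalRecord A F H Γ s' v r I :=
  { h with index_le := hi, exists_V_le := hV }

lemma Invariant.updateBounds (hs : Invariant A F H Γ s)
    (hcell : ∀ v ∈ treeNodes H, ∀ x ∈ A.tree.cell v, |F x - F (A.tree.center v)| ≤ A.V v.1)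
    (hpost : ∀ v ∈ treeNodes H, |F (A.tree.center v) - s.mean A v| ≤ A.β * s.std A v) :
    Invariant A F H Γ (s.updateBounds A) where
  nodes := hs.nodes
  numEvals_le := hs.numEvals_le
  upper v hv := le_min (hs.upper v hv) (currBounds_enclose hcell hpost hv).1
  lower v hv := max_le (hs.lower v hv) (currBounds_enclose hcell hpost hv).2
  width v hv h0 := by
    refine le_trans (sub_le_sub ?_ ?_) (hs.width v hv h0)
    · exact min_le_left _ _
    · exact le_max_left _ _
  parent := hs.parent
  inSet := hs.inSet
  outSet := hs.outSet
  cover := hs.cover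
  record j hj := by
    obtain ⟨I, hI⟩ := hs.record j hj
    refine ⟨I, hI.mono (fun w hw => le_trans ?_ (hI.index_le w hw)) hI.exists_V_le⟩
    exact max_le_max (sub_le_sub_right (min_le_left _ _) _) (sub_le_sub_left (le_max_left _ _) _)
  first := hs.first

lemma Invariant.classify (hs : Invariant A F H Γ s)
    (hcell : ∀ v ∈ treeNodes H, ∀ x ∈ A.tree.cell v, |F x - F (A.tree.center v)| ≤ A.V v.1) :
    Invariant A F H Γ (s.classify A) := by
  have hsub : ∀ v ∈ (s.classify A).active, v ∈ s.active := fun v hv => (Finset.mem_filter.1 hv).1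
  exact
  { nodes := fun v hv => hs.nodes v (hsub v hv)
    numEvals_le := hs.numEvals_le
    upper := hs.upper
    lower := hs.lower
    width := fun v hv => hs.width v (hsub v hv)
    parent := fun v hv => hs.parent v (hsub v hv)
    inSet := fun x hx => by
      rcases hx with hx | hx
      · exact hs.inSet x hx
      · simp only [Finset.mem_filter, mem_iUnion, exists_prop] at hx
        obtain ⟨v, ⟨hv, hτ⟩, hx⟩ := hx
        have h1 := hs.lower v (hs.nodes v hv)
        have h2 := abs_le.1 (hcell v (hs.nodes v hv) x hx)
        linarith
    outSet := fun x hx => by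
      rcases hx with hx | hx
      · exact hs.outSet x hx
      · simp only [Finset.mem_filter, mem_iUnion, exists_prop] at hx
        obtain ⟨v, ⟨hv, _, hτ⟩, hx⟩ := hx
        have h1 := hs.upper v (hs.nodes v hv)
        have h2 := abs_le.1 (hcell v (hs.nodes v hv) x hx)
        linarith
    cover := fun x => by
      rcases hs.cover x with hx | hx | ⟨v, hv, hx⟩
      · exact Or.inl (Or.inl hx)
      · exact Or.inr (Or.inl (Or.inl hx))
      · by_cases h1 : A.τ ≤ s.lower v
        · refine Or.inl (Or.inr ?_)
          simp only [Finset.mem_filter, mem_iUnion, exists_prop]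
          exact ⟨v, ⟨hv, h1⟩, hx⟩
        by_cases h2 : s.upper v < A.τ
        · refine Or.inr (Or.inl (Or.inr ?_))
          simp only [Finset.mem_filter, mem_iUnion, exists_prop]
          exact ⟨v, ⟨hv, h1, h2⟩, hx⟩
        · exact Or.inr (Or.inr ⟨v, Finset.mem_filter.2 ⟨hv, h1, h2⟩, hx⟩)
    record := fun j hj => by
      obtain ⟨I, hI⟩ := hs.record j hj
      exact ⟨I, hI.mono (fun w hw => hI.index_le w (hsub w hw))
        fun w hw => hI.exists_V_le w (hsub w hw)⟩
    first := hs.first }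

lemma Invariant.V_le_index (hs : Invariant A F H Γ s) {w : Node} (hw : w ∈ s.active) :
    A.V w.1 ≤ s.index A w := by
  have h1 := hs.upper w (hs.nodes w hw)
  have h2 := hs.lower w (hs.nodes w hw)
  rw [State.index]
  rcases le_total A.τ (F (A.tree.center w)) with h | h
  · exact le_trans (by linarith) (le_max_left _ _)
  · exact le_trans (by linarith) (le_max_right _ _)

/-- Refining a node preserves the invariants. The bounds of a child are at least as good as those
inherited from its parent, where `β σ < V`; so the index of a child of a node of depth `h` is at most
`4 V h + V (h + 1)`, which a past evaluation with index `I ≥ V h₀`, `h₀ ≤ h`, dominates up to the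
factor `6 Γ`. -/
lemma Invariant.refine (hs : Invariant A F H Γ s) (hΓ : 1 ≤ Γ) (hV : ∀ h, 0 ≤ A.V h)
    (hVΓ : ∀ h h', h ≤ h' → h' ≤ H + 1 → A.V h' ≤ Γ * A.V h) {v : Node} (hv : v ∈ s.active)
    (hvH : v.1 ≤ H) (hstd : A.β * s.std A v < A.V v.1)
    (hu : ∀ w, s.upper w ≤ s.currUpper A w) (hl : ∀ w, s.currLower A w ≤ s.lower w)
    (hlτ : s.lower v < A.τ) (huτ : A.τ ≤ s.upper v) :
    Invariant A F H Γ { s with active := s.active.erase v ∪ v.children } := by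
  have hvn := hs.nodes v hv
  have u1 := (hu v).trans (currUpper_le v)
  have l1 := (le_currLower v).trans (hl v)
  have hch : ∀ w ∈ v.children, s.upper w ≤ s.mean A v + A.β * s.std A v + A.V v.1 + A.V w.1 ∧
      s.mean A v - A.β * s.std A v - A.V v.1 - A.V w.1 ≤ s.lower w := fun w hw => by
    obtain ⟨e1, e2⟩ := mem_children hw
    have hw0 : w.1 ≠ 0 := by omega
    have a := (hu w).trans (currUpper_le_parent hw0)
    have b := (le_currLower_parent hw0).trans (hl w)
    rw [e2, show w.1 - 1 = v.1 by omega] at a b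
    exact ⟨a, b⟩
  have hcase : ∀ w ∈ s.active.erase v ∪ v.children, w ∈ s.active ∨ w ∈ v.children := fun w hw => by
    rcases Finset.mem_union.1 hw with h | h
    · exact Or.inl (Finset.mem_of_mem_erase h)
    · exact Or.inr h
  exact
  { nodes := fun w hw => (hcase w hw).elim (hs.nodes w) (children_mem_treeNodes hvn hvH)
    numEvals_le := hs.numEvals_le
    upper := hs.upper
    lower := hs.lower
    width := fun w hw h0 => by
      rcases hcase w hw with h | h
      · exact hs.width w h h0
      · have := hch w h
        rw [show w.1 - 1 = v.1 by have := (mem_children h).1; omega]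
        linarith [this.1, this.2]
    parent := fun w hw h0 => by
      rcases hcase w hw with h | h
      · exact hs.parent w h h0
      · rw [show w.1 - 1 = v.1 by have := (mem_children h).1; omega, (mem_children h).2, abs_le]
        have a := hs.upper v hvn
        have b := hs.lower v hvn
        have := hV v.1
        constructor <;> linarith
    inSet := hs.inSet
    outSet := hs.outSet
    cover := fun x => by
      rcases hs.cover x with hx | hx | ⟨w, hw, hx⟩
      · exact Or.inl hx
      · exact Or.inr (Or.inl hx)
      · refine Or.inr (Or.inr ?_)
        by_cases hwv : w = v
        · rw [hwv, ← Prod.mk.eta (p := v), ← A.tree.split v.1 v.2 (mem_treeNodes.1 hvn).2] at hx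
          rcases hx with hx | hx
          · exact ⟨_, Finset.mem_union_right _ (Finset.mem_insert_self _ _), hx⟩
          · exact ⟨_, Finset.mem_union_right _
              (Finset.mem_insert_of_mem (Finset.mem_singleton_self _)), hx⟩
        · exact ⟨w, Finset.mem_union_left _ (Finset.mem_erase.2 ⟨hwv, hw⟩), hx⟩
    record := fun j hj => by
      obtain ⟨I, hI⟩ := hs.record j hj
      obtain ⟨h₀, hh₀, hI₀⟩ := hI.exists_V_le v hv
      refine ⟨I, hI.mono (fun w hw => ?_) fun w hw => ?_⟩
      · rcases hcase w hw with h | h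
        · exact hI.index_le w h
        · have e1 := (mem_children h).1
          have a := hch w h
          have b1 := hVΓ h₀ v.1 hh₀ (by omega)
          have b2 := hVΓ h₀ w.1 (by omega) (by omega)
          have b3 : Γ * A.V h₀ ≤ Γ * I := mul_le_mul_of_nonneg_left hI₀ (by linarith)
          have b4 : 0 ≤ Γ * I := mul_nonneg (by linarith) hI.pos.le
          refine max_le ?_ ?_
          · change s.upper w - A.τ ≤ _
            linarith [a.1]
          · change A.τ - s.lower w ≤ _
            linarith [a.2]
      · rcases hcase w hw with h | h
        · exact hI.exists_V_le w h
        · exact ⟨h₀, by have := (mem_children h).1; omega, hI₀⟩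
    first := hs.first }

/-- Evaluating the function at a node preserves the invariants. The new record takes for `I` the index
of the evaluated node, which is the largest one. -/
lemma Invariant.evaluate (hs : Invariant A F H Γ s) (hΓ : 1 ≤ Γ) (hn : s.numEvals < A.n)
    {v : Node} (hv : v ∈ s.active) (y : ℝ)
    (hstd : v.1 ≤ H → A.V v.1 ≤ A.β * s.std A v)
    (hmax : ∀ w ∈ s.active, s.index A w ≤ s.index A v)
    (hu : ∀ w, s.upper w ≤ s.currUpper A w) (hl : ∀ w, s.currLower A w ≤ s.lower w)
    (hlτ : s.lower v < A.τ) (huτ : A.τ ≤ s.upper v) :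
    Invariant A F H Γ { s with
      node := Function.update s.node s.numEvals v
      obs := Function.update s.obs s.numEvals y
      numEvals := s.numEvals + 1 } := by
  set s' : State X := { s with
      node := Function.update s.node s.numEvals v
      obs := Function.update s.obs s.numEvals y
      numEvals := s.numEvals + 1 } with hs'
  have hnode : ∀ j < s.numEvals, s'.node j = s.node j := fun j hj =>
    Function.update_of_ne (Nat.ne_of_lt hj) _ _
  have hpoint : ∀ j < s.numEvals, s'.point A j = s.point A j := fun j hj => by
    rw [State.point, State.point, hnode j hj]
  have hnode' : s'.node s.numEvals = v := Function.update_self _ _ _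
  have hpoint' : s'.point A s.numEvals = A.tree.center v := by rw [State.point, hnode']
  have hstd_old : ∀ j < s.numEvals, s'.evalStd A j = s.evalStd A j := fun j hj => by
    rw [State.evalStd, State.evalStd, postStd, postStd, hpoint j hj,
      postVar_congr_design fun i hi => hpoint i (hi.trans hj)]
  have hstd_new : s'.evalStd A s.numEvals = s.std A v := by
    rw [State.evalStd, State.std, postStd, postStd, hpoint', postVar_congr_design hpoint]
  have u1 := (hu v).trans (currUpper_le v)
  have l1 := (le_currLower v).trans (hl v)
  have hpos : 0 < s.index A v := lt_of_lt_of_le (sub_pos.2 hlτ) (le_max_right _ _)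
  exact
  { nodes := hs.nodes
    numEvals_le := hn
    upper := hs.upper
    lower := hs.lower
    width := hs.width
    parent := hs.parent
    inSet := hs.inSet
    outSet := hs.outSet
    cover := hs.cover
    record := fun j hj => by
      rcases Nat.lt_succ_iff_lt_or_eq.1 hj with hj | rfl
      · obtain ⟨I, hI⟩ := hs.record j hj
        refine ⟨I, ?_⟩
        rw [hnode j hj, hstd_old j hj]
        exact hI.mono hI.index_le hI.exists_V_le
      · refine ⟨s.index A v, ?_⟩
        rw [hnode', hstd_new]
        refine ⟨hs.nodes v hv, hs.parent v hv, hpos, ?_, hstd, fun h0 => ?_, fun w hw => ?_,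
          fun w hw => ⟨w.1, le_rfl, (hs.V_le_index hw).trans (hmax w hw)⟩⟩
        · exact max_le (by linarith) (by linarith)
        · have := hs.width v hv h0
          exact max_le (by linarith) (by linarith)
        · change s.index A w ≤ _
          have := hmax w hw
          nlinarith
    first := fun _ => by
      rcases Nat.eq_zero_or_pos s.numEvals with h0 | h0
      · have e1 : s'.node 0 = v := by rw [← h0, hnode']
        have e2 : s'.evalStd A 0 = s.std A v := by rw [← hstd_new, h0]
        -- without observations the posterior mean vanishes, and `τ ≤ ū` is a bound for `τ`
        have e3 : s.mean A v = 0 := by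
          rw [State.mean, postMean_eq]
          exact Finset.sum_eq_zero fun i _ => absurd i.2 (by omega)
        rw [e1, e2]
        linarith
      · rw [hnode 0 h0, hstd_old 0 h0]
        exact hs.first h0 }

lemma invariant_run (hg : GoodRun A sel F ε H Γ) (t : ℕ) :
    Invariant A F H Γ (run A sel F ε t) := by
  induction t with
  | zero =>
    have hpost := hg.post 0 hg.n_pos
    have henc := fun (v : Node) (hv : v ∈ treeNodes H) =>
      currBounds_enclose (s := State.blank X) hg.cells hpost hv
    have hact : ∀ v ∈ (run A sel F ε 0).active, v = (0, 0) := fun v hv => Finset.mem_singleton.1 hv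
    exact
    { nodes := fun v hv => by
        rw [hact v hv, mem_treeNodes]
        exact ⟨Nat.zero_le _, by norm_num⟩
      numEvals_le := Nat.zero_le _
      upper := fun v hv => (henc v hv).1
      lower := fun v hv => (henc v hv).2
      width := fun v hv h0 => absurd (by rw [hact v hv]) h0
      parent := fun v hv h0 => absurd (by rw [hact v hv]) h0
      inSet := fun x hx => absurd hx (notMem_empty _)
      outSet := fun x hx => absurd hx (notMem_empty _)
      cover := fun x => by
        have := mem_univ x
        rw [← A.tree.cover 0] at this
        simp only [pow_zero, Finset.range_one, Finset.mem_singleton, iUnion_iUnion_eq_left] at this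
        exact Or.inr (Or.inr ⟨(0, 0), Finset.mem_singleton_self _, this⟩)
      record := fun j hj => absurd hj (Nat.not_lt_zero _)
      first := fun h => absurd h (lt_irrefl _) }
  | succ t ih =>
    have hpost := hg.post t
    rw [run]
    set s := run A sel F ε t
    by_cases hh : s.Halted A
    · rw [State.step_of_halted hh]
      exact ih
    rw [State.step_of_not_halted hh]
    have hn : s.numEvals < A.n := lt_of_le_of_ne ih.numEvals_le fun h => hh (Or.inl h)
    have h1 := (ih.updateBounds hg.cells (hpost hn)).classify hg.cells
    set s' := (s.updateBounds A).classify A with hs'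
    split_ifs with h0
    · exact h1
    have hne : (s'.argmax A).Nonempty := by
      obtain ⟨v, hv, hmax⟩ := s'.active.exists_max_image (s'.index A)
        (Finset.nonempty_iff_ne_empty.2 h0)
      exact ⟨v, Finset.mem_filter.2 ⟨hv, hmax⟩⟩
    have hv := hg.tie.mem t s'.obs _ hne
    set v := sel t s'.obs (s'.argmax A)
    obtain ⟨hv, hmax⟩ := Finset.mem_filter.1 hv
    obtain ⟨-, hlτ, huτ⟩ := Finset.mem_filter.1 hv
    have hu : ∀ w, s'.upper w ≤ s'.currUpper A w := fun w => min_le_right _ _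
    have hl : ∀ w, s'.currLower A w ≤ s'.lower w := fun w => le_max_right _ _
    rw [State.act]
    split_ifs with hc
    · exact h1.refine hg.one_le hg.V_nonneg hg.V_le hv ((hg.hmax _).1 hc.2) hc.1 hu hl
        (not_le.1 hlτ) (not_lt.1 huτ)
    · refine h1.evaluate hg.one_le hn hv _ (fun hH => ?_) hmax hu hl (not_le.1 hlτ) (not_lt.1 huτ)
      by_contra hlt
      exact hc ⟨not_le.1 hlt, (hg.hmax _).2 hH⟩

/-- The algorithm stops. A refinement of a node of depth `h` replaces it by two nodes of depth
`h + 1`, so the sum of `2 ^ (H + 2 - h) - 1` over the active nodes drops by one. -/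
lemma exists_halted (hg : GoodRun A sel F ε H Γ) : ∃ t, (run A sel F ε t).Halted A := by
  let wt : Node → ℕ := fun v => 2 ^ (H + 2 - v.1) - 1
  let Φ : State X → ℕ := fun s => (A.n - s.numEvals) + ∑ v ∈ s.active, wt v
  by_contra hcon
  push Not at hcon
  have hdec : ∀ t, Φ (run A sel F ε (t + 1)) < Φ (run A sel F ε t) := by
    intro t
    have hh := hcon t
    have hh' := hcon (t + 1)
    have hi := invariant_run hg t
    rw [run] at hh' ⊢
    set s := run A sel F ε t
    rw [State.step_of_not_halted hh] at hh' ⊢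
    have hn : s.numEvals < A.n := lt_of_le_of_ne hi.numEvals_le fun h => hh (Or.inl h)
    set s' := (s.updateBounds A).classify A with hs'
    have hle : ∑ v ∈ s'.active, wt v ≤ ∑ v ∈ s.active, wt v :=
      Finset.sum_le_sum_of_subset (Finset.filter_subset _ _)
    split_ifs with h0
    · rw [if_pos h0] at hh'
      exact absurd (Or.inr h0) hh'
    have hne : (s'.argmax A).Nonempty := by
      obtain ⟨v, hv, hmax⟩ := s'.active.exists_max_image (s'.index A)
        (Finset.nonempty_iff_ne_empty.2 h0)
      exact ⟨v, Finset.mem_filter.2 ⟨hv, hmax⟩⟩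
    have hv := hg.tie.mem t s'.obs _ hne
    set v := sel t s'.obs (s'.argmax A)
    obtain ⟨hv, -⟩ := Finset.mem_filter.1 hv
    rw [State.act]
    split_ifs with hc
    · have hH := (hg.hmax _).1 hc.2
      have hsum : ∑ w ∈ s'.active.erase v ∪ v.children, wt w < ∑ w ∈ s'.active, wt w := by
        have h1 : ∑ w ∈ s'.active.erase v ∪ v.children, wt w ≤
            ∑ w ∈ s'.active.erase v, wt w + ∑ w ∈ v.children, wt w := by
          rw [← Finset.sum_union_inter]
          exact Nat.le_add_right _ _
        have h2 : ∑ w ∈ v.children, wt w ≤ 2 * (2 ^ (H + 1 - v.1) - 1) := by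
          rw [Node.children, Finset.sum_pair (by simp)]
          simp only [wt]
          rw [show H + 2 - (v.1 + 1) = H + 1 - v.1 by omega]
          omega
        have h3 := Finset.add_sum_erase s'.active wt hv
        have h4 : wt v = 2 * 2 ^ (H + 1 - v.1) - 1 := by
          simp only [wt]
          rw [show H + 2 - v.1 = (H + 1 - v.1) + 1 by omega, pow_succ, mul_comm]
        have h5 : 0 < 2 ^ (H + 1 - v.1) := by positivity
        omega
      change A.n - s.numEvals + ∑ w ∈ s'.active.erase v ∪ v.children, wt w <
        A.n - s.numEvals + ∑ w ∈ s.active, wt w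
      omega
    · change A.n - (s.numEvals + 1) + ∑ w ∈ s'.active, wt w <
        A.n - s.numEvals + ∑ w ∈ s.active, wt w
      omega
  have : ∀ t, Φ (run A sel F ε t) + t ≤ Φ (run A sel F ε 0) := by
    intro t
    induction t with
    | zero => exact le_rfl
    | succ t ih => have := hdec t; omega
  have := this (Φ (run A sel F ε 0) + 1)
  omega

/-- The loss is at most the largest index of an active node. -/
lemma Invariant.loss_le (hs : Invariant A F H Γ s)
    (hcell : ∀ v ∈ treeNodes H, ∀ x ∈ A.tree.cell v, |F x - F (A.tree.center v)| ≤ A.V v.1)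
    {L : ℝ} (hL : ∀ v ∈ s.active, s.index A v ≤ L) :
    levelSetLoss F A.τ s.inSet ≤ ENNReal.ofReal L := by
  refine iSup₂_le fun x hx => ENNReal.ofReal_le_ofReal ?_
  rcases hx with ⟨h1, h2⟩ | ⟨h1, h2⟩
  · exact absurd (hs.inSet x h1) h2
  · rcases hs.cover x with h | h | ⟨v, hv, hx⟩
    · exact absurd h h2
    · exact absurd h1 (not_le.2 (hs.outSet x h))
    · have h1 : A.τ ≤ F x := h1
      have a := hs.upper v (hs.nodes v hv)
      have b := abs_le.1 (hcell v (hs.nodes v hv) x hx)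
      rw [abs_of_nonneg (by linarith)]
      exact le_trans (by linarith) ((le_max_left _ _).trans (hL v hv))

end Analysis

/-! ### Counting evaluations -/

section Counting

variable {X : Type*} [MetricSpace X] {A : Inputs X} {F : X → ℝ} {H : ℕ} {Γ : ℝ} {s : State X}

lemma dist_center_ge (T : PartitionTree X) {h i j : ℕ} (hi : i < 2 ^ h) (hj : j < 2 ^ h)
    (hij : i ≠ j) : T.v₂ * T.ρ ^ h ≤ dist (T.center (h, i)) (T.center (h, j)) := by
  by_contra hlt
  push Not at hlt
  exact Set.disjoint_left.1 (T.disjoint h i j hi hj hij)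
    (T.inner h i hi (by rw [Metric.mem_ball, dist_comm]; exact hlt)) (center_mem_cell T hj)

lemma scaleDepth_eq (T : PartitionTree X) (h : ℕ) : scaleDepth T (T.v₂ * T.ρ ^ h) = h := by
  have : {j : ℕ | T.v₂ * T.ρ ^ h ≤ T.v₂ * T.ρ ^ j} = Set.Iic h := by
    ext j
    rw [mem_ofPred_eq, mul_le_mul_iff_right₀ T.v₂_pos,
      pow_le_pow_iff_right_of_lt_one₀ T.ρ_pos T.ρ_lt_one, mem_Iic]
  rw [scaleDepth, this, csSup_Iic]

/-- Nodes of depth `h` whose centers are near the threshold are counted by the packing number. -/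
lemma card_le_of_packingBound {a C : ℝ} (hC : 0 ≤ C) (hV : ∀ h, 0 ≤ A.V h)
    (hpack : HasPackingBound (nearThreshold A F) a C) {h : ℕ} {Q : Finset Node}
    (hQ : ∀ p ∈ Q, p.1 = h ∧ p.2 < 2 ^ p.1 ∧ |F (A.tree.center p) - A.τ| ≤ 4 * A.V h) :
    (Q.card : ℝ) ≤ C * (A.tree.v₂ * A.tree.ρ ^ h) ^ (-a) := by
  set r := A.tree.v₂ * A.tree.ρ ^ h with hr
  have hr0 : 0 < r := mul_pos A.tree.v₂_pos (pow_pos A.tree.ρ_pos _)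
  have hr1 : r ≤ 1 := mul_le_one₀ A.tree.v₂_le_one (pow_nonneg A.tree.ρ_pos.le _)
    (pow_le_one₀ A.tree.ρ_pos.le A.tree.ρ_lt_one.le)
  have hsep : ∀ p ∈ Q, ∀ q ∈ Q, p ≠ q → r ≤ dist (A.tree.center p) (A.tree.center q) := by
    rintro ⟨h1, i⟩ hp ⟨h2, j⟩ hq hne
    obtain ⟨e1, hi, -⟩ := hQ _ hp
    obtain ⟨e2, hj, -⟩ := hQ _ hq
    simp only at e1 e2 hi hj
    subst e1 e2
    exact dist_center_ge A.tree hi hj fun h => hne (by rw [h])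
  have hinj : Set.InjOn A.tree.center (Q : Set Node) := fun p hp q hq hpq => by
    by_contra hne
    have := hsep p hp q hq hne
    rw [hpq, dist_self] at this
    linarith
  have hle : (Q.card : ℕ∞) ≤ packingNumber (nearThreshold A F r) r := by
    have h1 : A.tree.center '' (Q : Set Node) ⊆ nearThreshold A F r := by
      rintro _ ⟨p, hp, rfl⟩
      have := (hQ p hp).2.2
      change |F (A.tree.center p) - A.τ| ≤ 10 * A.V (scaleDepth A.tree r)
      rw [hr, scaleDepth_eq]
      linarith [hV h]
    have h2 : (A.tree.center '' (Q : Set Node)).Pairwise fun x y => r ≤ dist x y := by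
      rintro _ ⟨p, hp, rfl⟩ _ ⟨q, hq, rfl⟩ hne
      exact hsep p hp q hq fun h => hne (by rw [h])
    rw [← Set.encard_coe_eq_coe_finsetCard, ← hinj.encard_image]
    exact le_iSup₂_of_le _ h1 (le_iSup_of_le h2 le_rfl)
  have h3 := (ENat.toENNReal_mono hle).trans (hpack r hr0 hr1)
  rw [ENat.toENNReal_coe, ← ENNReal.ofReal_natCast] at h3
  exact (ENNReal.ofReal_le_ofReal_iff (by positivity)).1 h3

/-- Among the evaluations at a node, the last one was made at a small posterior variance. -/
lemma exists_evalStd_sq_le (hk : IsCovarianceFunction A.k) (hσ : 0 < A.σ)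
    (hpv : ∀ m p x, 0 ≤ postVar A.k A.σ m p x) {M : ℝ} (hM : ∀ x, A.k x x ≤ M) {v : Node} {N : ℕ}
    (hne : ((Finset.range N).filter fun j => s.node j = v).Nonempty) :
    ∃ j < N, s.node j = v ∧ s.evalStd A j ^ 2 ≤
      (M + A.σ ^ 2) / ((Finset.range N).filter fun j => s.node j = v).card := by
  set J := (Finset.range N).filter fun j => s.node j = v with hJ
  set j := J.max' hne with hj
  have hjJ : j ∈ J := J.max'_mem hne
  obtain ⟨hjN, hjv⟩ := Finset.mem_filter.1 hjJ
  refine ⟨j, Finset.mem_range.1 hjN, hjv, ?_⟩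
  let S : Finset (Fin j) := Finset.univ.filter fun i => s.node i = v
  have hS : S.map Fin.valEmbedding = J.erase j := by
    ext i
    simp only [S, Finset.mem_map, Finset.mem_filter, Finset.mem_univ, true_and,
      Fin.valEmbedding_apply, Finset.mem_erase]
    constructor
    · rintro ⟨i, hi, rfl⟩
      exact ⟨i.2.ne, Finset.mem_filter.2 ⟨Finset.mem_range.2
        (i.2.trans (Finset.mem_range.1 hjN)), hi⟩⟩
    · rintro ⟨hij, hi⟩
      exact ⟨⟨i, lt_of_le_of_ne (J.le_max' i hi) hij⟩, (Finset.mem_filter.1 hi).2, rfl⟩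
  have hcard : S.card + 1 = J.card := by
    rw [← Finset.card_map Fin.valEmbedding, hS, Finset.card_erase_add_one hjJ]
  have h := postVar_le_div hk hσ j (s.point A) (s.point A j) S fun i hi => by
    rw [State.point, State.point, (Finset.mem_filter.1 hi).2, hjv]
  rw [State.evalStd, postStd, Real.sq_sqrt (hpv _ _ _)]
  refine h.trans ?_
  have : ((S.card : ℝ) + 1) = J.card := by exact_mod_cast hcard
  rw [this]
  gcongr
  exact hM _

/-- If the posterior standard deviation exceeds `c` at all evaluations, the number of evaluations is
at most `(M + σ ^ 2) / c ^ 2` times the number of evaluated nodes. -/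
lemma card_evals_le (hk : IsCovarianceFunction A.k) (hσ : 0 < A.σ)
    (hpv : ∀ m p x, 0 ≤ postVar A.k A.σ m p x) {M : ℝ} (hM : ∀ x, A.k x x ≤ M) {N : ℕ} {c : ℝ}
    (hc : 0 < c) (hle : ∀ j < N, c ≤ s.evalStd A j) :
    (N : ℝ) ≤ ((Finset.range N).image s.node).card * ((M + A.σ ^ 2) / c ^ 2) := by
  have h1 : N = ∑ v ∈ (Finset.range N).image s.node,
      ((Finset.range N).filter fun j => s.node j = v).card := by
    rw [← Finset.card_eq_sum_card_image, Finset.card_range]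
  calc (N : ℝ) = ∑ v ∈ (Finset.range N).image s.node,
      (((Finset.range N).filter fun j => s.node j = v).card : ℝ) := by exact_mod_cast h1
    _ ≤ ∑ v ∈ (Finset.range N).image s.node, ((M + A.σ ^ 2) / c ^ 2) := by
        refine Finset.sum_le_sum fun v hv => ?_
        obtain ⟨i, hi, hiv⟩ := Finset.mem_image.1 hv
        have hne : ((Finset.range N).filter fun j => s.node j = v).Nonempty :=
          ⟨i, Finset.mem_filter.2 ⟨hi, hiv⟩⟩
        obtain ⟨j, hj, -, hsq⟩ := exists_evalStd_sq_le hk hσ hpv hM hne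
        have hpos : (0 : ℝ) < ((Finset.range N).filter fun j => s.node j = v).card := by
          exact_mod_cast hne.card_pos
        have := pow_le_pow_left₀ hc.le (hle j hj) 2
        rw [le_div_iff₀ hpos] at hsq
        rw [le_div_iff₀ (by positivity)]
        nlinarith
    _ = _ := by rw [Finset.sum_const, nsmul_eq_mul]

/-- The number of evaluated nodes of depth at most `d` is controlled by the packing numbers: each
node other than the root has a parent near the threshold. -/
lemma card_evaluated_le {a C : ℝ} (ha : 0 < a) (hC : 0 ≤ C) (hV : ∀ h, 0 ≤ A.V h)
    (hpack : HasPackingBound (nearThreshold A F) a C) {d : ℕ} {r : ℝ} (hr : 0 < r) (hr1 : r ≤ 1)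
    (hrd : ∀ h, h + 1 ≤ d → r ≤ A.tree.v₂ * A.tree.ρ ^ h) {Q : Finset Node}
    (hQ : ∀ v ∈ Q, v ∈ treeNodes H ∧ v.1 ≤ d ∧
      (v.1 ≠ 0 → |F (A.tree.center v.parent) - A.τ| ≤ 4 * A.V (v.1 - 1))) :
    (Q.card : ℝ) ≤ (d + 1) * ((1 + 2 * C) * r ^ (-a)) := by
  have hr1' : 1 ≤ r ^ (-a) := Real.one_le_rpow_of_pos_of_le_one_of_nonpos hr hr1 (by linarith)
  have hlevel : ∀ h ∈ Finset.range (d + 1),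
      ((Q.filter fun v => v.1 = h).card : ℝ) ≤ (1 + 2 * C) * r ^ (-a) := by
    intro h hh
    have hh : h ≤ d := Nat.lt_succ_iff.1 (Finset.mem_range.1 hh)
    rcases Nat.eq_zero_or_pos h with rfl | hpos
    · have : (Q.filter fun v => v.1 = 0) ⊆ {(0, 0)} := fun v hv => by
        obtain ⟨hv, h0⟩ := Finset.mem_filter.1 hv
        have := (mem_treeNodes.1 (hQ v hv).1).2
        rw [h0] at this
        rw [Finset.mem_singleton]
        exact Prod.ext h0 (by simpa using this)
      have h1 : ((Q.filter fun v => v.1 = 0).card : ℝ) ≤ 1 := by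
        exact_mod_cast Finset.card_le_card this
      nlinarith
    · obtain ⟨h, rfl⟩ := Nat.exists_eq_succ_of_ne_zero hpos.ne'
      set Q' := Q.filter fun v => v.1 = h.succ with hQ'
      have hpar : ((Q'.image Node.parent).card : ℝ) ≤
          C * (A.tree.v₂ * A.tree.ρ ^ h) ^ (-a) := by
        refine card_le_of_packingBound hC hV hpack fun p hp => ?_
        obtain ⟨v, hv, rfl⟩ := Finset.mem_image.1 hp
        obtain ⟨hv, hv1⟩ := Finset.mem_filter.1 hv
        obtain ⟨hn, -, hp⟩ := hQ v hv
        have hp := hp (by omega)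
        rw [hv1, Nat.succ_sub_one] at hp
        exact ⟨by simp [Node.parent, hv1], (mem_treeNodes.1 (parent_mem_treeNodes hn)).2, hp⟩
      have hsub : Q' ⊆ (Q'.image Node.parent).biUnion Node.children := fun v hv => by
        have hv1 := (Finset.mem_filter.1 hv).2
        refine Finset.mem_biUnion.2 ⟨v.parent, Finset.mem_image_of_mem _ hv, ?_⟩
        obtain ⟨i, j⟩ := v
        simp only at hv1
        subst hv1
        simp only [Node.children, Node.parent, Finset.mem_insert, Finset.mem_singleton,
          Prod.mk.injEq]
        omega
      have hcard : (Q'.card : ℝ) ≤ 2 * (Q'.image Node.parent).card := by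
        have h1 := (Finset.card_le_card hsub).trans
          (Finset.card_biUnion_le (s := Q'.image Node.parent) (t := Node.children))
        have h2 : ∑ p ∈ Q'.image Node.parent, p.children.card ≤
            (Q'.image Node.parent).card * 2 := by
          refine Finset.sum_le_card_nsmul _ _ _ fun p _ => Finset.card_le_two
        have := h1.trans h2
        have : (Q'.card : ℝ) ≤ (Q'.image Node.parent).card * 2 := by exact_mod_cast this
        linarith
      have hmono : (A.tree.v₂ * A.tree.ρ ^ h) ^ (-a) ≤ r ^ (-a) :=
        Real.rpow_le_rpow_of_nonpos hr (hrd h hh) (by linarith)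
      have := mul_le_mul_of_nonneg_left hmono hC
      nlinarith
  have hmaps : ∀ v ∈ Q, v.1 ∈ Finset.range (d + 1) := fun v hv =>
    Finset.mem_range.2 (Nat.lt_succ_iff.2 (hQ v hv).2.1)
  have h1 := Finset.card_eq_sum_card_fiberwise hmaps
  calc (Q.card : ℝ) = ∑ h ∈ Finset.range (d + 1), ((Q.filter fun v => v.1 = h).card : ℝ) := by
        exact_mod_cast h1
    _ ≤ ∑ h ∈ Finset.range (d + 1), (1 + 2 * C) * r ^ (-a) := Finset.sum_le_sum hlevel
    _ = _ := by rw [Finset.sum_const, Finset.card_range, nsmul_eq_mul]; push_cast; ring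

lemma sumPostVar_eq (hpv : ∀ m p x, 0 ≤ postVar A.k A.σ m p x) :
    sumPostVar A s = ∑ j ∈ Finset.range s.numEvals, s.evalStd A j ^ 2 := by
  refine Finset.sum_congr rfl fun j _ => ?_
  rw [State.evalStd, postStd, Real.sq_sqrt (hpv _ _ _)]

/-- The first evaluation already contributes to `J_n`, as the prior mean is below the threshold. -/
lemma Invariant.tau_le (hs : Invariant A F H Γ s)
    (hg : ∀ h : ℕ, H < h → h ≤ H + 1 → A.V h ≤ A.τ / 2)
    (hpv : ∀ m p x, 0 ≤ postVar A.k A.σ m p x) (hβ : 0 ≤ A.β) (hn : 0 < s.numEvals) :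
    A.τ ≤ 2 * (A.β * √(sumPostVar A s)) := by
  have h1 := hs.first hn
  obtain ⟨I, hI⟩ := hs.record 0 hn
  have h2 : s.evalStd A 0 ≤ √(sumPostVar A s) := by
    rw [sumPostVar_eq hpv]
    refine Real.le_sqrt_of_sq_le ?_
    exact Finset.single_le_sum (f := fun j => s.evalStd A j ^ 2) (fun j _ => sq_nonneg _)
      (Finset.mem_range.2 hn)
  have h3 := mul_le_mul_of_nonneg_left h2 hβ
  rcases le_or_gt (s.node 0).1 H with h | h
  · have := hI.V_le h
    linarith
  · have := hg _ h (mem_treeNodes.1 hI.node).1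
    linarith

/-- The largest index is at most a multiple of the average posterior standard deviation, which
Cauchy–Schwarz bounds by `√(J / n)`. -/
lemma Invariant.index_le_sqrt (hs : Invariant A F H Γ s) (hΓ : 1 ≤ Γ) (hV : ∀ h, 0 ≤ A.V h)
    (hpv : ∀ m p x, 0 ≤ postVar A.k A.σ m p x) (hβ : 0 ≤ A.β) (hn : 0 < s.numEvals) {w : Node}
    (hw : w ∈ s.active) :
    s.index A w ≤ 6 * Γ * (4 * (A.β * √(sumPostVar A s / s.numEvals)) + 2 * A.V (H + 1)) := by
  set n := s.numEvals
  have hn' : (0 : ℝ) < n := by exact_mod_cast hn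
  have hstd0 : ∀ j, 0 ≤ s.evalStd A j := fun j => Real.sqrt_nonneg _
  have h1 : ∀ j ∈ Finset.range n,
      s.index A w ≤ 6 * Γ * (4 * (A.β * s.evalStd A j) + 2 * A.V (H + 1)) := by
    intro j hj
    obtain ⟨I, hI⟩ := hs.record j (Finset.mem_range.1 hj)
    refine (hI.index_le w hw).trans ?_
    have hb := mul_nonneg hβ (hstd0 j)
    refine mul_le_mul_of_nonneg_left ?_ (by linarith)
    have := hI.le_std
    rcases le_or_gt (s.node j).1 H with h | h
    · have := hI.V_le h
      have := hV (H + 1)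
      linarith
    · have h' : (s.node j).1 = H + 1 := le_antisymm (mem_treeNodes.1 hI.node).1 h
      rw [h'] at this
      linarith
  have h2 := Finset.sum_le_sum h1
  rw [Finset.sum_const, Finset.card_range, nsmul_eq_mul, ← Finset.mul_sum, Finset.sum_add_distrib,
    ← Finset.mul_sum, ← Finset.mul_sum, Finset.sum_const, Finset.card_range, nsmul_eq_mul] at h2
  have h3 : ∑ j ∈ Finset.range n, s.evalStd A j ≤ n * √(sumPostVar A s / n) := by
    have hcs := sq_sum_le_card_mul_sum_sq (s := Finset.range n) (f := fun j => s.evalStd A j)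
    rw [Finset.card_range, ← sumPostVar_eq hpv] at hcs
    have hJ : 0 ≤ sumPostVar A s := by
      rw [sumPostVar_eq hpv]
      positivity
    refine (abs_le_of_sq_le_sq' ?_ (by positivity)).2
    rw [mul_pow, Real.sq_sqrt (by positivity)]
    refine hcs.trans (le_of_eq ?_)
    field_simp
  have h4 := mul_le_mul_of_nonneg_left h3 hβ
  have h5 : 6 * Γ * (4 * (A.β * ∑ j ∈ Finset.range n, s.evalStd A j) + n * (2 * A.V (H + 1))) ≤
      6 * Γ * (4 * (A.β * (n * √(sumPostVar A s / n))) + n * (2 * A.V (H + 1))) := by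
    refine mul_le_mul_of_nonneg_left ?_ (by linarith)
    linarith
  have h6 := h2.trans h5
  have h7 : 6 * Γ * (4 * (A.β * (n * √(sumPostVar A s / n))) + n * (2 * A.V (H + 1))) =
      n * (6 * Γ * (4 * (A.β * √(sumPostVar A s / n)) + 2 * A.V (H + 1))) := by ring
  rw [h7] at h6
  exact le_of_mul_le_mul_left h6 hn'

/-- If no node of depth `H + 1` was evaluated, the largest index `Λ` and the number of evaluations
satisfy the two inequalities that trade off in the dimension type bound. Here `r` is the inner radius
of the parent of a deepest evaluated node, and `r = 1` if only the root was evaluated. -/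
lemma Invariant.exists_scale (hs : Invariant A F H Γ s) (hΓ : 1 ≤ Γ) (hV : ∀ h, 0 ≤ A.V h)
    (hVΓ : ∀ h h', h ≤ h' → h' ≤ H + 1 → A.V h' ≤ Γ * A.V h)
    (hk : IsCovarianceFunction A.k) (hσ : 0 < A.σ)
    (hpv : ∀ m p x, 0 ≤ postVar A.k A.σ m p x) {M : ℝ} (hM : ∀ x, A.k x x ≤ M) (hβ : 0 < A.β)
    (hn : 0 < s.numEvals) {w : Node} (hw : w ∈ s.active) (hΛ : 0 < s.index A w)
    {a C α B : ℝ} (ha : 0 < a) (hC : 0 ≤ C) (hpack : HasPackingBound (nearThreshold A F) a C)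
    (hB : A.β * √M ≤ B)
    (hVB : ∀ h ≤ H, A.V h ≤ B * (A.tree.v₂ * A.tree.ρ ^ h) ^ α)
    (hdeep : ∀ j < s.numEvals, (s.node j).1 ≤ H) :
    ∃ r, 0 < r ∧ r ≤ 1 ∧ s.index A w ≤ 36 * Γ ^ 2 * B * r ^ α ∧
      (s.numEvals : ℝ) ≤ (H + 1) * ((1 + 2 * C) * r ^ (-a)) *
        ((M + A.σ ^ 2) / (s.index A w / (24 * Γ * A.β)) ^ 2) := by
  set n := s.numEvals
  set Λ := s.index A w
  have hΓ0 : 0 < Γ := by linarith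
  have hstd : ∀ j < n, Λ / (24 * Γ * A.β) ≤ s.evalStd A j := by
    intro j hj
    obtain ⟨I, hI⟩ := hs.record j hj
    rw [div_le_iff₀ (by positivity)]
    have h1 := hI.index_le w hw
    have h2 := hI.le_std
    have h3 := hI.V_le (hdeep j hj)
    have h4 : 6 * Γ * I ≤ 6 * Γ * (4 * (A.β * s.evalStd A j)) := by
      refine mul_le_mul_of_nonneg_left ?_ (by linarith)
      linarith
    calc Λ ≤ _ := h1.trans h4
      _ = _ := by ring
  have hcount := card_evals_le hk hσ hpv hM (c := Λ / (24 * Γ * A.β)) (by positivity) hstd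
  set Q := (Finset.range n).image s.node with hQ
  have hQne : Q.Nonempty := ⟨_, Finset.mem_image_of_mem _ (Finset.mem_range.2 hn)⟩
  obtain ⟨u, hu, hmax⟩ := Q.exists_max_image (fun v => v.1) hQne
  obtain ⟨j, hj, rfl⟩ := Finset.mem_image.1 hu
  have hj := Finset.mem_range.1 hj
  set d := (s.node j).1 with hd
  have hQd : ∀ v ∈ Q, v ∈ treeNodes H ∧ v.1 ≤ d ∧
      (v.1 ≠ 0 → |F (A.tree.center v.parent) - A.τ| ≤ 4 * A.V (v.1 - 1)) := by
    intro v hv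
    obtain ⟨i, hi, rfl⟩ := Finset.mem_image.1 hv
    obtain ⟨I, hI⟩ := hs.record i (Finset.mem_range.1 hi)
    exact ⟨hI.node, hmax _ hv, hI.parent⟩
  have hM0 : 0 ≤ M := (hk.self_nonneg (A.tree.center (0, 0))).trans (hM _)
  have hfinal : ∀ r, 0 < r → r ≤ 1 → (∀ h, h + 1 ≤ d → r ≤ A.tree.v₂ * A.tree.ρ ^ h) →
      (n : ℝ) ≤ (H + 1) * ((1 + 2 * C) * r ^ (-a)) *
        ((M + A.σ ^ 2) / (Λ / (24 * Γ * A.β)) ^ 2) := by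
    intro r hr hr1 hrd
    refine hcount.trans (mul_le_mul_of_nonneg_right ?_ (by positivity))
    refine (card_evaluated_le ha hC hV hpack hr hr1 hrd hQd).trans ?_
    have : (d : ℝ) ≤ H := by exact_mod_cast hdeep j hj
    gcongr
  obtain ⟨I, hI⟩ := hs.record j hj
  have hidx := hI.index_le w hw
  have hB0 : 0 ≤ B := (mul_nonneg hβ.le (Real.sqrt_nonneg M)).trans hB
  rcases Nat.eq_zero_or_pos d with h0 | h0
  · refine ⟨1, one_pos, le_rfl, ?_, hfinal 1 one_pos le_rfl fun h hh => by omega⟩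
    rw [Real.one_rpow, mul_one]
    have h2 := hI.le_std
    have h3 := hI.V_le (hdeep j hj)
    have h4 : s.evalStd A j ≤ √M :=
      Real.sqrt_le_sqrt ((postVar_le_self hk hσ _ _ _).trans (hM _))
    have h5 : I ≤ 4 * B := by
      have := mul_le_mul_of_nonneg_left h4 hβ.le
      linarith
    have h6 : 6 * Γ * I ≤ 6 * Γ * (4 * B) := mul_le_mul_of_nonneg_left h5 (by linarith)
    have h7 : Γ * B ≤ Γ ^ 2 * B := by nlinarith [mul_nonneg hΓ0.le hB0]
    have h8 : 0 ≤ Γ * B := mul_nonneg hΓ0.le hB0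
    calc Λ ≤ _ := hidx.trans h6
      _ ≤ 36 * (Γ * B) := by linarith
      _ ≤ _ := by linarith
  · have hρ0 := A.tree.ρ_pos
    have hρ1 := A.tree.ρ_lt_one.le
    have hr0 : 0 < A.tree.v₂ * A.tree.ρ ^ (d - 1) := mul_pos A.tree.v₂_pos (pow_pos hρ0 _)
    refine ⟨A.tree.v₂ * A.tree.ρ ^ (d - 1), hr0,
      mul_le_one₀ A.tree.v₂_le_one (pow_nonneg hρ0.le _) (pow_le_one₀ hρ0.le hρ1), ?_,
      hfinal _ hr0 (mul_le_one₀ A.tree.v₂_le_one (pow_nonneg hρ0.le _) (pow_le_one₀ hρ0.le hρ1))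
        fun h hh => ?_⟩
    · have h1 := hI.le_V h0.ne'
      have h2 := hVΓ (d - 1) d (by omega) (mem_treeNodes.1 hI.node).1
      have h3 : A.V (d - 1) ≤ Γ * A.V (d - 1) := by nlinarith [hV (d - 1)]
      have h4 : I ≤ 6 * (Γ * A.V (d - 1)) := by linarith
      have h5 := hVB (d - 1) (by have := hdeep j hj; omega)
      have h6 : 6 * Γ * I ≤ 6 * Γ * (6 * (Γ * A.V (d - 1))) :=
        mul_le_mul_of_nonneg_left h4 (by linarith)
      calc Λ ≤ _ := hidx.trans h6
        _ = 36 * Γ ^ 2 * A.V (d - 1) := by ring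
        _ ≤ 36 * Γ ^ 2 * (B * (A.tree.v₂ * A.tree.ρ ^ (d - 1)) ^ α) := by gcongr
        _ = _ := by ring
    · have : A.tree.ρ ^ (d - 1) ≤ A.tree.ρ ^ h := pow_le_pow_of_le_one hρ0.le hρ1 (by omega)
      exact mul_le_mul_of_nonneg_left this A.tree.v₂_pos.le

/-- If some node of depth `H + 1` was evaluated, the largest index is at most of the order of the
variation in the cells of depth `H`. -/
lemma Invariant.index_le_of_deep (hs : Invariant A F H Γ s) (hΓ : 1 ≤ Γ) {w : Node}
    (hw : w ∈ s.active) {j : ℕ} (hj : j < s.numEvals) (hdeep : H < (s.node j).1) :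
    s.index A w ≤ 6 * Γ * (4 * A.V H + 2 * A.V (H + 1)) := by
  obtain ⟨I, hI⟩ := hs.record j hj
  have h' : (s.node j).1 = H + 1 := le_antisymm (mem_treeNodes.1 hI.node).1 hdeep
  have := hI.le_V (by omega)
  rw [h', Nat.add_sub_cancel] at this
  exact (hI.index_le w hw).trans (mul_le_mul_of_nonneg_left this (by linarith))

end Counting

/-! ### Metric dimension of a space with a tree of partitions -/

section MetricDim

variable {X : Type*} [MetricSpace X] (T : PartitionTree X)

/-- The exponent `log 2 / log (1 / ρ)` at which the cells of the tree multiply. -/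
noncomputable def treeDim : ℝ := Real.log 2 / Real.log (1 / T.ρ)

lemma log_inv_rho_pos : 0 < Real.log (1 / T.ρ) :=
  Real.log_pos (by rw [lt_div_iff₀ T.ρ_pos, one_mul]; exact T.ρ_lt_one)

lemma treeDim_pos : 0 < treeDim T :=
  div_pos (Real.log_pos one_lt_two) (log_inv_rho_pos T)

lemma treeDim_mul_log : treeDim T * Real.log (1 / T.ρ) = Real.log 2 :=
  div_mul_cancel₀ _ (log_inv_rho_pos T).ne'

lemma rho_pow_rpow (n : ℕ) : (T.ρ ^ n) ^ (-treeDim T) = 2 ^ n := by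
  have h : T.ρ ^ (-treeDim T) = 2 := by
    rw [Real.rpow_def_of_pos T.ρ_pos]
    have : Real.log T.ρ * -treeDim T = Real.log 2 := by
      rw [← treeDim_mul_log T, one_div, Real.log_inv]
      ring
    rw [this, Real.exp_log two_pos]
  rw [← Real.rpow_natCast, ← Real.rpow_mul T.ρ_pos.le, mul_comm, Real.rpow_mul T.ρ_pos.le, h,
    Real.rpow_natCast]

/-- The set of the centers of depth `h`. -/
def centers (h : ℕ) : Set X :=
  (fun i => T.center (h, i)) '' (Finset.range (2 ^ h) : Set ℕ)

lemma encard_centers (h : ℕ) : (centers T h).encard = 2 ^ h := by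
  have hinj : Set.InjOn (fun i => T.center (h, i)) (Finset.range (2 ^ h) : Set ℕ) := by
    intro i hi j hj hij
    by_contra hne
    have := dist_center_ge T (Finset.mem_range.1 hi) (Finset.mem_range.1 hj) hne
    have hpos := mul_pos T.v₂_pos (pow_pos T.ρ_pos h)
    simp only at hij
    rw [hij, dist_self] at this
    linarith
  rw [centers, hinj.encard_image, Set.encard_coe_eq_coe_finsetCard, Finset.card_range]
  norm_cast

lemma coveringNumber_le_two_pow {h : ℕ} {r : ℝ} (hr : T.v₁ * T.ρ ^ h ≤ r) :
    Metric.coveringNumber r.toNNReal (Set.univ : Set X) ≤ 2 ^ h := by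
  rw [← encard_centers T h]
  refine Metric.IsCover.coveringNumber_le_encard (subset_univ _) fun x _ => ?_
  have hx := mem_univ x
  rw [← T.cover h] at hx
  simp only [mem_iUnion, Finset.mem_range, exists_prop] at hx
  obtain ⟨i, hi, hx⟩ := hx
  refine ⟨T.center (h, i), ⟨i, Finset.mem_coe.2 (Finset.mem_range.2 hi), rfl⟩, ?_⟩
  have := (Metric.mem_ball.1 (T.outer h i hi hx)).le.trans hr
  change edist x (T.center (h, i)) ≤ _
  rw [edist_dist]
  exact ENNReal.ofReal_le_ofReal this

lemma two_pow_le_coveringNumber {h : ℕ} {r : ℝ} (hr0 : 0 ≤ r) (hr : 2 * r < T.v₂ * T.ρ ^ h) :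
    2 ^ h ≤ Metric.coveringNumber r.toNNReal (Set.univ : Set X) := by
  rw [← encard_centers T h]
  refine le_trans ?_ ((Metric.packingNumber_two_mul_le_externalCoveringNumber r.toNNReal _).trans
    (Metric.externalCoveringNumber_le_coveringNumber _ _))
  refine Metric.IsSeparated.encard_le_packingNumber (subset_univ _) ?_
  rintro _ ⟨i, hi, rfl⟩ _ ⟨j, hj, rfl⟩ hne
  have hd := dist_center_ge T (Finset.mem_range.1 hi) (Finset.mem_range.1 hj)
    fun h => hne (by rw [h])
  have e : ((2 * r.toNNReal : ℝ≥0) : ℝ≥0∞) = ENNReal.ofReal (2 * r) := by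
    rw [ENNReal.ofReal, Real.toNNReal_mul zero_le_two]
    norm_num
  rw [edist_dist]
  push_cast at e ⊢
  rw [e]
  exact (ENNReal.ofReal_lt_ofReal_iff_of_nonneg (by positivity)).2 (hr.trans_le hd)

/-- The tree determines the metric dimension: the centers of depth `h` are an efficient net. -/
lemma metricDim_eq : metricDim X = treeDim T := by
  have hmem : treeDim T ∈ {a : ℝ | 0 < a ∧ ∃ C : ℝ, ∀ r : ℝ, 0 < r → r ≤ 1 →
      ((Metric.coveringNumber r.toNNReal (Set.univ : Set X) : ℕ∞) : ℝ≥0∞)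
        ≤ ENNReal.ofReal (C * r ^ (-a))} := by
    refine ⟨treeDim_pos T, 2 * T.v₁ ^ treeDim T, fun r hr hr1 => ?_⟩
    have hv : 0 < T.v₁ := by linarith [T.one_le_v₁]
    obtain ⟨n, h1, h2⟩ := exists_nat_pow_near_of_lt_one (x := r / T.v₁) (by positivity)
      (by rw [div_le_one hv]; linarith [T.one_le_v₁]) T.ρ_pos T.ρ_lt_one
    have hcov := ENat.toENNReal_mono (coveringNumber_le_two_pow T (h := n + 1) (r := r)
      (by rw [lt_div_iff₀ hv] at h1; linarith))
    refine hcov.trans ?_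
    have h3 : ((2 ^ (n + 1) : ℕ∞) : ℝ≥0∞) = ENNReal.ofReal (2 ^ (n + 1)) := by
      rw [ENNReal.ofReal_pow zero_le_two]
      simp
    rw [h3]
    refine ENNReal.ofReal_le_ofReal ?_
    have h4 : (2 : ℝ) ^ n ≤ (r / T.v₁) ^ (-treeDim T) := by
      rw [← rho_pow_rpow T n]
      exact Real.rpow_le_rpow_of_nonpos (by positivity) h2 (by linarith [treeDim_pos T])
    rw [Real.div_rpow hr.le hv.le, Real.rpow_neg hv.le, div_inv_eq_mul] at h4
    rw [pow_succ]
    linarith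
  refine le_antisymm (csInf_le ⟨0, fun a ha => ha.1.le⟩ hmem) (le_csInf ⟨_, hmem⟩ ?_)
  rintro a ⟨ha, C, hC⟩
  by_contra hlt
  push Not at hlt
  have hρa : T.ρ ^ (-a) < 2 := by
    rw [← pow_one (2 : ℝ), ← rho_pow_rpow T 1, pow_one]
    exact Real.rpow_lt_rpow_of_exponent_gt T.ρ_pos T.ρ_lt_one (by linarith)
  have hρa0 : 0 < T.ρ ^ (-a) := Real.rpow_pos_of_pos T.ρ_pos _
  have hbound : ∀ h : ℕ, (2 / T.ρ ^ (-a)) ^ h ≤ max (C * (T.v₂ / 3) ^ (-a)) 0 := by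
    intro h
    have hp : 0 < T.v₂ * T.ρ ^ h := mul_pos T.v₂_pos (pow_pos T.ρ_pos h)
    have hp1 : T.v₂ * T.ρ ^ h ≤ 1 := mul_le_one₀ T.v₂_le_one (pow_nonneg T.ρ_pos.le _)
      (pow_le_one₀ T.ρ_pos.le T.ρ_lt_one.le)
    have h1 := hC (T.v₂ * T.ρ ^ h / 3) (by positivity) (by linarith)
    have h2 := (ENat.toENNReal_mono (two_pow_le_coveringNumber T (h := h)
      (r := T.v₂ * T.ρ ^ h / 3) (by positivity) (by linarith))).trans h1
    have h3 : ((2 ^ h : ℕ∞) : ℝ≥0∞) = ENNReal.ofReal (2 ^ h) := by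
      rw [ENNReal.ofReal_pow zero_le_two]
      simp
    rw [h3, ENNReal.ofReal_le_ofReal_iff'] at h2
    rcases h2 with h2 | h2
    · rw [div_pow, div_le_iff₀ (by positivity)]
      have e : (T.v₂ * T.ρ ^ h / 3) ^ (-a) = (T.v₂ / 3) ^ (-a) * (T.ρ ^ (-a)) ^ h := by
        rw [show T.v₂ * T.ρ ^ h / 3 = T.v₂ / 3 * T.ρ ^ h by ring,
          Real.mul_rpow (by linarith [T.v₂_pos]) (pow_nonneg T.ρ_pos.le _), ← Real.rpow_natCast,
          ← Real.rpow_natCast, ← Real.rpow_mul T.ρ_pos.le, ← Real.rpow_mul T.ρ_pos.le,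
          mul_comm (-a)]
      rw [e, ← mul_assoc] at h2
      exact h2.trans (mul_le_mul_of_nonneg_right (le_max_left _ _) (by positivity))
    · exact absurd h2 (not_le.2 (by positivity))
  obtain ⟨n, hn⟩ := pow_unbounded_of_one_lt (max (C * (T.v₂ / 3) ^ (-a)) 0)
    ((one_lt_div hρa0).2 hρa)
  exact absurd (hbound n) (not_le.2 hn)

end MetricDim

/-! ### Chaining along the tree -/

section Chaining

variable {X : Type*} [MetricSpace X] (T : PartitionTree X)

lemma center_descendant_mem {h i : ℕ} (hi : i < 2 ^ h) (n : ℕ) {l : ℕ} (hl : l < 2 ^ n) :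
    T.center (h + n, i * 2 ^ n + l) ∈ T.cell (h, i) := by
  have hlt : ∀ n l, l < 2 ^ n → i * 2 ^ n + l < 2 ^ (h + n) := by
    intro n l hl
    calc i * 2 ^ n + l < (i + 1) * 2 ^ n := by rw [add_mul]; omega
      _ ≤ 2 ^ h * 2 ^ n := Nat.mul_le_mul_right _ hi
      _ = 2 ^ (h + n) := (pow_add _ _ _).symm
  have hsub : ∀ n l, l < 2 ^ n → T.cell (h + n, i * 2 ^ n + l) ⊆ T.cell (h, i) := by
    intro n
    induction n with
    | zero =>
      intro l hl
      obtain rfl : l = 0 := by simpa using hl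
      simp
    | succ n ih =>
      intro l hl
      refine (cell_subset_parent T (v := (h + (n + 1), i * 2 ^ (n + 1) + l)) (by simp)
        (hlt _ _ hl)).trans ?_
      have e : Node.parent (h + (n + 1), i * 2 ^ (n + 1) + l) = (h + n, i * 2 ^ n + l / 2) := by
        refine Prod.ext (by simp [Node.parent]) ?_
        simp only [Node.parent, pow_succ, ← mul_assoc]
        omega
      rw [e]
      exact ih _ (by rw [pow_succ] at hl; omega)
  exact hsub n l hl (center_mem_cell T (hlt n l hl))

lemma exists_descendant {h i : ℕ} {x : X} (hi : i < 2 ^ h) (hx : x ∈ T.cell (h, i)) (n : ℕ) :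
    ∃ l < 2 ^ n, dist x (T.center (h + n, i * 2 ^ n + l)) < T.v₁ * T.ρ ^ (h + n) := by
  have : ∃ l < 2 ^ n, i * 2 ^ n + l < 2 ^ (h + n) ∧ x ∈ T.cell (h + n, i * 2 ^ n + l) := by
    induction n with
    | zero => exact ⟨0, by simp, by simpa using hi, by simpa using hx⟩
    | succ n ih =>
      obtain ⟨l, hl, hlt, hxl⟩ := ih
      rw [← T.split _ _ hlt] at hxl
      have e1 : i * 2 ^ (n + 1) = 2 * (i * 2 ^ n) := by ring
      have e2 : 2 ^ (h + (n + 1)) = 2 * 2 ^ (h + n) := by ring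
      have e3 : 2 ^ (n + 1) = 2 * 2 ^ n := by ring
      rcases hxl with hxl | hxl
      · refine ⟨2 * l, by omega, by omega, ?_⟩
        rwa [e1, ← mul_add, ← add_assoc]
      · refine ⟨2 * l + 1, by omega, by omega, ?_⟩
        rwa [e1, ← add_assoc (2 * _), ← mul_add, ← add_assoc]
  obtain ⟨l, hl, hlt, hxl⟩ := this
  exact ⟨l, hl, Metric.mem_ball.1 (T.outer _ _ hlt hxl)⟩

/-- The deterministic part of chaining: a jump from the center of a cell to all its descendants
`m` levels below, followed by steps of one level. -/
lemma abs_sub_center_le_of_links {F : X → ℝ} (hF : Continuous F) {h i m : ℕ} (hi : i < 2 ^ h)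
    {a B : ℝ} {b : ℕ → ℝ}
    (hjump : ∀ l < 2 ^ m, |F (T.center (h + m, i * 2 ^ m + l)) - F (T.center (h, i))| ≤ a)
    (hlink : ∀ j, ∀ l < 2 ^ (m + j + 1), |F (T.center (h + (m + j + 1), i * 2 ^ (m + j + 1) + l)) -
      F (T.center (h + (m + j), i * 2 ^ (m + j) + l / 2))| ≤ b j)
    (hB : ∀ N, a + ∑ j ∈ Finset.range N, b j ≤ B) {x : X} (hx : x ∈ T.cell (h, i)) :
    |F x - F (T.center (h, i))| ≤ B := by
  have hsum : ∀ N, ∀ l < 2 ^ (m + N),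
      |F (T.center (h + (m + N), i * 2 ^ (m + N) + l)) - F (T.center (h, i))| ≤
        a + ∑ j ∈ Finset.range N, b j := by
    intro N
    induction N with
    | zero => simpa using hjump
    | succ N ih =>
      intro l hl
      rw [Finset.sum_range_succ, ← add_assoc a, add_comm _ (b N)]
      refine (abs_sub_le _ (F (T.center (h + (m + N), i * 2 ^ (m + N) + l / 2))) _).trans ?_
      refine add_le_add (hlink N l hl) (ih _ ?_)
      rw [← add_assoc, pow_succ] at hl
      omega
  refine le_of_forall_pos_le_add fun e he => ?_
  obtain ⟨d, hd, hdF⟩ := Metric.continuous_iff.1 hF x e he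
  have hv : 0 < T.v₁ := by linarith [T.one_le_v₁]
  obtain ⟨N, hN⟩ := exists_pow_lt_of_lt_one (div_pos hd hv) T.ρ_lt_one
  obtain ⟨l, hl, hdist⟩ := exists_descendant T hi hx (m + N)
  have hle : T.v₁ * T.ρ ^ (h + (m + N)) ≤ d := by
    have h1 : T.ρ ^ (h + (m + N)) ≤ T.ρ ^ N :=
      pow_le_pow_of_le_one T.ρ_pos.le T.ρ_lt_one.le (by omega)
    have h2 : T.ρ ^ N * T.v₁ < d := (lt_div_iff₀ hv).1 hN
    nlinarith
  have h3 := hdF (T.center (h + (m + N), i * 2 ^ (m + N) + l))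
    (by rw [dist_comm]; exact hdist.trans_le hle)
  rw [Real.dist_eq, abs_sub_comm] at h3
  have h4 := (hsum N l hl).trans (hB N)
  have h5 := abs_sub_le (F x) (F (T.center (h + (m + N), i * 2 ^ (m + N) + l)))
    (F (T.center (h, i)))
  linarith

variable {Ω : Type*} [MeasurableSpace Ω] {k : X → X → ℝ} {f : X → Ω → ℝ} {P : Measure Ω}
  [IsProbabilityMeasure P]

omit [MetricSpace X] in
lemma IsCenteredGP.measure_diff_gt_le (hf : IsCenteredGP k f P) {x y : X} {s t : ℝ} (ht : 0 ≤ t)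
    (hs : canonicalDist k x y ≤ s) :
    P {ω | s * t < |f x ω - f y ω|} ≤ ENNReal.ofReal (2 * Real.exp (-t ^ 2 / 2)) := by
  have hlaw : HasGaussianLaw (fun ω => f x ω - f y ω) P := hf.gaussian.hasGaussianLaw_sub
  have hint : ∀ z, Integrable (f z) P := fun z => (hf.memLp z).integrable one_le_two
  have hvar : Var[fun ω => f x ω - f y ω; P] = k x x + k y y - 2 * k x y := by
    have := variance_sub (hf.memLp x) (hf.memLp y)
    rw [show (fun ω => f x ω - f y ω) = f x - f y from rfl, this,
      ← covariance_self (hf.measurable x).aemeasurable,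
      ← covariance_self (hf.measurable y).aemeasurable, hf.cov, hf.cov, hf.cov]
    ring
  have hmap := hlaw.map_eq_gaussianReal
  rw [integral_sub (hint x) (hint y), hf.mean, hf.mean, sub_zero, hvar] at hmap
  have hs0 : 0 ≤ s := (Real.sqrt_nonneg _).trans hs
  refine gaussian_tail ((hf.measurable x).sub (hf.measurable y)) hmap hs0 ht ?_
  have := Real.sqrt_le_left hs0 |>.1 hs
  exact this

omit [MetricSpace X] in
lemma IsCenteredGP.measure_diff_pos (hf : IsCenteredGP k f P) {x y : X}
    (hs : canonicalDist k x y ≤ 0) : P {ω | 0 < |f x ω - f y ω|} = 0 := by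
  have h : ∀ t : ℝ, 0 ≤ t → P {ω | 0 < |f x ω - f y ω|} ≤
      ENNReal.ofReal (2 * Real.exp (-t ^ 2 / 2)) := by
    intro t ht
    have := hf.measure_diff_gt_le ht hs
    simpa only [zero_mul] using this
  have hlim : Filter.Tendsto (fun n : ℕ => ENNReal.ofReal (2 * Real.exp (-(n : ℝ) ^ 2 / 2)))
      Filter.atTop (nhds 0) := by
    rw [← ENNReal.ofReal_zero, ← mul_zero (2 : ℝ)]
    refine ENNReal.tendsto_ofReal (Filter.Tendsto.const_mul 2 (Real.tendsto_exp_atBot.comp ?_))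
    refine Filter.Tendsto.atBot_div_const two_pos (Filter.tendsto_neg_atTop_atBot.comp ?_)
    exact (Filter.tendsto_pow_atTop two_ne_zero).comp tendsto_natCast_atTop_atTop
  exact nonpos_iff_eq_zero.1 (ge_of_tendsto' hlim fun n => h n n.cast_nonneg)

omit [IsProbabilityMeasure P] in
/-- Union bound over the links of a chain. -/
lemma measure_cell_gt_le {h i : ℕ} (hi : i < 2 ^ h) (m : ℕ) {a B : ℝ} {b : ℕ → ℝ}
    (hB : ∀ N, a + ∑ j ∈ Finset.range N, b j ≤ B) {p : ℝ≥0∞} {q : ℕ → ℝ≥0∞}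
    (hjump : ∀ l < 2 ^ m,
      P {ω | a < |f (T.center (h + m, i * 2 ^ m + l)) ω - f (T.center (h, i)) ω|} ≤ p)
    (hlink : ∀ j, ∀ l < 2 ^ (m + j + 1),
      P {ω | b j < |f (T.center (h + (m + j + 1), i * 2 ^ (m + j + 1) + l)) ω -
        f (T.center (h + (m + j), i * 2 ^ (m + j) + l / 2)) ω|} ≤ q j) :
    P {ω | (Continuous fun x => f x ω) ∧ ∃ x ∈ T.cell (h, i), B < |f x ω - f (T.center (h, i)) ω|} ≤
      2 ^ m * p + ∑' j, 2 ^ (m + j + 1) * q j := by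
  have hsub : {ω | (Continuous fun x => f x ω) ∧
      ∃ x ∈ T.cell (h, i), B < |f x ω - f (T.center (h, i)) ω|} ⊆
      (⋃ l ∈ Finset.range (2 ^ m),
        {ω | a < |f (T.center (h + m, i * 2 ^ m + l)) ω - f (T.center (h, i)) ω|}) ∪
      ⋃ j, ⋃ l ∈ Finset.range (2 ^ (m + j + 1)),
        {ω | b j < |f (T.center (h + (m + j + 1), i * 2 ^ (m + j + 1) + l)) ω -
          f (T.center (h + (m + j), i * 2 ^ (m + j) + l / 2)) ω|} := by
    rintro ω ⟨hc, x, hx, hlt⟩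
    by_contra hn
    simp only [mem_union, mem_iUnion, Finset.mem_range, mem_ofPred_eq, not_or, not_exists,
      not_lt, exists_prop, not_and] at hn
    exact absurd (abs_sub_center_le_of_links T hc hi hn.1 hn.2 hB hx) (not_le.2 hlt)
  refine (measure_mono hsub).trans ((measure_union_le _ _).trans (add_le_add ?_ ?_))
  · refine (measure_biUnion_finset_le _ _).trans ?_
    refine (Finset.sum_le_card_nsmul _ _ p fun l hl => hjump l (Finset.mem_range.1 hl)).trans ?_
    rw [Finset.card_range, nsmul_eq_mul]
    norm_cast
  · refine (measure_iUnion_le _).trans (ENNReal.tsum_le_tsum fun j => ?_)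
    refine (measure_biUnion_finset_le _ _).trans ?_
    refine (Finset.sum_le_card_nsmul _ _ (q j)
      fun l hl => hlink j l (Finset.mem_range.1 hl)).trans ?_
    rw [Finset.card_range, nsmul_eq_mul]
    norm_cast

end Chaining

/-! ### The variation of the process in a cell -/

section CellVariation

variable {X : Type*} [MetricSpace X] (T : PartitionTree X)

lemma sum_pow_mul_le {r : ℝ} (hr : 0 ≤ r) (hr1 : r < 1) {c t₀ : ℝ} (hc : 0 ≤ c) (ht : 0 ≤ t₀)
    (N : ℕ) : ∑ j ∈ Finset.range N, c * r ^ j * (t₀ + 2 * ((j : ℝ) + 1)) ≤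
      c * (t₀ / (1 - r) + 2 / (1 - r) ^ 2) := by
  have h1r : 0 < 1 - r := by linarith
  have key : ∑ j ∈ Finset.range N, r ^ j * (t₀ + 2 * ((j : ℝ) + 1)) =
      t₀ / (1 - r) + 2 / (1 - r) ^ 2 -
        r ^ N * ((t₀ + 2 * N) / (1 - r) + 2 / (1 - r) ^ 2) := by
    induction N with
    | zero => simp
    | succ N ih =>
      rw [Finset.sum_range_succ, ih]
      field_simp
      push_cast
      ring
  have h2 : 0 ≤ r ^ N * ((t₀ + 2 * N) / (1 - r) + 2 / (1 - r) ^ 2) := by positivity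
  calc _ = c * ∑ j ∈ Finset.range N, r ^ j * (t₀ + 2 * ((j : ℝ) + 1)) := by
        rw [Finset.mul_sum]
        exact Finset.sum_congr rfl fun j _ => by ring
    _ ≤ _ := by
        rw [key]
        exact mul_le_mul_of_nonneg_left (by linarith) hc

/-- The failure probabilities of all links, when the `j`-th level uses the multiplier
`t₀ + 2 (j + 1)` of the standard deviation. -/
lemma link_failures_le {t₀ : ℝ} (ht : 0 ≤ t₀) (m : ℕ) :
    (2 : ℝ≥0∞) ^ m * ENNReal.ofReal (2 * Real.exp (-t₀ ^ 2 / 2)) +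
      ∑' j : ℕ, 2 ^ (m + j + 1) *
        ENNReal.ofReal (2 * Real.exp (-(t₀ + 2 * ((j : ℝ) + 1)) ^ 2 / 2)) ≤
      ENNReal.ofReal (4 * 2 ^ m * Real.exp (-t₀ ^ 2 / 2)) := by
  have e2 : ∀ n : ℕ, (2 : ℝ≥0∞) ^ n = ENNReal.ofReal (2 ^ n) := by
    intro n
    rw [ENNReal.ofReal_pow zero_le_two]
    simp
  set E := 2 ^ m * (2 * Real.exp (-t₀ ^ 2 / 2)) with hE
  have hE0 : 0 ≤ E := by positivity
  have hexp2 : Real.exp (-2) ≤ 1 / 4 := by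
    rw [Real.exp_neg, inv_eq_one_div]
    refine one_div_le_one_div_of_le (by norm_num) ?_
    have := Real.add_one_le_exp (1 : ℝ)
    rw [show (2 : ℝ) = 1 + 1 by norm_num, Real.exp_add]
    nlinarith
  have hterm : ∀ j : ℕ, (2 : ℝ≥0∞) ^ (m + j + 1) *
      ENNReal.ofReal (2 * Real.exp (-(t₀ + 2 * ((j : ℝ) + 1)) ^ 2 / 2)) ≤
      ENNReal.ofReal (E * (1 / 2 / 2 ^ j)) := by
    intro j
    rw [e2, ← ENNReal.ofReal_mul (by positivity)]
    refine ENNReal.ofReal_le_ofReal ?_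
    have h1 : Real.exp (-(t₀ + 2 * ((j : ℝ) + 1)) ^ 2 / 2) ≤
        Real.exp (-t₀ ^ 2 / 2) * Real.exp (-2) ^ (j + 1) := by
      rw [← Real.exp_nat_mul, ← Real.exp_add]
      refine Real.exp_le_exp.2 ?_
      push_cast
      have hj : (0 : ℝ) ≤ j := j.cast_nonneg
      nlinarith [mul_nonneg ht hj]
    have h2 : Real.exp (-2) ^ (j + 1) ≤ (1 / 4) ^ (j + 1) :=
      pow_le_pow_left₀ (Real.exp_pos _).le hexp2 _
    calc (2 : ℝ) ^ (m + j + 1) * (2 * Real.exp (-(t₀ + 2 * ((j : ℝ) + 1)) ^ 2 / 2))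
        ≤ 2 ^ (m + j + 1) * (2 * (Real.exp (-t₀ ^ 2 / 2) * (1 / 4) ^ (j + 1))) := by
          gcongr
          exact h1.trans (mul_le_mul_of_nonneg_left h2 (Real.exp_pos _).le)
      _ = E * (1 / 2 / 2 ^ j) := by
          rw [hE, add_assoc, pow_add, show (1 / 4 : ℝ) = (1 / 2) * (1 / 2) by norm_num, mul_pow,
            one_div_pow, pow_succ (2 : ℝ) j]
          field_simp
  have hsum : ∑' j : ℕ, ENNReal.ofReal (E * (1 / 2 / 2 ^ j)) = ENNReal.ofReal E := by
    rw [← ENNReal.ofReal_tsum_of_nonneg (fun j => by positivity)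
      ((summable_geometric_two' 1).mul_left E), tsum_mul_left, tsum_geometric_two', mul_one]
  refine (add_le_add le_rfl (ENNReal.tsum_le_tsum hterm)).trans ?_
  rw [hsum, e2, ← ENNReal.ofReal_mul (by positivity), ← hE, ← ENNReal.ofReal_add hE0 hE0]
  refine ENNReal.ofReal_le_ofReal (le_of_eq ?_)
  rw [hE]
  ring

/-- The choice of the first scale of the chain and of the constants. A cell with modulus `s` is
reached after a jump to a depth where the modulus is at most `s θ`; the multiplier `t₀` of the
jump pays for the `2 ^ m` descendants there. -/
lemma exists_chaining_scale {α δk Ck G : ℝ} (hα : 0 < α) (hδk : 0 < δk) (hCk : 0 < Ck)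
    (hG : 1 ≤ G) : ∃ C₂₀ C₃₀ : ℝ, 0 ≤ C₃₀ ∧ ∀ C₂ s L : ℝ, ∀ h : ℕ, C₂₀ ≤ C₂ → 0 < s → s ≤ G →
      0 ≤ L → 0 ≤ C₂ + 4 * (treeDim T / α) * Real.log (1 / s) ∧
      ∃ (m : ℕ) (θ t₀ : ℝ), T.v₁ * T.ρ ^ (h + m) ≤ δk ∧
        Ck * (T.v₁ * T.ρ ^ (h + m)) ^ α ≤ s * θ ∧ 0 ≤ θ ∧ 0 ≤ t₀ ∧
        4 * 2 ^ m * Real.exp (-t₀ ^ 2 / 2) ≤ Real.exp (-L) / 2 ∧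
        t₀ + θ * (t₀ / (1 - T.ρ ^ α) + 2 / (1 - T.ρ ^ α) ^ 2) ≤
          √(C₂ + 2 * L + 4 * (treeDim T / α) * Real.log (1 / s)) + C₃₀ := by
  set D := treeDim T / α with hD
  have hD0 : 0 < D := div_pos (treeDim_pos T) hα
  have hv : 0 < T.v₁ := by linarith [T.one_le_v₁]
  set r := T.ρ ^ α with hr
  have hr0 : 0 < r := Real.rpow_pos_of_pos T.ρ_pos _
  have hr1 : r < 1 := Real.rpow_lt_one T.ρ_pos.le T.ρ_lt_one hα
  have h1r : 0 < 1 - r := by linarith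
  have hDr : D * Real.log (1 / r) = Real.log 2 := by
    rw [← treeDim_mul_log T, hD, hr, one_div, one_div, Real.log_inv, Real.log_inv,
      Real.log_rpow T.ρ_pos]
    field_simp
  -- the cap on `q` puts the first scale below `δk`, where the Hölder bound of `g` holds
  set q := min 1 (Ck * δk ^ α / G) with hq
  have hG0 : 0 < G := by linarith
  have hq0 : 0 < q := lt_min one_pos (by positivity)
  have hq1 : q ≤ 1 := min_le_left _ _
  have hlogG : 0 ≤ Real.log G := Real.log_nonneg hG
  set κ := |Real.log (Ck * T.v₁ ^ α)| with hκ
  have hlogq : 0 ≤ Real.log (1 / q) := Real.log_nonneg (by rw [le_div_iff₀ hq0]; linarith)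
  have hl2 : 0 < Real.log 2 := Real.log_pos one_lt_two
  refine ⟨1 + 4 * D * Real.log G + 2 * (4 * Real.log 2 + D * κ + 2 * D * Real.log G +
    D * Real.log (1 / q)), D + (1 + D) / (1 - r) + 2 / (1 - r) ^ 2, by positivity, ?_⟩
  intro C₂ s L h hC hs hsG hL
  have hlogs : -Real.log G ≤ Real.log (1 / s) := by
    rw [one_div, Real.log_inv]
    exact neg_le_neg (Real.log_le_log hs hsG)
  have hDs : -(D * Real.log G) ≤ D * Real.log (1 / s) := by
    rw [← mul_neg]
    exact mul_le_mul_of_nonneg_left hlogs hD0.le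
  have hDκ : 0 ≤ D * κ := mul_nonneg hD0.le (abs_nonneg _)
  have hDG : 0 ≤ D * Real.log G := mul_nonneg hD0.le hlogG
  have hDq : 0 ≤ D * Real.log (1 / q) := mul_nonneg hD0.le hlogq
  refine ⟨by linarith, ?_⟩
  set Q := C₂ + 2 * L + 4 * D * Real.log (1 / s) with hQ
  have hQ1 : 1 ≤ Q := by rw [hQ]; linarith
  set R := √Q with hR
  have hR1 : 1 ≤ R := Real.one_le_sqrt.2 hQ1
  have hR2 : R ^ 2 = Q := Real.sq_sqrt (by linarith)
  have hR0 : 0 < R := by linarith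
  have hθ0 : 0 < q / R := by positivity
  have hsθ : 0 < s * (q / R) := by positivity
  -- the modulus at depth `h + n`
  have hmod : ∀ n, Ck * (T.v₁ * T.ρ ^ (h + n)) ^ α = Ck * T.v₁ ^ α * r ^ (h + n) := by
    intro n
    rw [Real.mul_rpow hv.le (pow_nonneg T.ρ_pos.le _), hr, ← Real.rpow_natCast, ← Real.rpow_natCast,
      ← Real.rpow_mul T.ρ_pos.le, ← Real.rpow_mul T.ρ_pos.le, mul_comm α, mul_assoc]
  have hCv : 0 < Ck * T.v₁ ^ α := by positivity
  have hex : ∃ n, Ck * (T.v₁ * T.ρ ^ (h + n)) ^ α ≤ s * (q / R) := by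
    obtain ⟨n, hn⟩ := exists_pow_lt_of_lt_one (div_pos hsθ hCv) hr1
    refine ⟨n, ?_⟩
    rw [hmod]
    have h1 : r ^ (h + n) ≤ r ^ n := pow_le_pow_of_le_one hr0.le hr1.le (by omega)
    have h2 : r ^ n * (Ck * T.v₁ ^ α) < s * (q / R) := (lt_div_iff₀ hCv).1 hn
    nlinarith
  classical
  set m := Nat.find hex with hm
  have hm1 := Nat.find_spec hex
  rw [← hm] at hm1
  have hmlog : m * Real.log 2 ≤ Real.log 2 + D * κ + D * Real.log G + D * Real.log (1 / s) +
      D * Real.log (1 / q) + D * Real.log R := by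
    have hlogR : 0 ≤ D * Real.log R := mul_nonneg hD0.le (Real.log_nonneg hR1)
    rcases Nat.eq_zero_or_pos m with h0 | h0
    · rw [h0]
      push_cast
      linarith
    · have hlt := Nat.find_min hex (m := m - 1) (by omega)
      rw [not_le, hmod] at hlt
      have h1 : r ^ (h + (m - 1)) ≤ r ^ (m - 1) := pow_le_pow_of_le_one hr0.le hr1.le (by omega)
      have h2 : s * (q / R) < Ck * T.v₁ ^ α * r ^ (m - 1) :=
        hlt.trans_le (mul_le_mul_of_nonneg_left h1 hCv.le)
      have h3 := Real.log_lt_log hsθ h2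
      rw [Real.log_mul hs.ne' hθ0.ne', Real.log_div hq0.ne' hR0.ne',
        Real.log_mul hCv.ne' (pow_pos hr0 _).ne', Real.log_pow] at h3
      have h4 : ((m - 1 : ℕ) : ℝ) = m - 1 := by
        rw [Nat.cast_sub h0, Nat.cast_one]
      rw [h4] at h3
      rw [one_div, Real.log_inv] at hDr ⊢
      rw [one_div, Real.log_inv]
      have h5 : Real.log (Ck * T.v₁ ^ α) ≤ κ := le_abs_self _
      have h6 := mul_lt_mul_of_pos_left h3 hD0
      have h7 := mul_le_mul_of_nonneg_left h5 hD0.le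
      have h8 : D * ((m - 1) * Real.log r) = -((m - 1) * Real.log 2) := by
        rw [← hDr]; ring
      linarith
  have hlogR : Real.log R ≤ R := (Real.log_le_sub_one_of_pos hR0).trans (by linarith)
  refine ⟨m, q / R, R + D, ?_, hm1, hθ0.le, by positivity, ?_, ?_⟩
  · have h1 : s * (q / R) ≤ Ck * δk ^ α := by
      have h2 : q / R ≤ q := div_le_self hq0.le hR1
      have h3 : q ≤ Ck * δk ^ α / G := min_le_right _ _
      have h4 : G * q ≤ Ck * δk ^ α := by
        rw [le_div_iff₀ hG0] at h3
        linarith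
      exact (mul_le_mul hsG h2 hθ0.le hG0.le).trans h4
    have h2 := (mul_le_mul_iff_right₀ hCk).1 (hm1.trans h1)
    exact (Real.rpow_le_rpow_iff (by have := T.ρ_pos; positivity) hδk.le hα).1 h2
  · have h4 : (4 : ℝ) = Real.exp (2 * Real.log 2) := by
      rw [two_mul, Real.exp_add, Real.exp_log two_pos]; norm_num
    have h2m : (2 : ℝ) ^ m = Real.exp (m * Real.log 2) := by
      rw [Real.exp_nat_mul, Real.exp_log two_pos]
    have h2 : (1 / 2 : ℝ) = Real.exp (-Real.log 2) := by
      rw [Real.exp_neg, Real.exp_log two_pos]; norm_num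
    rw [show Real.exp (-L) / 2 = Real.exp (-L) * (1 / 2) by ring, h4, h2m, h2, ← Real.exp_add,
      ← Real.exp_add, ← Real.exp_add]
    refine Real.exp_le_exp.2 ?_
    have h5 : D * Real.log R ≤ D * R := mul_le_mul_of_nonneg_left hlogR hD0.le
    have h6 : -(R + D) ^ 2 / 2 ≤ -(Q / 2) - D * R := by
      have e : (R + D) ^ 2 = R ^ 2 + 2 * (D * R) + D ^ 2 := by ring
      rw [← hR2]
      linarith [sq_nonneg D]
    rw [hQ] at h6
    linarith
  · have h1 : q / R * (R + D) ≤ 1 + D := by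
      rw [div_mul_eq_mul_div, div_le_iff₀ hR0]
      have e1 := mul_le_of_le_one_left (add_pos hR0 hD0).le hq1
      have e2 := le_mul_of_one_le_right hD0.le hR1
      linarith
    have h2 : q / R ≤ 1 := (div_le_one hR0).2 (hq1.trans hR1)
    have h3 : q / R * (R + D) / (1 - r) ≤ (1 + D) / (1 - r) :=
      div_le_div_of_nonneg_right h1 h1r.le
    have h4 : q / R * (2 / (1 - r) ^ 2) ≤ 2 / (1 - r) ^ 2 :=
      mul_le_of_le_one_left (by positivity) h2
    rw [mul_add, ← mul_div_assoc]
    linarith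

variable {Ω : Type*} [MeasurableSpace Ω] {k : X → X → ℝ} {f : X → Ω → ℝ} {P : Measure Ω}
  [IsProbabilityMeasure P] {g : ℝ → ℝ}

lemma canonicalDist_descendant_le (hg_mono : MonotoneOn g (Set.Ici 0))
    (hkg : ∀ x y : X, canonicalDist k x y ≤ g (dist x y)) {h i : ℕ} (hi : i < 2 ^ h) (n : ℕ)
    {l : ℕ} (hl : l < 2 ^ n) : canonicalDist k (T.center (h + n, i * 2 ^ n + l)) (T.center (h, i)) ≤
      g (T.v₁ * T.ρ ^ h) := by
  have hd := (Metric.mem_ball.1 (T.outer h i hi (center_descendant_mem T hi n hl))).le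
  exact (hkg _ _).trans (hg_mono dist_nonneg (dist_nonneg.trans hd) hd)

lemma canonicalDist_link_le (hg_mono : MonotoneOn g (Set.Ici 0))
    (hkg : ∀ x y : X, canonicalDist k x y ≤ g (dist x y)) {h i : ℕ} (hi : i < 2 ^ h) (n : ℕ)
    {l : ℕ} (hl : l < 2 ^ (n + 1)) :
    canonicalDist k (T.center (h + (n + 1), i * 2 ^ (n + 1) + l))
      (T.center (h + n, i * 2 ^ n + l / 2)) ≤ g (T.v₁ * T.ρ ^ (h + n)) := by
  have hlt : i * 2 ^ n + l / 2 < 2 ^ (h + n) := by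
    calc i * 2 ^ n + l / 2 < (i + 1) * 2 ^ n := by
          rw [add_mul]; rw [pow_succ] at hl; omega
      _ ≤ 2 ^ h * 2 ^ n := Nat.mul_le_mul_right _ hi
      _ = 2 ^ (h + n) := (pow_add _ _ _).symm
  have := canonicalDist_descendant_le T hg_mono hkg hlt 1 (l := l % 2) (by omega)
  rwa [show (i * 2 ^ n + l / 2) * 2 ^ 1 + l % 2 = i * 2 ^ (n + 1) + l by
    rw [pow_one, pow_succ, ← mul_assoc]; omega, add_assoc] at this

/-- With the thresholds for `C₂`, `C₃` obtained from the chaining constants, the probability that a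
continuous path leaves the band of half-width `V` around its value at the center of a given cell
is at most `exp (-L) / 2`. -/
lemma exists_thresholds (hg_mono : MonotoneOn g (Set.Ici 0)) (hg_zero : g 0 = 0)
    (hkg : ∀ x y : X, canonicalDist k x y ≤ g (dist x y))
    {α δk Ck : ℝ} (hα : 0 < α) (hδk : 0 < δk) (hCk : 0 < Ck)
    (hg_le : ∀ r : ℝ, 0 ≤ r → r ≤ δk → g r ≤ Ck * r ^ α) :
    ∃ C₂₀ C₃₀ : ℝ, 0 ≤ C₃₀ ∧
      (∀ C₂, C₂₀ ≤ C₂ → ∀ h : ℕ, 0 < g (T.v₁ * T.ρ ^ h) →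
        0 ≤ C₂ + 4 * (metricDim X / α) * Real.log (1 / g (T.v₁ * T.ρ ^ h))) ∧
      ∀ C₂ C₃ L : ℝ, ∀ h i : ℕ, C₂₀ ≤ C₂ → C₃₀ ≤ C₃ → 0 ≤ L → i < 2 ^ h →
      ∀ {Ω : Type v} [MeasurableSpace Ω] (P : Measure Ω) [IsProbabilityMeasure P]
        (f : X → Ω → ℝ), IsCenteredGP k f P →
        P {ω | (Continuous fun x => f x ω) ∧ ∃ x ∈ T.cell (h, i), g (T.v₁ * T.ρ ^ h) *
          (√(C₂ + 2 * L + 4 * (metricDim X / α) * Real.log (1 / g (T.v₁ * T.ρ ^ h))) + C₃) <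
            |f x ω - f (T.center (h, i)) ω|} ≤ ENNReal.ofReal (Real.exp (-L) / 2) := by
  have hv : 0 < T.v₁ := by linarith [T.one_le_v₁]
  have hrad : ∀ n, 0 ≤ T.v₁ * T.ρ ^ n := fun n => mul_nonneg hv.le (pow_nonneg T.ρ_pos.le n)
  have hrad_anti : ∀ m n, m ≤ n → T.v₁ * T.ρ ^ n ≤ T.v₁ * T.ρ ^ m := fun m n hmn =>
    mul_le_mul_of_nonneg_left (pow_le_pow_of_le_one T.ρ_pos.le T.ρ_lt_one.le hmn) hv.le
  obtain ⟨C₂₀, C₃₀, h3, hC⟩ := exists_chaining_scale T hα hδk hCk (le_max_right (g T.v₁) 1)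
  have hsG : ∀ h, g (T.v₁ * T.ρ ^ h) ≤ max (g T.v₁) 1 := fun h => by
    refine (hg_mono (hrad h) hv.le ?_).trans (le_max_left _ _)
    simpa using hrad_anti 0 h (Nat.zero_le h)
  rw [metricDim_eq T]
  refine ⟨C₂₀, C₃₀, h3, fun C₂ h2 h hs => (hC C₂ _ 0 h h2 hs (hsG h) le_rfl).1, ?_⟩
  intro C₂ C₃ L h i h2 h3' hL hi Ω _ P _ f hf
  have hs0 : 0 ≤ g (T.v₁ * T.ρ ^ h) := by
    rw [← hg_zero]
    exact hg_mono self_mem_Ici (hrad h) (hrad h)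
  rcases hs0.eq_or_lt with hs | hs
  · -- the modulus vanishes, and the process is constant on the cell
    rw [← hs, zero_mul]
    refine (measure_cell_gt_le T hi 0 (a := 0) (b := fun _ => 0) (p := 0) (q := fun _ => 0)
      (by simp) ?_ ?_).trans (by simp)
    · intro l hl
      have := canonicalDist_descendant_le T hg_mono hkg hi 0 hl
      rw [← hs] at this
      exact (hf.measure_diff_pos this).le
    · intro j l hl
      have := canonicalDist_link_le T hg_mono hkg hi (0 + j) hl
      exact (hf.measure_diff_pos (this.trans ((hg_mono (hrad _) (hrad _)
        (hrad_anti _ _ (by omega))).trans hs.symm.le))).le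
  · obtain ⟨-, m, θ, t₀, hmδ, hmθ, hθ, ht, hexp, hle⟩ := hC C₂ _ L h h2 hs (hsG h) hL
    have hr0 : 0 ≤ T.ρ ^ α := Real.rpow_nonneg T.ρ_pos.le _
    have hr1 : T.ρ ^ α < 1 := Real.rpow_lt_one T.ρ_pos.le T.ρ_lt_one hα
    set s := g (T.v₁ * T.ρ ^ h)
    refine (measure_cell_gt_le T hi m (a := s * t₀)
      (b := fun j => s * θ * (T.ρ ^ α) ^ j * (t₀ + 2 * ((j : ℝ) + 1)))
      (p := ENNReal.ofReal (2 * Real.exp (-t₀ ^ 2 / 2)))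
      (q := fun j => ENNReal.ofReal (2 * Real.exp (-(t₀ + 2 * ((j : ℝ) + 1)) ^ 2 / 2)))
      ?_ ?_ ?_).trans ((link_failures_le ht m).trans (ENNReal.ofReal_le_ofReal hexp))
    · intro N
      have h4 := sum_pow_mul_le hr0 hr1 (mul_nonneg hs.le hθ) ht N
      have h5 := mul_le_mul_of_nonneg_left (hle.trans (add_le_add_right h3' _)) hs.le
      nlinarith
    · intro l hl
      exact hf.measure_diff_gt_le ht (canonicalDist_descendant_le T hg_mono hkg hi m hl)
    · intro j l hl
      refine hf.measure_diff_gt_le (by positivity)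
        ((canonicalDist_link_le T hg_mono hkg hi (m + j) hl).trans ?_)
      refine (hg_le _ (hrad _) ((hrad_anti _ _ (by omega)).trans hmδ)).trans ?_
      have e : Ck * (T.v₁ * T.ρ ^ (h + (m + j))) ^ α =
          Ck * (T.v₁ * T.ρ ^ (h + m)) ^ α * (T.ρ ^ α) ^ j := by
        rw [← add_assoc, pow_add _ (h + m), ← mul_assoc, Real.mul_rpow (hrad _)
          (pow_nonneg T.ρ_pos.le _), ← Real.rpow_natCast T.ρ j, ← Real.rpow_mul T.ρ_pos.le,
          mul_comm (j : ℝ), Real.rpow_mul T.ρ_pos.le, Real.rpow_natCast, mul_assoc]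
      rw [e]
      exact mul_le_mul_of_nonneg_right hmθ (pow_nonneg hr0 _)

end CellVariation

/-! ### Growth of the parameters -/

section Band

variable {s s' t C₂ C₃ D L L' U : ℝ}

lemma sq_mul_log_inv_le (hs : 0 < s) (hst : s ≤ t) :
    s ^ 2 * Real.log (1 / s) ≤ s ^ 2 * Real.log (1 / t) + t ^ 2 / 2 := by
  have ht : 0 < t := hs.trans_le hst
  have h1 : Real.log (1 / s) = Real.log (1 / t) + Real.log (t / s) := by
    rw [one_div, one_div, Real.log_inv, Real.log_inv, Real.log_div ht.ne' hs.ne']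
    ring
  have h2 : 2 * Real.log (t / s) ≤ (t / s) ^ 2 := by
    have := Real.log_le_sub_one_of_pos (pow_pos (div_pos ht hs) 2)
    rw [Real.log_pow] at this
    push_cast at this
    linarith
  have h3 : s ^ 2 * (t / s) ^ 2 = t ^ 2 := by
    rw [← mul_pow, mul_div_cancel₀ _ hs.ne']
  have h4 := mul_le_mul_of_nonneg_left h2 (sq_nonneg s)
  rw [h1]
  linarith

/-- The half-width of the band over a cell is almost monotone in the modulus `s` of the cell. -/
lemma band_le_mul_band (hs' : 0 ≤ s') (hs : s' ≤ s) (hC₃ : 0 ≤ C₃) (hD : 0 ≤ D)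
    (hrad : 0 < s → 0 ≤ C₂ + 4 * D * Real.log (1 / s)) (hL : 1 ≤ 2 * L) (hL' : 1 ≤ 2 * L') :
    s' * (√(C₂ + 2 * L' + 4 * D * Real.log (1 / s')) + C₃) ≤
      √(1 + 2 * L' + 2 * D) * (s * (√(C₂ + 2 * L + 4 * D * Real.log (1 / s)) + C₃)) := by
  have hΓ : 1 ≤ √(1 + 2 * L' + 2 * D) := Real.one_le_sqrt.2 (by linarith)
  have hs0 : 0 ≤ s := hs'.trans hs
  rcases hs'.eq_or_lt with h0 | h0
  · rw [← h0, zero_mul]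
    positivity
  have hspos : 0 < s := h0.trans_le hs
  have hr := hrad hspos
  set a := C₂ + 4 * D * Real.log (1 / s)
  have h1 : s' * √(C₂ + 2 * L' + 4 * D * Real.log (1 / s')) ≤
      √(1 + 2 * L' + 2 * D) * (s * √(C₂ + 2 * L + 4 * D * Real.log (1 / s))) := by
    have e1 : s' = √(s' ^ 2) := (Real.sqrt_sq hs').symm
    have e2 : s = √(s ^ 2) := (Real.sqrt_sq hs0).symm
    nth_rewrite 1 [e1]
    nth_rewrite 1 [e2]
    rw [← Real.sqrt_mul (sq_nonneg _), ← Real.sqrt_mul (sq_nonneg _),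
      ← Real.sqrt_mul (by linarith)]
    refine Real.sqrt_le_sqrt ?_
    have h2 := mul_le_mul_of_nonneg_left (sq_mul_log_inv_le h0 hs) (by linarith : 0 ≤ 4 * D)
    have h3 : s' ^ 2 ≤ s ^ 2 := pow_le_pow_left₀ hs' hs 2
    have h4 : s' ^ 2 * (a + 2 * L') ≤ s ^ 2 * (a + 2 * L') :=
      mul_le_mul_of_nonneg_right h3 (by linarith)
    -- `a + 2 L ≥ 1`, so additive constants can be absorbed in the factor
    have h5 : a + 2 * L' + 2 * D ≤ (1 + 2 * L' + 2 * D) * (a + 2 * L) := by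
      nlinarith [mul_nonneg hD hr, mul_nonneg (by linarith : 0 ≤ 2 * L') hr,
        mul_nonneg (by linarith : 0 ≤ 2 * L' + 2 * D) (by linarith : 0 ≤ 2 * L - 1)]
    have h6 := mul_le_mul_of_nonneg_left h5 (sq_nonneg s)
    simp only [a] at h4 h6
    linarith
  have h2 : s' * C₃ ≤ √(1 + 2 * L' + 2 * D) * (s * C₃) :=
    (mul_le_mul_of_nonneg_right hs hC₃).trans
      (le_mul_of_one_le_left (mul_nonneg hs0 hC₃) hΓ)
  rw [mul_add, mul_add s, mul_add (√(1 + 2 * L' + 2 * D))]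
  linarith

lemma band_le (hs : 0 ≤ s) (hst : s ≤ t) (hC₃ : 0 ≤ C₃) (hD : 0 ≤ D) (hL : 0 ≤ L) (hU : 0 ≤ U)
    (htU : Real.log (1 / t) ≤ U) :
    s * (√(C₂ + 2 * L + 4 * D * Real.log (1 / s)) + C₃) ≤
      t * (1 + |C₂| + 2 * L + 4 * D * U + 2 * D + C₃) := by
  have ht0 : 0 ≤ t := hs.trans hst
  have hDU := mul_nonneg hD hU
  have hW : 0 ≤ |C₂| + 2 * L + 4 * D * U + 2 * D := by
    have := abs_nonneg C₂
    nlinarith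
  rcases hs.eq_or_lt with h0 | h0
  · rw [← h0, zero_mul]
    exact mul_nonneg ht0 (by linarith)
  have h1 : s * √(C₂ + 2 * L + 4 * D * Real.log (1 / s)) ≤
      t * √(|C₂| + 2 * L + 4 * D * U + 2 * D) := by
    have e1 : s = √(s ^ 2) := (Real.sqrt_sq hs).symm
    have e2 : t = √(t ^ 2) := (Real.sqrt_sq ht0).symm
    nth_rewrite 1 [e1]
    nth_rewrite 1 [e2]
    rw [← Real.sqrt_mul (sq_nonneg _), ← Real.sqrt_mul (sq_nonneg _)]
    refine Real.sqrt_le_sqrt ?_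
    have h2 := mul_le_mul_of_nonneg_left (sq_mul_log_inv_le h0 hst) (by linarith : 0 ≤ 4 * D)
    have h3 : s ^ 2 ≤ t ^ 2 := pow_le_pow_left₀ hs hst 2
    have h4 : C₂ + 2 * L + 4 * D * Real.log (1 / t) ≤ |C₂| + 2 * L + 4 * D * U := by
      have := mul_le_mul_of_nonneg_left htU (by linarith : 0 ≤ 4 * D)
      linarith [le_abs_self C₂]
    have h5 := mul_le_mul_of_nonneg_left h4 (sq_nonneg s)
    have h6 := mul_le_mul_of_nonneg_right h3
      (by have := abs_nonneg C₂; nlinarith : 0 ≤ |C₂| + 2 * L + 4 * D * U)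
    linarith
  have h2 : √(|C₂| + 2 * L + 4 * D * U + 2 * D) ≤ 1 + (|C₂| + 2 * L + 4 * D * U + 2 * D) :=
    Real.sqrt_le_iff.2 ⟨by linarith, by nlinarith⟩
  have h3 := mul_le_mul_of_nonneg_left h2 ht0
  have h4 := mul_le_mul_of_nonneg_right hst hC₃
  rw [mul_add]
  linarith

end Band

section Growth

variable {X : Type*} [MetricSpace X] (T : PartitionTree X)

/-- The rate `1 / (2 α log (1 / ρ̄))` at which the maximal depth grows with `log n`. -/
noncomputable def depthRate (α : ℝ) : ℝ := 1 / (2 * α * Real.log (1 / rhoBar T))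

lemma rhoBar_pos : 0 < rhoBar T := T.ρ_pos.trans_le (le_max_left _ _)

lemma log_inv_rhoBar_pos : 0 < Real.log (1 / rhoBar T) :=
  Real.log_pos (by
    rw [lt_div_iff₀ (rhoBar_pos T), one_mul]
    exact max_lt T.ρ_lt_one (by norm_num))

lemma log_inv_rhoBar_le : Real.log (1 / rhoBar T) ≤ Real.log (1 / T.ρ) :=
  Real.log_le_log (one_div_pos.2 (rhoBar_pos T))
    (one_div_le_one_div_of_le T.ρ_pos (le_max_left _ _))

lemma depthRate_pos {α : ℝ} (hα : 0 < α) : 0 < depthRate T α :=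
  one_div_pos.2 (mul_pos (mul_pos two_pos hα) (log_inv_rhoBar_pos T))

lemma maxDepth_eq (α : ℝ) (n : ℕ) : maxDepth T α n = depthRate T α * Real.log n := by
  rw [maxDepth, depthRate, div_mul_eq_mul_div, one_mul]

lemma log_inv_deltaParam {α δ : ℝ} (hδ : 0 < δ) {n : ℕ} (hn : 0 < maxDepth T α n) (h : ℕ) :
    Real.log (1 / deltaParam T α δ n h) =
      h * Real.log 2 + Real.log (maxDepth T α n) + Real.log (1 / δ) := by
  have h2 : (2 : ℝ) ^ h ≠ 0 := by positivity
  rw [deltaParam, one_div, inv_div, Real.log_div (mul_ne_zero h2 hn.ne') hδ.ne',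
    Real.log_mul h2 hn.ne', Real.log_pow, one_div, Real.log_inv]
  ring

lemma rho_rpow_le {α : ℝ} (hα : 0 < α) {n h : ℕ} (hn : 0 < n) (hh : maxDepth T α n ≤ h) :
    T.ρ ^ (α * h) ≤ 1 / √n := by
  have hn' : (1 : ℝ) ≤ n := by exact_mod_cast hn
  have hlog : 0 ≤ Real.log n := Real.log_nonneg hn'
  have hb := log_inv_rhoBar_pos T
  rw [Real.rpow_def_of_pos T.ρ_pos, one_div, Real.sqrt_eq_rpow, ← Real.rpow_neg (by linarith),
    Real.rpow_def_of_pos (by linarith)]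
  refine Real.exp_le_exp.2 ?_
  have h1 : Real.log T.ρ = -Real.log (1 / T.ρ) := by rw [one_div, Real.log_inv, neg_neg]
  have h2 := log_inv_rhoBar_le T
  have h3 : maxDepth T α n * (α * Real.log (1 / rhoBar T)) = Real.log n / 2 := by
    rw [maxDepth]
    field_simp
  have h4 : Real.log n / 2 ≤ h * (α * Real.log (1 / T.ρ)) := by
    rw [← h3]
    exact mul_le_mul hh (mul_le_mul_of_nonneg_left h2 hα.le) (by positivity) (Nat.cast_nonneg h)
  rw [h1]
  linarith

/-- The modulus of a cell of depth `h` is `O(ρ ^ (α h))`, at all depths. -/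
lemma exists_modulus_le {g : ℝ → ℝ} (hg_mono : MonotoneOn g (Set.Ici 0)) {α δk Ck : ℝ}
    (hα : 0 < α) (hδk : 0 < δk) (hCk : 0 < Ck)
    (hg_le : ∀ r : ℝ, 0 ≤ r → r ≤ δk → g r ≤ Ck * r ^ α) :
    ∃ c, 0 < c ∧ ∀ h : ℕ, g (T.v₁ * T.ρ ^ h) ≤ c * T.ρ ^ (α * h) := by
  have hv : 0 < T.v₁ := by linarith [T.one_le_v₁]
  have hG : 0 < max (g T.v₁) 1 := lt_max_of_lt_right one_pos
  refine ⟨Ck * T.v₁ ^ α + max (g T.v₁) 1 * (T.v₁ / δk) ^ α, by positivity, fun h => ?_⟩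
  have hρ := pow_pos T.ρ_pos h
  have hpow : (T.ρ ^ h) ^ α = T.ρ ^ (α * h) := by
    rw [← Real.rpow_natCast, ← Real.rpow_mul T.ρ_pos.le, mul_comm]
  rw [← hpow, add_mul, mul_assoc, mul_assoc, ← Real.mul_rpow hv.le hρ.le,
    ← Real.mul_rpow (by positivity) hρ.le]
  rcases le_or_gt (T.v₁ * T.ρ ^ h) δk with hle | hgt
  · have := hg_le _ (by positivity) hle
    have h2 : 0 ≤ max (g T.v₁) 1 * (T.v₁ / δk * T.ρ ^ h) ^ α := by positivity
    linarith
  · have h1 : g (T.v₁ * T.ρ ^ h) ≤ max (g T.v₁) 1 := by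
      refine (hg_mono (by simp; positivity) hv.le ?_).trans (le_max_left _ _)
      exact mul_le_of_le_one_right hv.le (pow_le_one₀ T.ρ_pos.le T.ρ_lt_one.le)
    have h2 : 1 ≤ (T.v₁ / δk * T.ρ ^ h) ^ α := by
      refine Real.one_le_rpow ?_ hα.le
      rw [div_mul_eq_mul_div, one_le_div hδk]
      exact hgt.le
    have h3 := le_mul_of_one_le_right hG.le h2
    have h4 : 0 ≤ Ck * (T.v₁ * T.ρ ^ h) ^ α := by positivity
    linarith

lemma betaParam_sq {α δ : ℝ} (hα : 0 < α) (hδ : 0 < δ) (hδ1 : δ < 1) {n : ℕ} (hn : 0 < n) :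
    betaParam T α δ n ^ 2 = 2 * (Real.log 2 + (1 + 2 * depthRate T α) * Real.log n) +
      2 * Real.log (1 / δ) ∧ 0 < betaParam T α δ n := by
  have hn' : (1 : ℝ) ≤ n := by exact_mod_cast hn
  have hlog : 0 ≤ Real.log n := Real.log_nonneg hn'
  have hc := depthRate_pos T hα
  have hd : 0 < Real.log (1 / δ) := Real.log_pos (by rw [lt_div_iff₀ hδ]; linarith)
  have h2 : 0 < Real.log 2 := Real.log_pos one_lt_two
  have he : 2 / (2 * α * Real.log (1 / rhoBar T)) = 2 * depthRate T α := by
    rw [depthRate]; ring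
  have e : 2 * Real.log (2 * (n : ℝ) ^ (1 + 2 / (2 * α * Real.log (1 / rhoBar T)))) +
      2 * Real.log (1 / δ) = 2 * (Real.log 2 + (1 + 2 * depthRate T α) * Real.log n) +
      2 * Real.log (1 / δ) := by
    rw [he, Real.log_mul two_ne_zero (by positivity), Real.log_rpow (by linarith)]
  rw [betaParam, e]
  exact ⟨Real.sq_sqrt (by positivity), Real.sqrt_pos.2 (by positivity)⟩

lemma failure_probability_le {α δ : ℝ} (hα : 0 < α) (hδ : 0 < δ) (hδ1 : δ < 1) {n H : ℕ}
    (hn : 0 < n) (hdepth : 2 ≤ maxDepth T α n) (hH : (H : ℝ) ≤ maxDepth T α n) :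
    (n : ℝ) * 2 ^ (H + 2) * (2 * Real.exp (-betaParam T α δ n ^ 2 / 2)) ≤ δ := by
  have hn' : (1 : ℝ) ≤ n := by exact_mod_cast hn
  have hn0 : (0 : ℝ) < n := by linarith
  have hl2 : Real.log 2 ≤ 1 := by linarith [Real.log_two_lt_d9]
  have hl20 : 0 < Real.log 2 := Real.log_pos one_lt_two
  rw [maxDepth_eq] at hdepth hH
  have e1 : (n : ℝ) = Real.exp (Real.log n) := (Real.exp_log hn0).symm
  have e2 : (2 : ℝ) ^ (H + 2) = Real.exp ((H + 2) * Real.log 2) := by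
    rw [← Real.exp_log (pow_pos two_pos (H + 2)), Real.log_pow]
    push_cast
    rfl
  have e3 : 2 * Real.exp (-betaParam T α δ n ^ 2 / 2) =
      Real.exp (-(1 + 2 * depthRate T α) * Real.log n + Real.log δ) := by
    nth_rewrite 1 [← Real.exp_log two_pos]
    rw [← Real.exp_add, (betaParam_sq T hα hδ hδ1 hn).1, one_div, Real.log_inv]
    congr 1
    ring
  rw [e3, e2]
  nth_rewrite 1 [e1]
  rw [← Real.exp_add, ← Real.exp_add]
  refine (Real.exp_le_exp.2 ?_).trans_eq (Real.exp_log hδ)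
  have h1 : (H + 2 : ℝ) * Real.log 2 ≤ (H + 2) * 1 :=
    mul_le_mul_of_nonneg_left hl2 (by positivity)
  nlinarith

end Growth

/-! ### Bounds of the loss -/

section LossBounds

variable {X : Type*} [MetricSpace X]

/-- What the prescribed parameters satisfy for a large budget: the depth `H`, the ratio `Γ` and the
multiplier `β` grow at most like powers of `log n`, and the half-widths decay like `ρ ^ (α h)`, up
to a logarithm. -/
structure GrowthBounds (A : Inputs X) (α K : ℝ) (H : ℕ) (Γ : ℝ) : Prop where
  one_le_log : 1 ≤ Real.log A.n
  hmax : ∀ h : ℕ, (h : ℝ) ≤ A.hmax ↔ h ≤ H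
  one_le : 1 ≤ Γ
  ratio_le : Γ ^ 2 ≤ K * Real.log A.n
  β_pos : 0 < A.β
  β_le : A.β ≤ K * Real.log A.n
  depth_le : (H : ℝ) + 1 ≤ K * Real.log A.n
  V_nonneg : ∀ h, 0 ≤ A.V h
  V_le : ∀ h h', h ≤ h' → h' ≤ H + 1 → A.V h' ≤ Γ * A.V h
  V_le_rpow : ∀ h ≤ H + 1, A.V h ≤ K * Real.log A.n * A.tree.ρ ^ (α * h)
  V_deep_le : ∀ h, H ≤ h → h ≤ H + 1 → A.V h ≤ K * Real.log A.n / √A.n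
  V_last_le : A.V (H + 1) ≤ A.τ / 2

variable {A : Inputs X} {F : X → ℝ} {H : ℕ} {Γ α K : ℝ} {s : State X}

lemma GrowthBounds.n_pos (hA : GrowthBounds A α K H Γ) : 0 < A.n := by
  rcases Nat.eq_zero_or_pos A.n with h | h
  · have := hA.one_le_log
    rw [h, Nat.cast_zero, Real.log_zero] at this
    linarith
  · exact h

lemma GrowthBounds.K_pos (hA : GrowthBounds A α K H Γ) : 0 < K := by
  by_contra h
  have h1 := hA.one_le_log
  have h2 := hA.β_le
  have h3 := hA.β_pos
  nlinarith

lemma GrowthBounds.ratio_le' (hA : GrowthBounds A α K H Γ) : Γ ≤ K * Real.log A.n := by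
  have h1 := hA.one_le
  have h2 := hA.ratio_le
  nlinarith

/-- Bound of the loss by the sum of the posterior variances. -/
lemma Invariant.loss_le_sqrt (hA : GrowthBounds A α K H Γ) (hs : Invariant A F H Γ s)
    (hhalt : s.Halted A) (hτ : 0 < A.τ) (hpv : ∀ m p x, 0 ≤ postVar A.k A.σ m p x)
    (hcell : ∀ v ∈ treeNodes H, ∀ x ∈ A.tree.cell v, |F x - F (A.tree.center v)| ≤ A.V v.1) :
    levelSetLoss F A.τ s.inSet ≤ ENNReal.ofReal
      (24 * K * (1 + K / A.τ) * Real.log A.n ^ 4 * A.β * √(sumPostVar A s / A.n)) := by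
  refine hs.loss_le hcell fun w hw => ?_
  have hn : s.numEvals = A.n := hhalt.resolve_right (Finset.ne_empty_of_mem hw)
  have hn0 : 0 < s.numEvals := hn ▸ hA.n_pos
  have hK := hA.K_pos
  have hℓ := hA.one_le_log
  have hn' : (0 : ℝ) < A.n := by exact_mod_cast hA.n_pos
  have h1 := hs.index_le_sqrt hA.one_le hA.V_nonneg hpv hA.β_pos.le hn0 hw
  have h2 := hs.tau_le (fun h h1 h2 => by
    obtain rfl : h = H + 1 := by omega
    exact hA.V_last_le) hpv hA.β_pos.le hn0
  rw [hn] at h1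
  set S := A.β * √(sumPostVar A s / A.n) with hS
  have hsq : A.β * √(sumPostVar A s) = S * √A.n := by
    rw [hS, Real.sqrt_div' _ hn'.le, mul_assoc, div_mul_cancel₀ _ (Real.sqrt_pos.2 hn').ne']
  have hS0 : 0 ≤ S := mul_nonneg hA.β_pos.le (Real.sqrt_nonneg _)
  have hV := hA.V_deep_le (H + 1) (by omega) le_rfl
  set ℓ := Real.log A.n
  have hsn : 0 < √(A.n : ℝ) := Real.sqrt_pos.2 hn'
  have h3 : A.V (H + 1) ≤ K * ℓ * (2 * S / A.τ) := by
    refine hV.trans ?_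
    rw [div_eq_mul_one_div (K * ℓ)]
    refine mul_le_mul_of_nonneg_left ?_ (by positivity)
    rw [div_le_div_iff₀ hsn hτ]
    rw [hsq] at h2
    linarith
  have hV0 := hA.V_nonneg (H + 1)
  have hΓ0 : 0 ≤ Γ := by linarith [hA.one_le]
  have h4 : S ≤ ℓ * S := le_mul_of_one_le_left hS0 hℓ
  calc s.index A w ≤ 6 * Γ * (4 * S + 2 * A.V (H + 1)) := h1
    _ ≤ 6 * (K * ℓ) * (4 * (ℓ * S) + 2 * (K * ℓ * (2 * S / A.τ))) := by
        have := hA.ratio_le'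
        gcongr
    _ = 24 * K * (1 + K / A.τ) * S * ℓ ^ 2 := by
        field_simp
        ring
    _ ≤ 24 * K * (1 + K / A.τ) * S * ℓ ^ 4 :=
        mul_le_mul_of_nonneg_left (pow_le_pow_right₀ hℓ (by norm_num)) (by positivity)
    _ = _ := by rw [hS]; ring

/-- A quantity `Λ` that is visible at a scale `R` with `Λ ≲ R ^ α`, while `n` evaluations there only
cover `R ^ (-a)` places with `Λ ^ (-2)` evaluations each, obeys the rate with exponent
`α / (a + 2 α)`. -/
lemma le_rate_of_scale {Λ W C a α n R : ℝ} (hW : 1 ≤ W) (hC : 0 ≤ C) (ha : 0 < a)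
    (hα : 0 < α) (hR : 0 < R) (hn : 0 < n) (h1 : Λ ≤ W * R ^ α)
    (h2 : n * Λ ^ 2 ≤ (1 + C) * W * R ^ (-a)) :
    Λ ≤ (1 + C) * W * n ^ (-(α / (a + 2 * α))) := by
  by_contra hlt
  push Not at hlt
  set N := n ^ (-(α / (a + 2 * α))) with hN
  have hN0 : 0 < N := Real.rpow_pos_of_pos hn _
  have hCW : 1 ≤ (1 + C) * W := by nlinarith
  have h3 : N ≤ R ^ α := by
    have h4 : W * ((1 + C) * N) < W * R ^ α := by linarith
    have h5 := lt_of_mul_lt_mul_left h4 (by linarith)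
    nlinarith
  have h4 : N ^ (a / α) ≤ R ^ a := by
    have := Real.rpow_le_rpow hN0.le h3 (div_pos ha hα).le
    rwa [← Real.rpow_mul hR.le, mul_div_cancel₀ _ hα.ne'] at this
  have h5 : n * N ^ 2 * N ^ (a / α) = 1 := by
    rw [hN, ← Real.rpow_natCast, ← Real.rpow_mul hn.le, ← Real.rpow_mul hn.le]
    nth_rewrite 1 [← Real.rpow_one n]
    rw [← Real.rpow_add hn, ← Real.rpow_add hn]
    convert Real.rpow_zero n using 2
    push_cast
    field_simp
    ring
  have hRa : 0 < R ^ a := Real.rpow_pos_of_pos hR _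
  rw [Real.rpow_neg hR.le, ← div_eq_mul_inv, le_div_iff₀ hRa] at h2
  have h6 : ((1 + C) * W * N) ^ 2 < Λ ^ 2 :=
    pow_lt_pow_left₀ hlt (by positivity) two_ne_zero
  have h7 : n * ((1 + C) * W * N) ^ 2 * N ^ (a / α) < n * Λ ^ 2 * R ^ a := by
    have hNa : 0 < N ^ (a / α) := Real.rpow_pos_of_pos hN0 _
    refine mul_lt_mul (mul_lt_mul_of_pos_left h6 hn) h4 hNa ?_
    have := sq_nonneg Λ
    positivity
  have h8 : n * ((1 + C) * W * N) ^ 2 * N ^ (a / α) =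
      ((1 + C) * W) ^ 2 * (n * N ^ 2 * N ^ (a / α)) := by ring
  rw [h8, h5, mul_one] at h7
  nlinarith

/-- The constant in the dimension type bound: the three summands after `1` serve an evaluation at the
largest depth, the first inequality of `Invariant.exists_scale`, and the second one. -/
noncomputable def rateConstant (A : Inputs X) (α K M : ℝ) : ℝ :=
  1 + 36 * K ^ 2 + 36 * K * (K * √M + K / A.tree.v₂ ^ α) + 1152 * K ^ 4 * (M + A.σ ^ 2)

/-- Bound of the loss by the packing numbers of the near-threshold regions. -/
lemma Invariant.loss_le_rate (hA : GrowthBounds A α K H Γ) (hs : Invariant A F H Γ s)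
    (hhalt : s.Halted A) (hk : IsCovarianceFunction A.k) (hσ : 0 < A.σ) (hα : 0 < α)
    (hpv : ∀ m p x, 0 ≤ postVar A.k A.σ m p x) {M : ℝ} (hM0 : 0 ≤ M) (hM : ∀ x, A.k x x ≤ M)
    (hcell : ∀ v ∈ treeNodes H, ∀ x ∈ A.tree.cell v, |F x - F (A.tree.center v)| ≤ A.V v.1)
    {a C : ℝ} (ha : 0 < a) (hC : 0 ≤ C) (hpack : HasPackingBound (nearThreshold A F) a C) :
    levelSetLoss F A.τ s.inSet ≤ ENNReal.ofReal
      (rateConstant A α K M * (1 + C) * Real.log A.n ^ 4 *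
        (A.n : ℝ) ^ (-(α / (a + 2 * α)))) := by
  refine hs.loss_le hcell fun w hw => ?_
  have hn : s.numEvals = A.n := hhalt.resolve_right (Finset.ne_empty_of_mem hw)
  have hn0 : 0 < s.numEvals := hn ▸ hA.n_pos
  have hK := hA.K_pos
  have hℓ := hA.one_le_log
  have hn' : (0 : ℝ) < A.n := by exact_mod_cast hA.n_pos
  have hn1 : (1 : ℝ) ≤ A.n := by exact_mod_cast hA.n_pos
  have hv₂ : 0 < A.tree.v₂ ^ α := Real.rpow_pos_of_pos A.tree.v₂_pos _
  have hv₂' := A.tree.v₂_pos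
  set K₁ := rateConstant A α K M with hK₁
  have hK₁1 : 1 ≤ K₁ := by
    rw [hK₁, rateConstant]
    have : 0 ≤ 36 * K ^ 2 + 36 * K * (K * √M + K / A.tree.v₂ ^ α) +
      1152 * K ^ 4 * (M + A.σ ^ 2) := by positivity
    linarith
  have hΓ0 : 0 < Γ := by linarith [hA.one_le]
  set ℓ := Real.log A.n with hℓdef
  have hℓ0 : 0 < ℓ := by linarith
  have hW1 : 1 ≤ K₁ * ℓ ^ 4 := by
    have := one_le_pow₀ (n := 4) hℓ
    nlinarith
  rw [show K₁ * (1 + C) * ℓ ^ 4 = (1 + C) * (K₁ * ℓ ^ 4) by ring]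
  set Λ := s.index A w with hΛ
  rcases le_or_gt Λ 0 with hneg | hpos
  · refine hneg.trans ?_
    positivity
  by_cases hdeep : ∀ j < s.numEvals, (s.node j).1 ≤ H
  · set B := (K * √M + K / A.tree.v₂ ^ α) * ℓ with hB
    have hB1 : A.β * √M ≤ B := by
      have h1 := mul_le_mul_of_nonneg_right hA.β_le (Real.sqrt_nonneg M)
      have h2 : 0 ≤ K / A.tree.v₂ ^ α * ℓ := by positivity
      rw [hB, add_mul]
      linarith
    have hB0 : 0 ≤ B := by positivity
    have hVB : ∀ h ≤ H, A.V h ≤ B * (A.tree.v₂ * A.tree.ρ ^ h) ^ α := by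
      intro h hh
      have hρ := pow_pos A.tree.ρ_pos h
      refine (hA.V_le_rpow h (by omega)).trans ?_
      have e : (A.tree.v₂ * A.tree.ρ ^ h) ^ α = A.tree.v₂ ^ α * A.tree.ρ ^ (α * h) := by
        rw [Real.mul_rpow hv₂'.le hρ.le, ← Real.rpow_natCast,
          ← Real.rpow_mul A.tree.ρ_pos.le, mul_comm α]
      have hρα : 0 < A.tree.ρ ^ (α * h) := Real.rpow_pos_of_pos A.tree.ρ_pos _
      rw [e, hB, ← mul_assoc]
      refine mul_le_mul_of_nonneg_right ?_ hρα.le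
      have e2 : (K * √M + K / A.tree.v₂ ^ α) * ℓ * A.tree.v₂ ^ α =
          K * √M * ℓ * A.tree.v₂ ^ α + K * ℓ := by
        field_simp
      rw [e2]
      have : 0 ≤ K * √M * ℓ * A.tree.v₂ ^ α := by positivity
      linarith
    obtain ⟨R, hR, -, hR1, hR2⟩ := hs.exists_scale hA.one_le hA.V_nonneg hA.V_le hk hσ hpv hM
      hA.β_pos hn0 hw hpos ha hC hpack hB1 hVB hdeep
    rw [← hΛ] at hR1 hR2
    rw [hn] at hR2
    refine le_rate_of_scale hW1 hC ha hα hR hn' (hR1.trans ?_) ?_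
    · refine mul_le_mul_of_nonneg_right ?_ (Real.rpow_nonneg hR.le _)
      calc 36 * Γ ^ 2 * B ≤ 36 * (K * ℓ) * B := by
            have := hA.ratio_le
            gcongr
        _ = 36 * K * (K * √M + K / A.tree.v₂ ^ α) * ℓ ^ 2 := by rw [hB]; ring
        _ ≤ 36 * K * (K * √M + K / A.tree.v₂ ^ α) * ℓ ^ 4 :=
            mul_le_mul_of_nonneg_left (pow_le_pow_right₀ hℓ (by norm_num)) (by positivity)
        _ ≤ K₁ * ℓ ^ 4 := by
            refine mul_le_mul_of_nonneg_right ?_ (by positivity)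
            rw [hK₁, rateConstant]
            have h1 : 0 ≤ 36 * K ^ 2 := by positivity
            have h2 : 0 ≤ 1152 * K ^ 4 * (M + A.σ ^ 2) := by positivity
            linarith
    · have hRa : 0 < R ^ (-a) := Real.rpow_pos_of_pos hR _
      have hβ := hA.β_pos
      rw [show (M + A.σ ^ 2) / (Λ / (24 * Γ * A.β)) ^ 2 =
        (M + A.σ ^ 2) * (24 * Γ * A.β) ^ 2 / Λ ^ 2 by field_simp, ← mul_div_assoc,
        le_div_iff₀ (by positivity), ← mul_assoc] at hR2
      refine hR2.trans ?_
      have hMσ : 0 ≤ M + A.σ ^ 2 := by positivity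
      have e1 : ((H : ℝ) + 1) * Γ ^ 2 * A.β ^ 2 ≤ (K * ℓ) * (K * ℓ) * (K * ℓ) ^ 2 := by
        have h1 := hA.depth_le
        have h2 := hA.ratio_le
        have h3 := hA.β_le
        gcongr
      have e2 : 1 + 2 * C ≤ 2 * (1 + C) := by linarith
      calc ((H : ℝ) + 1) * ((1 + 2 * C) * R ^ (-a)) * (M + A.σ ^ 2) * (24 * Γ * A.β) ^ 2
          = 576 * (M + A.σ ^ 2) * (1 + 2 * C) * (((H : ℝ) + 1) * Γ ^ 2 * A.β ^ 2) * R ^ (-a) := by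
            ring
        _ ≤ 576 * (M + A.σ ^ 2) * (2 * (1 + C)) * ((K * ℓ) * (K * ℓ) * (K * ℓ) ^ 2) * R ^ (-a) := by
            gcongr
        _ = (1 + C) * (1152 * K ^ 4 * (M + A.σ ^ 2) * ℓ ^ 4) * R ^ (-a) := by ring
        _ ≤ (1 + C) * (K₁ * ℓ ^ 4) * R ^ (-a) := by
            refine mul_le_mul_of_nonneg_right (mul_le_mul_of_nonneg_left
              (mul_le_mul_of_nonneg_right ?_ (by positivity)) (by linarith)) hRa.le
            rw [hK₁, rateConstant]
            have : 0 ≤ 36 * K ^ 2 + 36 * K * (K * √M + K / A.tree.v₂ ^ α) := by positivity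
            linarith
  · -- an evaluation at the largest depth certifies the rate `n ^ (-1/2)`
    push Not at hdeep
    obtain ⟨j, hj, hjH⟩ := hdeep
    have h1 := hs.index_le_of_deep hA.one_le hw hj hjH
    have hV1 := hA.V_deep_le H le_rfl (by omega)
    have hV2 := hA.V_deep_le (H + 1) (by omega) le_rfl
    rw [← hℓdef] at hV1 hV2
    have hrate : 1 / √(A.n : ℝ) ≤ (A.n : ℝ) ^ (-(α / (a + 2 * α))) := by
      rw [one_div, Real.sqrt_eq_rpow, ← Real.rpow_neg hn'.le]
      refine Real.rpow_le_rpow_of_exponent_le hn1 (neg_le_neg ?_)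
      rw [div_le_div_iff₀ (by linarith) two_pos]
      linarith
    have hsn : 0 < √(A.n : ℝ) := Real.sqrt_pos.2 hn'
    calc Λ ≤ 6 * Γ * (4 * A.V H + 2 * A.V (H + 1)) := h1
      _ ≤ 6 * (K * ℓ) * (4 * (K * ℓ / √A.n) + 2 * (K * ℓ / √A.n)) := by
          have h2 := hA.ratio_le'
          have h3 := hA.V_nonneg H
          have h4 := hA.V_nonneg (H + 1)
          gcongr
      _ = 36 * K ^ 2 * ℓ ^ 2 * (1 / √A.n) := by ring
      _ ≤ 36 * K ^ 2 * ℓ ^ 4 * (1 / √A.n) :=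
          mul_le_mul_of_nonneg_right (mul_le_mul_of_nonneg_left
            (pow_le_pow_right₀ hℓ (by norm_num)) (by positivity)) (by positivity)
      _ ≤ (1 + C) * (K₁ * ℓ ^ 4) * (1 / √A.n) := by
          refine mul_le_mul_of_nonneg_right ?_ (by positivity)
          have h2 : 36 * K ^ 2 ≤ K₁ := by
            rw [hK₁, rateConstant]
            have : 0 ≤ 36 * K * (K * √M + K / A.tree.v₂ ^ α) +
              1152 * K ^ 4 * (M + A.σ ^ 2) := by positivity
            linarith
          have h3 := mul_le_mul_of_nonneg_right h2 (pow_pos hℓ0 4).le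
          have h4 : K₁ * ℓ ^ 4 ≤ (1 + C) * (K₁ * ℓ ^ 4) :=
            le_mul_of_one_le_left (by linarith) (by linarith)
          linarith
      _ ≤ _ := mul_le_mul_of_nonneg_left hrate (by positivity)

end LossBounds

/-! ### The prescribed parameters -/

section Prescribed

variable {X : Type*} [MetricSpace X] (T : PartitionTree X)

lemma eventually_growth {c κ : ℝ} (hc : 0 < c) (hκ : 0 < κ) :
    ∃ N : ℕ, ∀ n : ℕ, N ≤ n →
      1 ≤ Real.log n ∧ 2 ≤ c * Real.log n ∧ Real.log n / √n ≤ κ := by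
  have hlog : Filter.Tendsto (fun n : ℕ => Real.log n) Filter.atTop Filter.atTop :=
    Real.tendsto_log_atTop.comp tendsto_natCast_atTop_atTop
  have h1 := hlog.eventually_ge_atTop 1
  have h2 := (hlog.const_mul_atTop hc).eventually_ge_atTop 2
  have h3 : Filter.Tendsto (fun n : ℕ => Real.log n / √n) Filter.atTop (nhds 0) := by
    have := (isLittleO_log_rpow_atTop (by norm_num : (0 : ℝ) < 1 / 2)).tendsto_div_nhds_zero
    have h := this.comp tendsto_natCast_atTop_atTop
    simpa only [Function.comp_def, ← Real.sqrt_eq_rpow] using h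
  obtain ⟨N, hN⟩ := Filter.eventually_atTop.1 ((h1.and h2).and (h3.eventually_le_const hκ))
  exact ⟨N, fun n hn => ⟨(hN n hn).1.1, (hN n hn).1.2, (hN n hn).2⟩⟩

set_option maxHeartbeats 800000 in
/-- For a large budget the prescribed parameters satisfy the growth conditions, with constants that
do not depend on the budget. -/
lemma exists_growthBounds (k : X → X → ℝ) {g : ℝ → ℝ} (hg_mono : MonotoneOn g (Set.Ici 0))
    (hg_zero : g 0 = 0) {α δk Ck : ℝ} (hα : 0 < α) (hδk : 0 < δk) (hCk : 0 < Ck)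
    (hg_le : ∀ r : ℝ, 0 ≤ r → r ≤ δk → g r ≤ Ck * r ^ α) {C₂ C₃ : ℝ} (hC₃ : 0 ≤ C₃)
    (hC₂ : ∀ h : ℕ, 0 < g (T.v₁ * T.ρ ^ h) →
      0 ≤ C₂ + 4 * (metricDim X / α) * Real.log (1 / g (T.v₁ * T.ρ ^ h)))
    (σ : ℝ) {τ δ : ℝ} (hτ : 0 < τ) (hδ : 0 < δ) (hδ1 : δ < 1) :
    ∃ (K : ℝ) (N : ℕ), ∀ n : ℕ, N ≤ n → 2 ≤ maxDepth T α n ∧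
      (∀ h, 0 ≤ Real.log (1 / deltaParam T α δ n h)) ∧
      ∃ (H : ℕ) (Γ : ℝ), (H : ℝ) ≤ maxDepth T α n ∧
        GrowthBounds (inputs T k g α C₂ C₃ σ τ δ n) α K H Γ := by
  have hv : 0 < T.v₁ := by linarith [T.one_le_v₁]
  have hc := depthRate_pos T hα
  have hD : 0 ≤ metricDim X / α := by
    rw [metricDim_eq T]
    exact (div_pos (treeDim_pos T) hα).le
  obtain ⟨cg, hcg, hcg'⟩ := exists_modulus_le T hg_mono hα hδk hCk hg_le
  have hdlt : 0 < Real.log (1 / δ) := Real.log_pos (by rw [lt_div_iff₀ hδ]; linarith)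
  have hb := log_inv_rho_pos T
  have hl2 : Real.log 2 ≤ 1 := by linarith [Real.log_two_lt_d9]
  have hl2' : 1 ≤ 2 * Real.log 2 := by linarith [Real.log_two_gt_d9]
  set c := depthRate T α with hcdef
  set D := metricDim X / α
  set d := Real.log (1 / δ)
  set KL := 2 * c + 1 + d with hKL
  have hKL0 : 0 < KL := by positivity
  set KU := |Real.log cg| + α * Real.log (1 / T.ρ) * (c + 1) with hKU
  have hKU0 : 0 ≤ KU := by positivity
  set KV := cg * (1 + |C₂| + 2 * KL + 4 * D * KU + 2 * D + C₃) with hKV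
  have hKV0 : 0 < KV := by positivity
  set K₁ := 1 + 2 * KL + 2 * D with hK₁
  set K₂ := 5 + 4 * c + 2 * d with hK₂
  have hρα : 0 < T.ρ ^ (-α) := Real.rpow_pos_of_pos T.ρ_pos _
  set K := K₁ + K₂ + KV + KV * T.ρ ^ (-α) with hK
  have hKVρ : 0 < KV * T.ρ ^ (-α) := mul_pos hKV0 hρα
  have hK₁0 : 0 < K₁ := by positivity
  have hK₂0 : 0 < K₂ := by positivity
  have hK0 : 0 < K := by positivity
  obtain ⟨N, hN⟩ := eventually_growth hc (κ := τ / 2 / K) (by positivity)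
  refine ⟨K, N, fun n hn => ?_⟩
  obtain ⟨h1, h2, h3⟩ := hN n hn
  have hmd : maxDepth T α n = c * Real.log n := maxDepth_eq T α n
  set ℓ := Real.log n with hℓ
  have hn0 : 0 < n := by
    rcases Nat.eq_zero_or_pos n with h | h
    · rw [hℓ, h, Nat.cast_zero, Real.log_zero] at h1
      linarith
    · exact h
  have hℓ0 : 0 < ℓ := by linarith
  have hmd0 : 0 < maxDepth T α n := by rw [hmd]; linarith
  have hLlog := log_inv_deltaParam T (α := α) hδ hmd0
  set L := fun h => Real.log (1 / deltaParam T α δ n h) with hL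
  change ∀ h : ℕ, L h = _ at hLlog
  rw [hmd] at hLlog ⊢
  have hlogmd : Real.log 2 ≤ Real.log (c * ℓ) := Real.log_le_log two_pos h2
  have hL1 : ∀ h, 1 ≤ 2 * L h := fun h => by
    rw [hLlog]
    have : (0 : ℝ) ≤ h * Real.log 2 := mul_nonneg (Nat.cast_nonneg h) (by linarith)
    linarith
  have hL0 : ∀ h, 0 ≤ L h := fun h => by linarith [hL1 h]
  set H := ⌊c * ℓ⌋₊ with hH
  have hHle : (H : ℝ) ≤ c * ℓ := Nat.floor_le (by linarith)
  have hHlt : c * ℓ < H + 1 := Nat.lt_floor_add_one _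
  have hLmono : ∀ h h', h ≤ h' → L h ≤ L h' := fun h h' hh => by
    have hcast : (h : ℝ) ≤ h' := by exact_mod_cast hh
    rw [hLlog, hLlog]
    have := mul_le_mul_of_nonneg_right hcast (by linarith : 0 ≤ Real.log 2)
    linarith
  have hLle : L (H + 1) ≤ KL * ℓ := by
    rw [hLlog]
    push_cast
    have e1 : Real.log (c * ℓ) ≤ c * ℓ :=
      (Real.log_le_sub_one_of_pos (by linarith)).trans (by linarith)
    have e2 : ((H : ℝ) + 1) * Real.log 2 ≤ (H + 1) * 1 :=
      mul_le_mul_of_nonneg_left hl2 (by positivity)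
    have e3 : d ≤ d * ℓ := le_mul_of_one_le_right hdlt.le h1
    rw [hKL]
    linarith
  have hs0 : ∀ h : ℕ, 0 ≤ g (T.v₁ * T.ρ ^ h) := fun h => by
    rw [← hg_zero]
    have := T.ρ_pos
    exact hg_mono self_mem_Ici (by simp; positivity) (by positivity)
  set V := varParam T g α C₂ C₃ δ n with hV
  have hVeq : ∀ h, V h = g (T.v₁ * T.ρ ^ h) * (√(C₂ + 2 * L h + 4 * D *
    Real.log (1 / g (T.v₁ * T.ρ ^ h))) + C₃) := fun h => rfl
  have hVnn : ∀ h, 0 ≤ V h := fun h => by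
    rw [hVeq]
    exact mul_nonneg (hs0 h) (add_nonneg (Real.sqrt_nonneg _) hC₃)
  have hVρ : ∀ h ≤ H + 1, V h ≤ KV * ℓ * T.ρ ^ (α * h) := by
    intro h hh
    have hρh : 0 < T.ρ ^ (α * h) := Real.rpow_pos_of_pos T.ρ_pos _
    have hcast : (h : ℝ) ≤ H + 1 := by exact_mod_cast hh
    have hU : Real.log (1 / (cg * T.ρ ^ (α * h))) ≤ KU * ℓ := by
      have e1 : Real.log (1 / (cg * T.ρ ^ (α * h))) =
          -Real.log cg + h * (α * Real.log (1 / T.ρ)) := by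
        rw [one_div, Real.log_inv, Real.log_mul hcg.ne' hρh.ne', Real.log_rpow T.ρ_pos, one_div,
          Real.log_inv]
        ring
      have e2 : (h : ℝ) ≤ (c + 1) * ℓ := by linarith
      have e3 := mul_le_mul_of_nonneg_right e2 (mul_pos hα hb).le
      have e4 : |Real.log cg| ≤ |Real.log cg| * ℓ := le_mul_of_one_le_right (abs_nonneg _) h1
      rw [e1, hKU]
      linarith [neg_abs_le (Real.log cg)]
    rw [hVeq]
    refine (band_le (hs0 h) (hcg' h) hC₃ hD (hL0 h) (by positivity) hU).trans ?_
    have e1 : 1 + |C₂| + 2 * L h + 4 * D * (KU * ℓ) + 2 * D + C₃ ≤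
        (1 + |C₂| + 2 * KL + 4 * D * KU + 2 * D + C₃) * ℓ := by
      have e2 := (hLmono h (H + 1) hh).trans hLle
      have e3 := le_mul_of_one_le_right (by positivity : 0 ≤ 1 + |C₂| + 2 * D + C₃) h1
      linarith
    have e4 := mul_le_mul_of_nonneg_left e1 (mul_pos hcg hρh).le
    rw [hKV]
    linarith
  have hρlast : T.ρ ^ (α * ((H + 1 : ℕ) : ℝ)) ≤ 1 / √n :=
    rho_rpow_le T hα hn0 (by rw [hmd]; push_cast; exact hHlt.le)
  have hKℓ : ∀ {a : ℝ}, a ≤ K → a * ℓ ≤ K * ℓ := fun h => mul_le_mul_of_nonneg_right h hℓ0.le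
  have hsn : 0 < √(n : ℝ) := Real.sqrt_pos.2 (by exact_mod_cast hn0)
  have hVdeep : ∀ h, H ≤ h → h ≤ H + 1 → V h ≤ K * ℓ / √n := by
    intro h hh hh'
    refine (hVρ h hh').trans ?_
    rw [div_eq_mul_one_div]
    rcases Nat.lt_or_ge H h with hlt | hge
    · obtain rfl : h = H + 1 := by omega
      exact mul_le_mul (hKℓ (by linarith)) hρlast (Real.rpow_nonneg T.ρ_pos.le _) (by positivity)
    · obtain rfl : h = H := by omega
      have e : T.ρ ^ (α * (H : ℝ)) = T.ρ ^ (-α) * T.ρ ^ (α * ((H + 1 : ℕ) : ℝ)) := by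
        rw [← Real.rpow_add T.ρ_pos]
        congr 1
        push_cast
        ring
      rw [e, ← mul_assoc]
      refine mul_le_mul ?_ hρlast (Real.rpow_nonneg T.ρ_pos.le _) (by positivity)
      have := hKℓ (a := KV * T.ρ ^ (-α)) (by linarith)
      linarith
  obtain ⟨hβsq, hβ0⟩ := betaParam_sq T hα hδ hδ1 hn0
  refine ⟨h2, hL0, H, √(1 + 2 * L (H + 1) + 2 * D), hHle, ?_⟩
  refine ⟨h1, fun h => ?_, Real.one_le_sqrt.2 (by linarith [hL0 (H + 1)]), ?_, hβ0, ?_, ?_, hVnn,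
    ?_, ?_, hVdeep, ?_⟩
  · change (h : ℝ) ≤ maxDepth T α n ↔ h ≤ H
    rw [hmd, hH, Nat.le_floor_iff (by linarith)]
  · rw [Real.sq_sqrt (by linarith [hL0 (H + 1)])]
    refine le_trans ?_ (hKℓ (a := K₁) (by linarith))
    rw [hK₁]
    have := le_mul_of_one_le_right (by positivity : 0 ≤ 1 + 2 * D) h1
    linarith
  · refine le_trans ?_ (hKℓ (a := K₂) (by linarith))
    change betaParam T α δ n ≤ _
    have e1 : betaParam T α δ n ≤ 1 + betaParam T α δ n ^ 2 := by
      nlinarith [sq_nonneg (betaParam T α δ n - 1)]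
    have e2 := le_mul_of_one_le_right (by positivity : 0 ≤ 3 + 2 * d) h1
    rw [hβsq] at e1
    rw [hK₂]
    linarith
  · refine le_trans ?_ (hKℓ (a := K₂) (by linarith))
    have e1 : 0 ≤ (4 + 3 * c + 2 * d) * ℓ := by positivity
    rw [hK₂]
    linarith
  · intro h h' hh hh'
    change V h' ≤ _ * V h
    rw [hVeq, hVeq]
    have hmono : g (T.v₁ * T.ρ ^ h') ≤ g (T.v₁ * T.ρ ^ h) := by
      have := T.ρ_pos
      refine hg_mono (by simp; positivity) (by simp; positivity) ?_
      exact mul_le_mul_of_nonneg_left (pow_le_pow_of_le_one T.ρ_pos.le T.ρ_lt_one.le hh) hv.le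
    refine (band_le_mul_band (hs0 h') hmono hC₃ hD (hC₂ h) (hL1 h) (hL1 h')).trans ?_
    refine mul_le_mul_of_nonneg_right (Real.sqrt_le_sqrt ?_) ?_
    · linarith [hLmono h' (H + 1) hh']
    · rw [← hVeq]
      exact hVnn h
  · intro h hh
    exact (hVρ h hh).trans (mul_le_mul_of_nonneg_right (hKℓ (by linarith))
      (Real.rpow_nonneg T.ρ_pos.le _))
  · refine (hVdeep (H + 1) (by omega) le_rfl).trans ?_
    rw [le_div_iff₀ hK0] at h3
    rw [mul_div_assoc, mul_comm]
    exact h3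

/-- The event that the path is continuous and its variation over some cell of depth `h ≤ H + 1`, seen
from the center, exceeds `V h`. -/
def cellFailure {Ω : Type*} (A : Inputs X) (f : X → Ω → ℝ) (H : ℕ) : Set Ω :=
  ⋃ h ∈ Finset.range (H + 2), ⋃ i ∈ Finset.range (2 ^ h),
    {ω | (Continuous fun x => f x ω) ∧ ∃ x ∈ A.tree.cell (h, i),
      A.V h < |f x ω - f (A.tree.center (h, i)) ω|}

lemma measure_cellFailure_le {Ω : Type*} [MeasurableSpace Ω] {P : Measure Ω} {A : Inputs X}
    {f : X → Ω → ℝ} {H : ℕ} {e : ℝ}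
    (hP : ∀ h i : ℕ, i < 2 ^ h → P {ω | (Continuous fun x => f x ω) ∧ ∃ x ∈ A.tree.cell (h, i),
      A.V h < |f x ω - f (A.tree.center (h, i)) ω|} ≤ ENNReal.ofReal (e / 2 ^ h)) :
    P (cellFailure A f H) ≤ ENNReal.ofReal ((H + 2) * e) := by
  refine (measure_biUnion_finset_le _ _).trans ?_
  have hlevel : ∀ h ∈ Finset.range (H + 2), P (⋃ i ∈ Finset.range (2 ^ h),
      {ω | (Continuous fun x => f x ω) ∧ ∃ x ∈ A.tree.cell (h, i),
        A.V h < |f x ω - f (A.tree.center (h, i)) ω|}) ≤ ENNReal.ofReal e := by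
    intro h _
    refine (measure_biUnion_finset_le _ _).trans ?_
    refine (Finset.sum_le_card_nsmul _ _ _ fun i hi => hP h i (Finset.mem_range.1 hi)).trans ?_
    rw [Finset.card_range, nsmul_eq_mul, ← ENNReal.ofReal_natCast,
      ← ENNReal.ofReal_mul (Nat.cast_nonneg _)]
    refine ENNReal.ofReal_le_ofReal (le_of_eq ?_)
    push_cast
    field_simp
  refine (Finset.sum_le_card_nsmul _ _ _ hlevel).trans ?_
  rw [Finset.card_range, nsmul_eq_mul, ← ENNReal.ofReal_natCast,
    ← ENNReal.ofReal_mul (Nat.cast_nonneg _)]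
  push_cast
  exact le_rfl

end Prescribed

end GPLevelSet

theorem theorem1 {X : Type u} [MetricSpace X] [CompactSpace X]
    (T : GPLevelSet.PartitionTree X)
    (k : X → X → ℝ) (hk : GPLevelSet.IsCovarianceFunction k)
    (g : ℝ → ℝ) (hg_mono : MonotoneOn g (Set.Ici 0)) (hg_cont : ContinuousOn g (Set.Ici 0))
    (hg_zero : g 0 = 0)
    (hkg : ∀ x y : X, GPLevelSet.canonicalDist k x y ≤ g (dist x y))
    (α δk Ck : ℝ) (hα : 0 < α) (hα_le : α ≤ 1) (hδk : 0 < δk) (hCk : 0 < Ck)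
    (hg_le : ∀ r : ℝ, 0 ≤ r → r ≤ δk → g r ≤ Ck * r ^ α) :
    -- the constants `C₂`, `C₃` of the algorithm, as soon as they are large enough
    ∃ C₂₀ C₃₀ : ℝ, ∀ C₂ C₃ : ℝ, C₂₀ ≤ C₂ → C₃₀ ≤ C₃ →
    ∀ σ τ δ : ℝ, 0 < σ → 0 < τ → 0 < δ → δ < 1 →
    ∃ (K p C₁ : ℝ) (N : ℕ),
    ∀ (Ω : Type v) [MeasurableSpace Ω] (P : Measure Ω) [IsProbabilityMeasure P]
      (f : X → Ω → ℝ) (η : ℕ → Ω → ℝ),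
      GPLevelSet.IsCenteredGP k f P →
      (∀ᵐ ω ∂P, Continuous fun x => f x ω) →
      GPLevelSet.IsNoise σ f η P →
    ∀ sel : ℕ → (ℕ → ℝ) → Finset GPLevelSet.Node → GPLevelSet.Node,
      GPLevelSet.IsTieBreaking sel →
    ∀ n : ℕ, N ≤ n →
    ∃ E : Set Ω, MeasurableSet E ∧ ENNReal.ofReal (1 - 2 * δ) ≤ P E ∧
    ∀ ω ∈ E,
      let A := GPLevelSet.inputs T k g α C₂ C₃ σ τ δ n
      let F : X → ℝ := fun x => f x ω
      let ζ : ℝ → Set X := GPLevelSet.nearThreshold A F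
      -- the algorithm stops, with final state `s`
      ∃ t : ℕ,
        let s := GPLevelSet.run A sel F (fun j => η j ω) t
        s.Halted A ∧
        -- dimension type bound, at every exponent `D̃ + ε`, `ε ≥ 0`, at which the packing bound holds
        (∀ ε C : ℝ, 0 ≤ ε → 0 ≤ C → 0 < GPLevelSet.localDim ζ + ε →
          GPLevelSet.HasPackingBound ζ (GPLevelSet.localDim ζ + ε) C →
          GPLevelSet.levelSetLoss F τ s.inSet ≤ ENNReal.ofReal
            (K * (1 + C) * Real.log n ^ p *
              (n : ℝ) ^ (-(α / (GPLevelSet.localDim ζ + ε + 2 * α))))) ∧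
        -- information type bound
        GPLevelSet.levelSetLoss F τ s.inSet ≤ ENNReal.ofReal
          (K * Real.log n ^ p * A.β * √(GPLevelSet.sumPostVar A s / n)) ∧
        -- bound of `J_n` by the information gain of the evaluated points
        ENNReal.ofReal (GPLevelSet.sumPostVar A s) ≤
          ENNReal.ofReal C₁ * GPLevelSet.infoGain P f η s.numEvals (s.point A) := by
  obtain ⟨C₂₀, C₃₀, hC₃₀, hrad, hvar⟩ := GPLevelSet.exists_thresholds.{v} T hg_mono hg_zero hkg hα
    hδk hCk hg_le
  refine ⟨C₂₀, C₃₀, fun C₂ C₃ hC₂ hC₃ σ τ δ hσ hτ hδ hδ1 => ?_⟩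
  have hC₃0 : 0 ≤ C₃ := hC₃₀.trans hC₃
  obtain ⟨K, N, hK⟩ := GPLevelSet.exists_growthBounds T k hg_mono hg_zero hα hδk hCk hg_le hC₃0
    (hrad C₂ hC₂) σ hτ hδ hδ1
  -- a bound of the prior variances
  set M := 2 * k (T.center (0, 0)) (T.center (0, 0)) + 2 * g T.v₁ ^ 2 with hMdef
  have hM0 : 0 ≤ M := by
    have := hk.self_nonneg (T.center (0, 0))
    positivity
  have hM : ∀ x, k x x ≤ M := by
    intro x
    have hx := Set.mem_univ x
    rw [← T.cover 0] at hx
    simp only [pow_zero, Finset.range_one, Finset.mem_singleton, Set.iUnion_iUnion_eq_left] at hx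
    have hd := (Metric.mem_ball.1 (T.outer 0 0 (by simp) hx)).le
    rw [pow_zero, mul_one] at hd
    exact hk.self_le ((hkg _ _).trans (hg_mono dist_nonneg (dist_nonneg.trans hd) hd))
  -- `rateConstant` reads only the tree and `σ`, so the budget of `A₀` is immaterial
  set A₀ := GPLevelSet.inputs T k g α C₂ C₃ σ τ δ 0
  set K₁ := GPLevelSet.rateConstant A₀ α K M with hK₁
  set K₂ := 24 * K * (1 + K / τ) with hK₂
  refine ⟨max K₁ K₂, (4 : ℕ), 2 * (M + σ ^ 2), N, ?_⟩
  intro Ω _ P _ f η hf hcont hη sel hsel n hn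
  obtain ⟨hdepth, hL0, H, Γ, hHle, hA⟩ := hK n hn
  set A := GPLevelSet.inputs T k g α C₂ C₃ σ τ δ n with hAdef
  have hn0 : 0 < n := hA.n_pos
  have hpv : ∀ m p x, 0 ≤ GPLevelSet.postVar A.k A.σ m p x :=
    fun m p x => GPLevelSet.postVar_nonneg hk hσ hf hη m p x
  set bad := GPLevelSet.posteriorFailure A sel f η H ∪ GPLevelSet.cellFailure A f H ∪
    {ω | ¬ Continuous fun x => f x ω} with hbad
  have hP1 : P (GPLevelSet.posteriorFailure A sel f η H) ≤ ENNReal.ofReal δ :=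
    (GPLevelSet.measure_posteriorFailure_le hk hσ hf hη hsel hA.β_pos.le H).trans
      (ENNReal.ofReal_le_ofReal
        (GPLevelSet.failure_probability_le T hα hδ hδ1 hn0 hdepth hHle))
  have hmd : 0 < GPLevelSet.maxDepth T α n := by linarith
  have hP2 : P (GPLevelSet.cellFailure A f H) ≤ ENNReal.ofReal δ := by
    refine (GPLevelSet.measure_cellFailure_le
      (e := δ / (2 * GPLevelSet.maxDepth T α n)) fun h i hi => ?_).trans ?_
    · refine (hvar C₂ C₃ _ h i hC₂ hC₃ (hL0 h) hi P f hf).trans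
        (ENNReal.ofReal_le_ofReal (le_of_eq ?_))
      have hδh : 0 < GPLevelSet.deltaParam T α δ n h := by
        rw [GPLevelSet.deltaParam]
        positivity
      rw [one_div, Real.log_inv, neg_neg, Real.exp_log hδh, GPLevelSet.deltaParam]
      field_simp
    · refine ENNReal.ofReal_le_ofReal ?_
      rw [← mul_div_assoc, div_le_iff₀ (by positivity)]
      nlinarith
  have hP : P bad ≤ ENNReal.ofReal (2 * δ) := by
    refine (measure_union_le _ _).trans ?_
    rw [show P {ω | ¬ Continuous fun x => f x ω} = 0 from hcont, add_zero, two_mul,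
      ENNReal.ofReal_add hδ.le hδ.le]
    exact (measure_union_le _ _).trans (add_le_add hP1 hP2)
  -- `bad` need not be measurable, as it involves all paths
  refine ⟨(toMeasurable P bad)ᶜ, (measurableSet_toMeasurable P bad).compl, ?_, ?_⟩
  · rw [prob_compl_eq_one_sub (measurableSet_toMeasurable P bad), measure_toMeasurable,
      ENNReal.ofReal_sub _ (by positivity), ENNReal.ofReal_one]
    exact tsub_le_tsub_left hP 1
  intro ω hω A F ζ
  have hgood : ω ∉ bad := fun h => hω (subset_toMeasurable P bad h)
  simp only [hbad, Set.mem_union, not_or, Set.mem_ofPred_eq, not_not] at hgood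
  obtain ⟨⟨hpost, hcell⟩, hc⟩ := hgood
  have hcells : ∀ v ∈ GPLevelSet.treeNodes H, ∀ x ∈ A.tree.cell v,
      |F x - F (A.tree.center v)| ≤ A.V v.1 := by
    rintro ⟨h, i⟩ hv x hx
    rw [GPLevelSet.mem_treeNodes] at hv
    by_contra hlt
    refine hcell ?_
    simp only [GPLevelSet.cellFailure, Set.mem_iUnion, Finset.mem_range]
    exact ⟨h, by have := hv.1; simp only at this; omega, i, hv.2, hc, x, hx, not_le.1 hlt⟩
  have hrun : GPLevelSet.GoodRun A sel F (fun j => η j ω) H Γ := by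
    refine ⟨hn0, hsel, hA.hmax, hA.one_le, hA.V_nonneg, hA.V_le, hcells, fun t ht v hv => ?_⟩
    by_contra hlt
    exact hpost ⟨t, ht, v, hv, not_le.1 hlt⟩
  obtain ⟨t, ht⟩ := GPLevelSet.exists_halted hrun
  have hinv := GPLevelSet.invariant_run hrun t
  refine ⟨t, ht, fun ε C hε hC ha hpack => ?_, ?_, ?_⟩
  · refine (hinv.loss_le_rate hA ht hk hσ hα hpv hM0 hM hcells ha hC hpack).trans
      (ENNReal.ofReal_le_ofReal ?_)
    have hℓ : 0 ≤ Real.log n := by linarith [show 1 ≤ Real.log n from hA.one_le_log]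
    rw [Real.rpow_natCast]
    have h1 : K₁ ≤ max K₁ K₂ := le_max_left _ _
    change K₁ * (1 + C) * Real.log n ^ 4 * _ ≤ _
    exact mul_le_mul_of_nonneg_right (mul_le_mul_of_nonneg_right
      (mul_le_mul_of_nonneg_right h1 (by linarith)) (pow_nonneg hℓ 4))
      (Real.rpow_nonneg n.cast_nonneg _)
  · refine (hinv.loss_le_sqrt hA ht hτ hpv hcells).trans (ENNReal.ofReal_le_ofReal ?_)
    have hℓ : 0 ≤ Real.log n := by linarith [show 1 ≤ Real.log n from hA.one_le_log]
    have hβ := hA.β_pos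
    rw [Real.rpow_natCast]
    have h1 : K₂ ≤ max K₁ K₂ := le_max_right _ _
    change K₂ * Real.log n ^ 4 * A.β * _ ≤ _
    have h2 : 0 ≤ Real.log n ^ 4 * A.β * √(GPLevelSet.sumPostVar A
      (GPLevelSet.run A sel F (fun j => η j ω) t) / n) := by positivity
    have h3 := mul_le_mul_of_nonneg_right h1 h2
    simp only [← mul_assoc] at h3
    exact h3
  · exact GPLevelSet.sum_postVar_le_infoGain hk hσ hf hη hM _ _
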